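/- Let $\mathfrak{X}$ be a topological space homeomorphic to the Cantor set and let $G$ be the group of all self-homeomorphisms of $\mathfrak{X}$. For $\mathfrak{A} \subset \mathfrak{X}$ put $G\{\mathfrak{A}\} = \{g \in G : g\mathfrak{A} = \mathfrak{A}\}$, and topologize $G$ by taking the subgroups $G\{\mathfrak{A}_1\} \cap \cdots \cap G\{\mathfrak{A}_n\}$, with $\mathfrak{A}_1, \dots, \mathfrak{A}_n$ clopen, as a neighborhood basis of the identity. A finitary $G$-set is a set with an action of $G$ that has open point stabilizers and finitely many orbits; it is transitive if it has exactly one orbit. A measure for $G$ valued in a commutative ring $k$ is a rule $m$ assigning to each $G$-equivariant map $f \colon X \to Y$ of finitary $G$-sets, with $Y$ transitive, an element $m(f) \in k$ such that: (1) $m(f) = 1$ if $f$ is an isomorphism; (2) $m(f) = m(f|_{X_1}) + m(f|_{X_2})$ if $X = X_1 \amalg X_2$ is a decomposition of $G$-sets; (3) $m(g \circ f) = m(g)\, m(f)$ if $g \colon Y \to Z$ is a map of transitive $G$-sets; (4) $m(f') = m(f)$ if $f' \colon X' \to Y'$ is the base change of $f$ along a map $Y' \to Y$ of transitive $G$-sets.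 Write $m(X) = m(X \to \mathbf{1})$, where $\mathbf{1}$ is the one-point $G$-set. The measure $m$ is regular if $m(f)$ is a unit whenever $f$ is a map of transitive $G$-sets. Let $\Theta(G)$ be the quotient of the polynomial ring over $\mathbf{Z}$ in symbols $[f]$, one for each such map $f$, by the relations (1)--(4) with $[f]$ in place of $m(f)$; thus a measure $m$ valued in $k$ induces a ring homomorphism $\Theta(G) \to k$, $[f] \mapsto m(f)$. For $n \ge 1$ let $X(n)$ be the finitary $G$-set of continuous surjections $\mathfrak{X} \to \{1, \dots, n\}$, and let $\mathbf{Z}_{(2)} \subset \mathbf{Q}$ be the ring of rational numbers with odd denominator. Theorem. There are unique regular $\mathbf{Q}$-valued measures $\mu$ and $\nu$ for $G$ with $\mu(X(n)) = (-2)^{n-1}$ and $\nu(X(n)) = (-1)^{n-1}$ for all $n \ge 1$. The homomorphism $\Theta(G) \to \mathbf{Q} \times \mathbf{Q}$ induced by the pair $(\mu, \nu)$ gives a ring isomorphism $$\Theta(G) \cong \mathbf{Z}_{(2)} \times \mathbf{Q}.$$ Consequently, over any field $k$ of characteristic $0$, $G$ has exactly two measures valued in $k$, namely $\mu$ and $\nu$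 (composed with $\mathbf{Q} \subset k$), and these are distinct. -/

import Mathlib

open Function

universe u v w

/-! ### Finitary smooth `G`-sets -/

/-- A finitary `G`-set of a topological group `G`: a set with an action of `G` whose point
stabilizers are open and which has finitely many orbits. -/
structure FinGSet (G : Type u) [Group G] [TopologicalSpace G] : Type (u + 1) where
  carrier : Type u
  [action : MulAction G carrier]
  smooth : ∀ x : carrier, IsOpen (MulAction.stabilizer G x : Set G)
  finitary : Finite (MulAction.orbitRel.Quotient G carrier)

namespace FinGSet

variable {G : Type u} [Group G] [TopologicalSpace G]

instance : CoeSort (FinGSet G) (Type u) := ⟨FinGSet.carrier⟩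

instance (X : FinGSet G) : MulAction G X := X.action

/-- A `G`-set is transitive if it consists of exactly one orbit. -/
def IsTransitive (X : FinGSet G) : Prop :=
  Nonempty X ∧ MulAction.IsPretransitive G X

/-- The equivariant maps `i₁` and `i₂` exhibit `X` as the disjoint union `X₁ ⨿ X₂`. -/
def IsDecomposition {X X₁ X₂ : FinGSet G} (i₁ : X₁ →[G] X) (i₂ : X₂ →[G] X) : Prop :=
  Injective i₁ ∧ Injective i₂ ∧ IsCompl (Set.range i₁) (Set.range i₂)

/-- The square with sides `f' : X' → Y'`, `g' : X' → X`, `f : X → Y`, `g : Y' → Y` is cartesian,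
i.e. it commutes and identifies `X'` with the fiber product of `X` and `Y'` over `Y`. -/
def IsCartesian {X Y X' Y' : FinGSet G}
    (f' : X' →[G] Y') (g' : X' →[G] X) (f : X →[G] Y) (g : Y' →[G] Y) : Prop :=
  (∀ z, f (g' z) = g (f' z)) ∧ ∀ x y', f x = g y' → ∃! z, g' z = x ∧ f' z = y'

/-- The one-point `G`-set. -/
def point (G : Type u) [Group G] [TopologicalSpace G] : FinGSet G where
  carrier := PUnit
  action :=
    { smul := fun _ x => x
      one_smul := fun _ => rfl
      mul_smul := fun _ _ _ => rfl }
  smooth x := by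
    convert isOpen_univ using 1
    exact Set.eq_univ_of_forall fun _ => rfl
  finitary := Quotient.finite _

theorem point_isTransitive : (point G).IsTransitive :=
  ⟨⟨PUnit.unit⟩, ⟨fun _ _ => ⟨1, rfl⟩⟩⟩

/-- The unique map from a `G`-set to the one-point `G`-set. -/
def toPoint (X : FinGSet G) : X →[G] point G where
  toFun _ := PUnit.unit
  map_smul' _ _ := rfl

end FinGSet

/-- A map of finitary `G`-sets with transitive target. -/
structure TMap (G : Type u) [Group G] [TopologicalSpace G] : Type (u + 1) where
  src : FinGSet G
  tgt : FinGSet G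
  hom : src →[G] tgt
  transitive : tgt.IsTransitive

/-! ### Measures -/

/-- A measure for `G` valued in the commutative ring `k`. -/
@[ext]
structure GMeasure (G : Type u) [Group G] [TopologicalSpace G] (k : Type v) [CommRing k] where
  toFun : TMap G → k
  map_iso : ∀ f : TMap G, Bijective f.hom → toFun f = 1
  map_add : ∀ (X X₁ X₂ Y : FinGSet G) (hY : Y.IsTransitive) (f : X →[G] Y)
    (i₁ : X₁ →[G] X) (i₂ : X₂ →[G] X), FinGSet.IsDecomposition i₁ i₂ →
    toFun ⟨X, Y, f, hY⟩ = toFun ⟨X₁, Y, f.comp i₁, hY⟩ + toFun ⟨X₂, Y, f.comp i₂, hY⟩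
  map_comp : ∀ (X Y Z : FinGSet G) (hY : Y.IsTransitive) (hZ : Z.IsTransitive)
    (f : X →[G] Y) (g : Y →[G] Z),
    toFun ⟨X, Z, g.comp f, hZ⟩ = toFun ⟨Y, Z, g, hZ⟩ * toFun ⟨X, Y, f, hY⟩
  map_baseChange : ∀ (X Y X' Y' : FinGSet G) (hY : Y.IsTransitive) (hY' : Y'.IsTransitive)
    (f' : X' →[G] Y') (g' : X' →[G] X) (f : X →[G] Y) (g : Y' →[G] Y),
    FinGSet.IsCartesian f' g' f g → toFun ⟨X', Y', f', hY'⟩ = toFun ⟨X, Y, f, hY⟩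

namespace GMeasure

variable {G : Type u} [Group G] [TopologicalSpace G] {k : Type v} [CommRing k]

/-- The measure `μ(X) = μ(X → 1)` of a finitary `G`-set. -/
def ofSet (μ : GMeasure G k) (X : FinGSet G) : k :=
  μ.toFun ⟨X, FinGSet.point G, X.toPoint, FinGSet.point_isTransitive⟩

/-- A measure is regular if its values on maps between transitive `G`-sets are units. -/
def IsRegular (μ : GMeasure G k) : Prop :=
  ∀ f : TMap G, f.src.IsTransitive → IsUnit (μ.toFun f)

/-- Extension of scalars of a measure along a ring homomorphism. -/
def map {l : Type w} [CommRing l] (φ : k →+* l) (μ : GMeasure G k) : GMeasure G l where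
  toFun f := φ (μ.toFun f)
  map_iso f hf := by rw [μ.map_iso f hf, map_one]
  map_add X X₁ X₂ Y hY f i₁ i₂ h := by rw [μ.map_add X X₁ X₂ Y hY f i₁ i₂ h, _root_.map_add]
  map_comp X Y Z hY hZ f g := by rw [μ.map_comp X Y Z hY hZ f g, map_mul]
  map_baseChange X Y X' Y' hY hY' f' g' f g h := by
    rw [μ.map_baseChange X Y X' Y' hY hY' f' g' f g h]

end GMeasure

/-! ### The ring `Θ(G)` -/

/-- The defining relations of `Θ(G)`: `ThetaRel p` says that `p = 0` is one of them. -/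
inductive ThetaRel (G : Type u) [Group G] [TopologicalSpace G] : MvPolynomial (TMap G) ℤ → Prop
  | iso (f : TMap G) (hf : Bijective f.hom) : ThetaRel G (MvPolynomial.X f - 1)
  | add (X X₁ X₂ Y : FinGSet G) (hY : Y.IsTransitive) (f : X →[G] Y)
      (i₁ : X₁ →[G] X) (i₂ : X₂ →[G] X) (h : FinGSet.IsDecomposition i₁ i₂) :
      ThetaRel G (MvPolynomial.X ⟨X, Y, f, hY⟩ -
        (MvPolynomial.X ⟨X₁, Y, f.comp i₁, hY⟩ + MvPolynomial.X ⟨X₂, Y, f.comp i₂, hY⟩))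
  | comp (X Y Z : FinGSet G) (hY : Y.IsTransitive) (hZ : Z.IsTransitive)
      (f : X →[G] Y) (g : Y →[G] Z) :
      ThetaRel G (MvPolynomial.X ⟨X, Z, g.comp f, hZ⟩ -
        MvPolynomial.X ⟨Y, Z, g, hZ⟩ * MvPolynomial.X ⟨X, Y, f, hY⟩)
  | baseChange (X Y X' Y' : FinGSet G) (hY : Y.IsTransitive) (hY' : Y'.IsTransitive)
      (f' : X' →[G] Y') (g' : X' →[G] X) (f : X →[G] Y) (g : Y' →[G] Y)
      (h : FinGSet.IsCartesian f' g' f g) :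
      ThetaRel G (MvPolynomial.X ⟨X', Y', f', hY'⟩ - MvPolynomial.X ⟨X, Y, f, hY⟩)

/-- The ideal generated by the defining relations of `Θ(G)`. -/
noncomputable def thetaIdeal (G : Type u) [Group G] [TopologicalSpace G] : Ideal (MvPolynomial (TMap G) ℤ) :=
  Ideal.span {p | ThetaRel G p}

/-- The ring `Θ(G)`: the polynomial ring in symbols `[f]` modulo the defining relations. -/
abbrev Theta (G : Type u) [Group G] [TopologicalSpace G] : Type (u + 1) :=
  MvPolynomial (TMap G) ℤ ⧸ thetaIdeal G

namespace Theta

variable {G : Type u} [Group G] [TopologicalSpace G] {k : Type v} [CommRing k]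

/-- The class `[f]` in `Θ(G)`. -/
noncomputable def cls (f : TMap G) : Theta G := Ideal.Quotient.mk (thetaIdeal G) (MvPolynomial.X f)

theorem mk_eq_of_rel {p q : MvPolynomial (TMap G) ℤ} (h : ThetaRel G (p - q)) :
    Ideal.Quotient.mk (thetaIdeal G) p = Ideal.Quotient.mk (thetaIdeal G) q :=
  Ideal.Quotient.eq.2 (Ideal.subset_span h)

/-- The universal measure `f ↦ [f]`, valued in `Θ(G)`. -/
noncomputable def univMeasure (G : Type u) [Group G] [TopologicalSpace G] : GMeasure G (Theta G) where
  toFun := cls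
  map_iso f hf := mk_eq_of_rel (.iso f hf)
  map_add X X₁ X₂ Y hY f i₁ i₂ h := mk_eq_of_rel (.add X X₁ X₂ Y hY f i₁ i₂ h)
  map_comp X Y Z hY hZ f g := mk_eq_of_rel (.comp X Y Z hY hZ f g)
  map_baseChange X Y X' Y' hY hY' f' g' f g h :=
    mk_eq_of_rel (.baseChange X Y X' Y' hY hY' f' g' f g h)

theorem eval_eq_zero (μ : GMeasure G k) (p : MvPolynomial (TMap G) ℤ) (hp : p ∈ thetaIdeal G) :
    MvPolynomial.eval₂Hom (Int.castRingHom k) μ.toFun p = 0 := by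
  refine (Ideal.span_le (I := RingHom.ker
    (MvPolynomial.eval₂Hom (Int.castRingHom k) μ.toFun))).2 ?_ hp
  intro q hq
  simp only [SetLike.mem_coe, RingHom.mem_ker]
  induction hq with
  | iso f hf => simp [μ.map_iso f hf]
  | add X X₁ X₂ Y hY f i₁ i₂ h => simp [μ.map_add X X₁ X₂ Y hY f i₁ i₂ h]
  | comp X Y Z hY hZ f g => simp [μ.map_comp X Y Z hY hZ f g]
  | baseChange X Y X' Y' hY hY' f' g' f g h =>
    simp [μ.map_baseChange X Y X' Y' hY hY' f' g' f g h]

/-- The ring homomorphism `Θ(G) → k` induced by a measure, sending `[f]` to `μ(f)`. -/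
noncomputable def lift (μ : GMeasure G k) : Theta G →+* k :=
  Ideal.Quotient.lift (thetaIdeal G) (MvPolynomial.eval₂Hom (Int.castRingHom k) μ.toFun)
    (eval_eq_zero μ)

theorem lift_cls (μ : GMeasure G k) (f : TMap G) : lift μ (cls f) = μ.toFun f := by
  rw [lift, cls, Ideal.Quotient.lift_mk]
  simp

end Theta

/-! ### The homeomorphism group of the Cantor set -/

/-- A Cantor space: a topological space homeomorphic to the Cantor set. -/
class IsCantorSpace (𝔛 : Type u) [TopologicalSpace 𝔛] : Prop where
  nonempty_homeomorph : Nonempty (𝔛 ≃ₜ cantorSet)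

section HomeoGroup

variable (𝔛 : Type u) [TopologicalSpace 𝔛]

/-- The subgroups `G{𝔄₁} ∩ ⋯ ∩ G{𝔄ₙ}` of the homeomorphism group `G` of `𝔛`, where the `𝔄ᵢ` are
clopen and `G{𝔄}` is the group of all `g` with `g 𝔄 = 𝔄`. -/
abbrev homeoBasis : GroupFilterBasis (𝔛 ≃ₜ 𝔛) where
  sets := {U | ∃ s : Set (Set 𝔛), s.Finite ∧ (∀ A ∈ s, IsClopen A) ∧
    U = {g : 𝔛 ≃ₜ 𝔛 | ∀ A ∈ s, g '' A = A}}
  nonempty := ⟨_, ∅, Set.finite_empty, by simp, rfl⟩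
  inter_sets := by
    rintro _ _ ⟨s, hs, hs', rfl⟩ ⟨t, ht, ht', rfl⟩
    refine ⟨_, ⟨s ∪ t, hs.union ht, ?_, rfl⟩, ?_⟩
    · rintro A (hA | hA)
      exacts [hs' A hA, ht' A hA]
    · intro g hg
      exact ⟨fun A hA => hg A (Or.inl hA), fun A hA => hg A (Or.inr hA)⟩
  one' := by
    rintro _ ⟨s, hs, hs', rfl⟩ A _
    exact Set.image_id A
  mul' := by
    rintro _ ⟨s, hs, hs', rfl⟩
    refine ⟨_, ⟨s, hs, hs', rfl⟩, ?_⟩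
    rintro _ ⟨g, hg, h, hh, rfl⟩ A hA
    change (g ∘ h) '' A = A
    rw [Set.image_comp, hh A hA, hg A hA]
  inv' := by
    rintro _ ⟨s, hs, hs', rfl⟩
    refine ⟨_, ⟨s, hs, hs', rfl⟩, ?_⟩
    intro g hg A hA
    change g.symm '' A = A
    conv_lhs => rw [← hg A hA]
    rw [← Set.image_comp]
    simp
  conj' := by
    rintro x _ ⟨s, hs, hs', rfl⟩
    refine ⟨_, ⟨(fun A => x.symm '' A) '' s, hs.image _, ?_, rfl⟩, ?_⟩
    · rintro _ ⟨A, hA, rfl⟩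
      exact ⟨x.symm.isClosedMap _ (hs' A hA).1, x.symm.isOpenMap _ (hs' A hA).2⟩
    · intro g hg A hA
      have := hg _ ⟨A, hA, rfl⟩
      change (x ∘ g ∘ x.symm) '' A = A
      rw [Set.image_comp, Set.image_comp, this, ← Set.image_comp]
      simp

/-- The homeomorphism group is topologized by taking the subgroups of `homeoBasis` as a
neighborhood basis of the identity. -/
instance homeoTopology : TopologicalSpace (𝔛 ≃ₜ 𝔛) := (homeoBasis 𝔛).topology

instance homeo_isTopologicalGroup : IsTopologicalGroup (𝔛 ≃ₜ 𝔛) :=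
  (homeoBasis 𝔛).isTopologicalGroup

/-- The set of all continuous surjections from `𝔛` to the discrete space with `n` points. -/
def ContSurj (n : ℕ) : Type u := {φ : C(𝔛, Fin n) // Surjective φ}

/-- The group of self-homeomorphisms acts on `ContSurj 𝔛 n` by `g • φ = φ ∘ g⁻¹`. -/
instance (n : ℕ) : MulAction (𝔛 ≃ₜ 𝔛) (ContSurj 𝔛 n) where
  smul g φ := ⟨φ.1.comp (g⁻¹ : 𝔛 ≃ₜ 𝔛), φ.2.comp (g⁻¹ : 𝔛 ≃ₜ 𝔛).surjective⟩
  one_smul _ := rfl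
  mul_smul _ _ _ := rfl

variable {𝔛}

theorem contSurj_smul_apply {n : ℕ} (g : 𝔛 ≃ₜ 𝔛) (φ : ContSurj 𝔛 n) (x : 𝔛) :
    (g • φ).1 x = φ.1 (g.symm x) := rfl

theorem contSurj_smooth {n : ℕ} (φ : ContSurj 𝔛 n) :
    IsOpen (MulAction.stabilizer (𝔛 ≃ₜ 𝔛) φ : Set (𝔛 ≃ₜ 𝔛)) := by
  apply Subgroup.isOpen_of_mem_nhds (g := 1)
  refine (homeoBasis 𝔛).nhds_one_hasBasis.mem_iff.2
    ⟨_, ⟨Set.range fun i : Fin n => φ.1 ⁻¹' {i}, Set.finite_range _, ?_, rfl⟩, ?_⟩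
  · rintro _ ⟨i, rfl⟩
    exact (isClopen_discrete _).preimage φ.1.continuous
  · intro g hg
    apply Subtype.ext
    ext1 x
    rw [contSurj_smul_apply]
    have h := hg _ ⟨φ.1 x, rfl⟩
    have hx : x ∈ g '' (φ.1 ⁻¹' {φ.1 x}) := by rw [h]; rfl
    obtain ⟨y, hy, rfl⟩ := hx
    rw [g.symm_apply_apply]
    exact hy

/-- A clopen subset of `ℕ → Bool` is determined by finitely many coordinates. -/
theorem clopen_finite_level {U : Set (ℕ → Bool)} (hU : IsClopen U) :
    ∃ n : ℕ, ∀ x y : ℕ → Bool, (∀ i < n, x i = y i) → x ∈ U → y ∈ U := by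
  by_contra! hcon
  let K : ℕ → Set ((ℕ → Bool) × (ℕ → Bool)) := fun n =>
    {p | (∀ i < n, p.1 i = p.2 i) ∧ p.1 ∈ U ∧ p.2 ∈ Uᶜ}
  have hcl : ∀ n, IsClosed (K n) := by
    intro n
    refine IsClosed.inter ?_ ((hU.1.preimage continuous_fst).inter
      (hU.compl.1.preimage continuous_snd))
    have : {p : (ℕ → Bool) × (ℕ → Bool) | ∀ i < n, p.1 i = p.2 i} =
        ⋂ i, ⋂ (_ : i < n), {p | p.1 i = p.2 i} := by ext; simp
    change IsClosed {p : (ℕ → Bool) × (ℕ → Bool) | ∀ i < n, p.1 i = p.2 i}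
    rw [this]
    exact isClosed_iInter fun i => isClosed_iInter fun _ =>
      isClosed_eq (by fun_prop) (by fun_prop)
  obtain ⟨p, hp⟩ := IsCompact.nonempty_iInter_of_sequence_nonempty_isCompact_isClosed K
    (fun n p hp => ⟨fun i hi => hp.1 i (hi.trans n.lt_succ_self), hp.2⟩)
    (fun n => by
      obtain ⟨x, y, h1, h2, h3⟩ := hcon n
      exact ⟨(x, y), h1, h2, h3⟩)
    (hcl 0).isCompact hcl
  rw [Set.mem_iInter] at hp
  have : p.1 = p.2 := funext fun i => (hp (i + 1)).1 i i.lt_succ_self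
  exact (hp 0).2.2 (this ▸ (hp 0).2.1)

/-- Prepending a bit to a sequence of bits. -/
def bitCons (b : Bool) (x : ℕ → Bool) : ℕ → Bool
  | 0 => b
  | n + 1 => x n

theorem bitCons_tail (x : ℕ → Bool) : bitCons (x 0) (fun n => x (n + 1)) = x := by
  funext n
  cases n <;> rfl

theorem continuous_bitCons : Continuous fun p : Bool × (ℕ → Bool) => bitCons p.1 p.2 := by
  refine continuous_pi fun n => ?_
  cases n with
  | zero => exact continuous_fst
  | succ n => exact (continuous_apply n).comp continuous_snd

theorem bitCons_inj {b c : Bool} {x y : ℕ → Bool} (h : bitCons b x = bitCons c y) :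
    b = c ∧ x = y :=
  ⟨congrFun h 0, funext fun n => congrFun h (n + 1)⟩

theorem level_parametrization (n : ℕ) : ∀ U : Set (ℕ → Bool), U.Nonempty →
    (∀ x y : ℕ → Bool, (∀ i < n, x i = y i) → x ∈ U → y ∈ U) →
    ∃ f : (ℕ → Bool) → (ℕ → Bool), Continuous f ∧ Injective f ∧ Set.range f = U := by
  induction n with
  | zero =>
    rintro U ⟨x, hx⟩ h
    refine ⟨id, continuous_id, injective_id, ?_⟩
    rw [Set.range_id, eq_comm, Set.eq_univ_iff_forall]
    exact fun y => h x y (by simp) hx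
  | succ n ih =>
    intro U hne h
    have hV : ∀ b, (bitCons b ⁻¹' U).Nonempty → ∃ f : (ℕ → Bool) → (ℕ → Bool),
        Continuous f ∧ Injective f ∧ Set.range f = bitCons b ⁻¹' U := by
      intro b hb
      refine ih _ hb fun x y hxy hx => h _ _ ?_ hx
      rintro (_ | i) hi
      · rfl
      · exact hxy i (by omega)
    by_cases hall : ∀ b, (bitCons b ⁻¹' U).Nonempty
    · choose f hc hi hr using fun b => hV b (hall b)
      refine ⟨fun x => bitCons (x 0) (f (x 0) fun n => x (n + 1)), ?_, ?_, ?_⟩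
      · have hf : Continuous fun p : Bool × (ℕ → Bool) => f p.1 p.2 :=
          continuous_prod_of_discrete_left.2 hc
        have ht : Continuous fun x : ℕ → Bool => fun n => x (n + 1) :=
          continuous_pi fun n => continuous_apply _
        exact continuous_bitCons.comp
          ((continuous_apply 0).prodMk (hf.comp ((continuous_apply 0).prodMk ht)))
      · intro x y hxy
        obtain ⟨h0, h1⟩ := bitCons_inj hxy
        rw [h0] at h1
        rw [← bitCons_tail x, ← bitCons_tail y, h0, hi _ h1]
      · ext y
        constructor
        · rintro ⟨x, rfl⟩
          have : f (x 0) (fun n => x (n + 1)) ∈ bitCons (x 0) ⁻¹' U := hr _ ▸ ⟨_, rfl⟩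
          exact this
        · intro hy
          have : (fun n => y (n + 1)) ∈ Set.range (f (y 0)) := by
            rw [hr, Set.mem_preimage, bitCons_tail]; exact hy
          obtain ⟨x, hx⟩ := this
          refine ⟨bitCons (y 0) x, ?_⟩
          change bitCons (y 0) (f (y 0) x) = y
          rw [hx, bitCons_tail]
    · obtain ⟨b, hb⟩ := not_forall.1 hall
      have hU : ∀ y ∈ U, y 0 = !b := by
        intro y hy
        by_contra hne'
        refine hb ⟨fun n => y (n + 1), ?_⟩
        have : y 0 = b := by cases hy0 : y 0 <;> cases b <;> simp_all
        rw [Set.mem_preimage, ← this, bitCons_tail]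
        exact hy
      obtain ⟨f, hc, hi, hr⟩ := hV (!b) (by
        obtain ⟨y, hy⟩ := hne
        refine ⟨fun n => y (n + 1), ?_⟩
        rw [Set.mem_preimage, ← hU y hy, bitCons_tail]
        exact hy)
      refine ⟨fun x => bitCons (!b) (f x), ?_, ?_, ?_⟩
      · exact continuous_bitCons.comp (continuous_const.prodMk hc)
      · exact fun x y hxy => hi (bitCons_inj hxy).2
      · ext y
        constructor
        · rintro ⟨x, rfl⟩
          have : f x ∈ bitCons (!b) ⁻¹' U := hr ▸ ⟨_, rfl⟩
          exact this
        · intro hy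
          have : (fun n => y (n + 1)) ∈ Set.range f := by
            rw [hr, Set.mem_preimage, ← hU y hy, bitCons_tail]; exact hy
          obtain ⟨x, hx⟩ := this
          refine ⟨x, ?_⟩
          change bitCons (!b) (f x) = y
          rw [hx, ← hU y hy, bitCons_tail]

/-- The fibers of a continuous surjection from a Cantor space to a finite set are Cantor
spaces. -/
theorem contSurj_parametrization [IsCantorSpace 𝔛] {n : ℕ} (φ : ContSurj 𝔛 n) :
    ∃ F : (Fin n × (ℕ → Bool)) ≃ₜ 𝔛, ∀ i c, φ.1 (F (i, c)) = i := by
  obtain ⟨e₀⟩ := IsCantorSpace.nonempty_homeomorph (𝔛 := 𝔛)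
  let e : 𝔛 ≃ₜ (ℕ → Bool) := e₀.trans cantorSetHomeomorphNatToBool
  have key : ∀ i : Fin n, ∃ f : (ℕ → Bool) → 𝔛, Continuous f ∧ Injective f ∧
      Set.range f = φ.1 ⁻¹' {i} := by
    intro i
    have hcl : IsClopen (e.symm ⁻¹' (φ.1 ⁻¹' {i})) :=
      ((isClopen_discrete {i}).preimage φ.1.continuous).preimage e.symm.continuous
    obtain ⟨m, hm⟩ := clopen_finite_level hcl
    obtain ⟨x, hx⟩ := φ.2 i
    obtain ⟨f, hc, hi, hr⟩ := level_parametrization m _ ⟨e x, by simpa using hx⟩ hm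
    refine ⟨e.symm ∘ f, e.symm.continuous.comp hc, e.symm.injective.comp hi, ?_⟩
    rw [Set.range_comp, hr, Set.image_preimage_eq _ e.symm.surjective]
  choose f hc hi hr using key
  have hφ : ∀ i c, φ.1 (f i c) = i := by
    intro i c
    have : f i c ∈ φ.1 ⁻¹' {i} := hr i ▸ ⟨c, rfl⟩
    exact this
  have hbij : Bijective fun p : Fin n × (ℕ → Bool) => f p.1 p.2 := by
    constructor
    · rintro ⟨i, c⟩ ⟨j, d⟩ h
      have hij : i = j := by
        rw [← hφ i c, ← hφ j d]
        exact congrArg _ h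
      subst hij
      exact Prod.ext rfl (hi i h)
    · intro x
      have : x ∈ Set.range (f (φ.1 x)) := by rw [hr]; rfl
      obtain ⟨c, hc⟩ := this
      exact ⟨(φ.1 x, c), hc⟩
  have : T2Space 𝔛 := e.symm.t2Space
  have hcont : Continuous (Equiv.ofBijective _ hbij) := continuous_prod_of_discrete_left.2 hc
  exact ⟨hcont.homeoOfEquivCompactToT2, hφ⟩

theorem contSurj_isPretransitive [IsCantorSpace 𝔛] (n : ℕ) :
    MulAction.IsPretransitive (𝔛 ≃ₜ 𝔛) (ContSurj 𝔛 n) := by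
  constructor
  intro φ ψ
  obtain ⟨F, hF⟩ := contSurj_parametrization φ
  obtain ⟨H, hH⟩ := contSurj_parametrization ψ
  refine ⟨F.symm.trans H, Subtype.ext ?_⟩
  ext1 x
  rw [contSurj_smul_apply]
  change φ.1 (F (H.symm x)) = _
  obtain ⟨⟨i, c⟩, rfl⟩ := H.surjective x
  rw [H.symm_apply_apply, hF, hH]

variable (𝔛)

/-- The finitary `G`-set `X(n)` of continuous surjections `𝔛 → {1, …, n}`, where `G` is the
homeomorphism group of the Cantor space `𝔛`. -/
def cantorX [IsCantorSpace 𝔛] (n : ℕ) : FinGSet (𝔛 ≃ₜ 𝔛) where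
  carrier := ContSurj 𝔛 n
  smooth := contSurj_smooth
  finitary := by
    have := contSurj_isPretransitive (𝔛 := 𝔛) n
    have : Subsingleton (MulAction.orbitRel.Quotient (𝔛 ≃ₜ 𝔛) (ContSurj 𝔛 n)) :=
      (MulAction.pretransitive_iff_subsingleton_quotient _ _).1 this
    infer_instance

/-- `m` is a regular measure with `m(X(n)) = α ^ (n - 1)` for all `n ≥ 1`. -/
def IsPowerMeasure [IsCantorSpace 𝔛] (α : ℚ) (m : GMeasure (𝔛 ≃ₜ 𝔛) ℚ) : Prop :=
  m.IsRegular ∧ ∀ n : ℕ, 1 ≤ n → m.ofSet (cantorX 𝔛 n) = α ^ (n - 1)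

end HomeoGroup

/-- The ring `ℤ₍₂₎` of rational numbers with odd denominator. -/
def ZLocTwo : Subring ℚ where
  carrier := {q | Odd q.den}
  mul_mem' {a b} ha hb := Odd.of_dvd_nat (Odd.mul ha hb) (Rat.mul_den_dvd a b)
  one_mem' := by simp
  add_mem' {a b} ha hb := Odd.of_dvd_nat (Odd.mul ha hb) (Rat.add_den_dvd a b)
  zero_mem' := by simp
  neg_mem' {a} ha := by simpa using ha

/-! ### Homeomorphisms of clopen sets: extension, gluing, generation by overlapping supports -/

section Topology

variable {𝔛 : Type u} [TopologicalSpace 𝔛]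

/-! Open subgroups of `G` are controlled by clopen partitions. Homeomorphisms supported in two
overlapping clopen sets generate all those supported in the union (`homeoSupportedIn_union_le`).
Hence the fixers of two partitions generate the fixer of their join, and every open subgroup `U`
contains the fixer of a coarsest partition `coarsest U`, whose classes it permutes through a finite
group of order `symIndex U`. So every transitive set has a finite cover by the coset space of a
fixer, and base change forces every measure to take the value `d` on a cover of degree `d`. What is
left are the maps between coset spaces of fixers, which are composites of splits of one class into
two.

Orbits on a fibre product of such coset spaces correspond to incidence relations between classes
(`orbitSum_cartesian`). Against a split, with `n` classes over the split class and `l` others, the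
relations have generating function `z^l (2z + z²)^n - 2 z^(n+l)` (`sum_totalRelations`). This count
works in both directions. For existence, give `U` the weight `a^c / symIndex U`, where `c` is the
number of classes of `coarsest U`; quotients of total weights respect base change once the count at
`z = a` is `a^(n+l+1)`, that is, `(2 + a)^n = 2 + a` for `n ≥ 1`, which leaves `a = -2` and `a =
-1`. Conversely, for a measure in any ring the value on splits is a constant `a` with `(a + 1)(a +
2) = 0` (`exists_isRelValue_pow`), and it determines all values up to division by symmetry indices
(`symIndex_mul_map`). This gives uniqueness in characteristic zero.

In `Θ(G)` the universal `a` satisfies the same equation, and `a + 1`, `a + 2` are comaximal, so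
`Θ(G)` is the product of its quotients at `a = -2` and `a = -1`. A cyclic group permuting `d`
classes yields a set of measure `x` with `d x = a^(d-1)`, so `d` becomes invertible when prime to
`a`: odd `d` in the first quotient, all `d ≠ 0` in the second. It remains to bound denominators
without dividing, since torsion is not excluded beforehand. For `a = -1` nothing more is needed. For
`a = -2` only odd denominators may occur, which is shown by induction on the symmetry index
(`valueSubgroup_le_fractionSubring`): after an orbit of classes is cut in two, either the index
drops, or the pieces on one side can be merged, which exhibits a factor `-2`. Every value is thus a
controlled one plus twice another value, and since a factorial clears all denominators, finitely
many rounds suffice. -/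

instance IsCantorSpace.compactSpace [IsCantorSpace 𝔛] : CompactSpace 𝔛 := by
  obtain ⟨e⟩ := IsCantorSpace.nonempty_homeomorph (𝔛 := 𝔛)
  exact (e.trans cantorSetHomeomorphNatToBool).symm.compactSpace

instance IsCantorSpace.t2Space [IsCantorSpace 𝔛] : T2Space 𝔛 := by
  obtain ⟨e⟩ := IsCantorSpace.nonempty_homeomorph (𝔛 := 𝔛)
  exact (e.trans cantorSetHomeomorphNatToBool).symm.t2Space

instance IsCantorSpace.nonempty [IsCantorSpace 𝔛] : Nonempty 𝔛 := by
  obtain ⟨e⟩ := IsCantorSpace.nonempty_homeomorph (𝔛 := 𝔛)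
  exact ⟨(e.trans cantorSetHomeomorphNatToBool).symm fun _ => true⟩

/-- Two locally constant maps with the same range differ by a homeomorphism. -/
theorem exists_homeo_comp_eq [IsCantorSpace 𝔛] {ι : Type w} {φ ψ : 𝔛 → ι}
    (hφ : IsLocallyConstant φ) (hψ : IsLocallyConstant ψ) (h : Set.range φ = Set.range ψ) :
    ∃ g : 𝔛 ≃ₜ 𝔛, ∀ x, ψ (g x) = φ x := by
  have hfin : Finite (Set.range φ) := hφ.range_finite
  obtain ⟨n, ⟨e⟩⟩ := Finite.exists_equiv_fin (Set.range φ)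
  have hφc : IsLocallyConstant fun x => e ⟨φ x, x, rfl⟩ := by
    refine (IsLocallyConstant.iff_eventually_eq _).2 fun x => ?_
    filter_upwards [(IsLocallyConstant.iff_eventually_eq _).1 hφ x] with y hy
    exact congrArg e (Subtype.ext hy)
  have hψc : IsLocallyConstant fun x => e ⟨ψ x, h ▸ ⟨x, rfl⟩⟩ := by
    refine (IsLocallyConstant.iff_eventually_eq _).2 fun x => ?_
    filter_upwards [(IsLocallyConstant.iff_eventually_eq _).1 hψ x] with y hy
    exact congrArg e (Subtype.ext hy)
  -- Read through `e`, both maps become surjections onto `Fin n`, where the transitivity of `G` on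
  -- `ContSurj 𝔛 n` applies.
  let φ' : ContSurj 𝔛 n := ⟨⟨_, hφc.continuous⟩, fun i => by
    obtain ⟨x, hx⟩ := (e.symm i).2
    exact ⟨x, by exact e.eq_symm_apply.1 (Subtype.ext hx)⟩⟩
  let ψ' : ContSurj 𝔛 n := ⟨⟨_, hψc.continuous⟩, fun i => by
    obtain ⟨x, hx⟩ : (e.symm i : ι) ∈ Set.range ψ := by rw [← h]; exact (e.symm i).2
    exact ⟨x, by exact e.eq_symm_apply.1 (Subtype.ext hx)⟩⟩
  obtain ⟨g, hg⟩ := (contSurj_isPretransitive (𝔛 := 𝔛) n).exists_smul_eq φ' ψ'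
  refine ⟨g, fun x => ?_⟩
  have h1 : (g • φ').1 (g x) = ψ'.1 (g x) := by rw [hg]
  rw [contSurj_smul_apply, g.symm_apply_apply] at h1
  exact congrArg Subtype.val (e.injective h1).symm

/-- Gluing two homeomorphisms along a clopen set with the same images. -/
theorem exists_glue [IsCantorSpace 𝔛] {A : Set 𝔛} (hA : IsClopen A) (g h : 𝔛 ≃ₜ 𝔛)
    (hgh : g '' A = h '' A) :
    ∃ k : 𝔛 ≃ₜ 𝔛, (∀ x ∈ A, k x = g x) ∧ ∀ x ∉ A, k x = h x := by
  classical
  let f : 𝔛 → 𝔛 := A.piecewise g h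
  have hc : Continuous f := by
    refine continuous_iff_continuousAt.2 fun x => ?_
    by_cases hx : x ∈ A
    · refine (g.continuous.continuousAt (x := x)).congr ?_
      filter_upwards [hA.isOpen.mem_nhds hx] with y hy
      exact (Set.piecewise_eq_of_mem _ _ _ hy).symm
    · refine (h.continuous.continuousAt (x := x)).congr ?_
      filter_upwards [hA.compl.isOpen.mem_nhds hx] with y hy
      exact (Set.piecewise_eq_of_notMem _ _ _ hy).symm
  have h1 : ∀ x ∈ A, f x = g x := fun x hx => Set.piecewise_eq_of_mem _ _ _ hx
  have h2 : ∀ x ∉ A, f x = h x := fun x hx => Set.piecewise_eq_of_notMem _ _ _ hx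
  have h3 : ∀ x y, x ∈ A → y ∉ A → g x ≠ h y := by
    intro x y hx hy hxy
    have : h y ∈ h '' A := by rw [← hgh, ← hxy]; exact ⟨x, hx, rfl⟩
    exact hy ((h.injective.mem_set_image).1 this)
  have hb : Bijective f := by
    constructor
    · intro x y hxy
      by_cases hx : x ∈ A <;> by_cases hy : y ∈ A
      · rw [h1 x hx, h1 y hy] at hxy; exact g.injective hxy
      · rw [h1 x hx, h2 y hy] at hxy; exact (h3 x y hx hy hxy).elim
      · rw [h2 x hx, h1 y hy] at hxy; exact (h3 y x hy hx hxy.symm).elim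
      · rw [h2 x hx, h2 y hy] at hxy; exact h.injective hxy
    · intro y
      by_cases hy : y ∈ h '' A
      · rw [← hgh] at hy
        obtain ⟨x, hx, rfl⟩ := hy
        exact ⟨x, h1 x hx⟩
      · obtain ⟨x, rfl⟩ := h.surjective y
        exact ⟨x, h2 x fun hx => hy ⟨x, hx, rfl⟩⟩
  have hc' : Continuous (Equiv.ofBijective f hb) := hc
  exact ⟨hc'.homeoOfEquivCompactToT2, h1, h2⟩

/-- The group of homeomorphisms supported in `A`. -/
def homeoSupportedIn (A : Set 𝔛) : Subgroup (𝔛 ≃ₜ 𝔛) where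
  carrier := {g | ∀ x ∉ A, g x = x}
  one_mem' _ _ := rfl
  mul_mem' {g h} hg hh x hx := by
    change g (h x) = x
    rw [hh x hx, hg x hx]
  inv_mem' {g} hg x hx := by
    change g.symm x = x
    rw [g.symm_apply_eq, hg x hx]

theorem homeoSupportedIn_mono {A B : Set 𝔛} (h : A ⊆ B) :
    homeoSupportedIn A ≤ homeoSupportedIn B :=
  fun _ hg x hx => hg x fun hxA => hx (h hxA)

theorem mem_of_mem_homeoSupportedIn {A : Set 𝔛} {g : 𝔛 ≃ₜ 𝔛} (hg : g ∈ homeoSupportedIn A)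
    {x : 𝔛} (hx : x ∈ A) : g x ∈ A := by
  by_contra h
  have := hg _ h
  rw [g.injective this] at h
  exact h hx

theorem isLocallyConstant_mem {A : Set 𝔛} (hA : IsClopen A) : IsLocallyConstant (· ∈ A) := by
  refine (IsLocallyConstant.iff_eventually_eq _).2 fun x => ?_
  by_cases hx : x ∈ A
  · filter_upwards [hA.isOpen.mem_nhds hx] with y hy
    simp only [eq_iff_iff]; exact iff_of_true hy hx
  · filter_upwards [hA.compl.isOpen.mem_nhds hx] with y hy
    simp only [eq_iff_iff]; exact iff_of_false hy hx

theorem image_eq_of_mem_iff {A B : Set 𝔛} {g : 𝔛 ≃ₜ 𝔛} (h : ∀ x, g x ∈ B ↔ x ∈ A) :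
    g '' A = B := by
  ext y
  constructor
  · rintro ⟨x, hx, rfl⟩
    exact (h x).2 hx
  · intro hy
    obtain ⟨x, rfl⟩ := g.surjective y
    exact ⟨x, (h x).1 hy, rfl⟩

/-- Inside a clopen set, any homeomorphism between nonempty proper clopen subsets extends. -/
theorem exists_supported_extension [IsCantorSpace 𝔛] {A E F : Set 𝔛} (hA : IsClopen A)
    (hE : IsClopen E) (hF : IsClopen F) (hEA : E ⊆ A) (hFA : F ⊆ A)
    (hE' : (A \ E).Nonempty) (hF' : (A \ F).Nonempty) (p : 𝔛 ≃ₜ 𝔛) (hp : p '' E = F) :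
    ∃ k ∈ homeoSupportedIn A, ∀ x ∈ E, k x = p x := by
  rcases E.eq_empty_or_nonempty with rfl | hEn
  · exact ⟨1, one_mem _, fun x hx => hx.elim⟩
  have hFn : F.Nonempty := hp ▸ hEn.image p
  -- The joint range of the two membership functions is the same for `E` and `F`, so a homeomorphism
  -- matches them.
  have hr : ∀ D : Set 𝔛, D ⊆ A → D.Nonempty → (A \ D).Nonempty →
      Set.range (fun x => ((x ∈ A : Prop), (x ∈ D : Prop))) =
        {q | (q = (True, True)) ∨ (q = (True, False)) ∨ (q = (False, False) ∧ ∃ x, x ∉ A)} := by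
    intro D hDA hD hD'
    ext q
    simp only [Set.mem_range, Set.mem_ofPred_eq]
    constructor
    · rintro ⟨x, rfl⟩
      by_cases hxA : x ∈ A
      · by_cases hxD : x ∈ D
        · left; simp [hxA, hxD]
        · right; left; simp [hxA, hxD]
      · right; right
        refine ⟨?_, x, hxA⟩
        have : x ∉ D := fun h => hxA (hDA h)
        simp [hxA, this]
    · rintro (rfl | rfl | ⟨rfl, x, hx⟩)
      · obtain ⟨x, hx⟩ := hD
        exact ⟨x, by simp [hx, hDA hx]⟩
      · obtain ⟨x, hx⟩ := hD'
        exact ⟨x, by simp [hx.1, hx.2]⟩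
      · refine ⟨x, ?_⟩
        have : x ∉ D := fun h => hx (hDA h)
        simp [hx, this]
  have hlc : ∀ D : Set 𝔛, IsClopen D →
      IsLocallyConstant (fun x => ((x ∈ A : Prop), (x ∈ D : Prop))) := by
    intro D hD
    exact (isLocallyConstant_mem hA).prodMk (isLocallyConstant_mem hD)
  -- `h` preserves `A` and carries `E` to `F`, but ignores `p`. Two gluings then install `p` on `E`
  -- and the identity outside `A`.
  obtain ⟨h, hh⟩ := exists_homeo_comp_eq (hlc E hE) (hlc F hF)
    ((hr E hEA hEn hE').trans (hr F hFA hFn hF').symm)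
  have hhA : ∀ x, h x ∈ A ↔ x ∈ A := fun x => by
    have := congrArg Prod.fst (hh x); simpa using this
  have hhE : ∀ x, h x ∈ F ↔ x ∈ E := fun x => by
    have := congrArg Prod.snd (hh x); simpa using this
  obtain ⟨k1, hk1, hk1'⟩ := exists_glue hE p h (hp.trans (image_eq_of_mem_iff hhE).symm)
  have hk1A : k1 '' A = A := by
    refine image_eq_of_mem_iff fun x => ?_
    by_cases hx : x ∈ E
    · rw [hk1 x hx]
      have : p x ∈ F := hp ▸ ⟨x, hx, rfl⟩
      exact iff_of_true (hFA this) (hEA hx)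
    · rw [hk1' x hx, hhA]
  obtain ⟨k, hk, hk'⟩ := exists_glue hA k1 1 (hk1A.trans (Set.image_id A).symm)
  exact ⟨k, fun x hx => hk' x hx, fun x hx => by rw [hk x (hEA hx), hk1 x hx]⟩

theorem exists_supported_map [IsCantorSpace 𝔛] {A E F : Set 𝔛} (hA : IsClopen A)
    (hE : IsClopen E) (hF : IsClopen F) (hEA : E ⊆ A) (hFA : F ⊆ A)
    (hEn : E.Nonempty) (hFn : F.Nonempty) (hE' : (A \ E).Nonempty) (hF' : (A \ F).Nonempty) :
    ∃ k ∈ homeoSupportedIn A, k '' E = F := by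
  have hr : ∀ D : Set 𝔛, D.Nonempty → (∃ x, x ∉ D) →
      Set.range (· ∈ D) = Set.univ := by
    rintro D ⟨x, hx⟩ ⟨y, hy⟩
    refine Set.eq_univ_of_forall fun q => ?_
    by_cases hq : q
    · exact ⟨x, by simp [hx, hq]⟩
    · exact ⟨y, by simp [hy, hq]⟩
  obtain ⟨p, hp⟩ := exists_homeo_comp_eq (isLocallyConstant_mem hE) (isLocallyConstant_mem hF)
    ((hr E hEn (hE'.imp fun x hx => hx.2)).trans (hr F hFn (hF'.imp fun x hx => hx.2)).symm)
  have hp' : p '' E = F := image_eq_of_mem_iff fun x => by simpa using hp x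
  obtain ⟨k, hk, hk'⟩ := exists_supported_extension hA hE hF hEA hFA hE' hF' p hp'
  exact ⟨k, hk, by rw [← hp']; exact Set.image_congr hk'⟩

/-- A Cantor space has no isolated points. -/
theorem exists_proper_clopen [IsCantorSpace 𝔛] {A : Set 𝔛} (hA : IsClopen A) (hn : A.Nonempty) :
    ∃ B ⊆ A, IsClopen B ∧ B.Nonempty ∧ (A \ B).Nonempty := by
  obtain ⟨e₀⟩ := IsCantorSpace.nonempty_homeomorph (𝔛 := 𝔛)
  let e : 𝔛 ≃ₜ (ℕ → Bool) := e₀.trans cantorSetHomeomorphNatToBool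
  obtain ⟨n, hU⟩ := clopen_finite_level (hA.preimage e.symm.continuous)
  obtain ⟨x, hx⟩ := hn
  have hcl : IsClopen {z | e z n = e x n} :=
    (isClopen_discrete {e x n}).preimage ((continuous_apply n).comp e.continuous)
  -- Membership in `A` depends only on the coordinates below `n`, so flipping coordinate `n` of a
  -- point of `A` stays in `A`.
  refine ⟨A ∩ {z | e z n = e x n}, Set.inter_subset_left, hA.inter hcl, ⟨x, hx, rfl⟩,
    e.symm (Function.update (e x) n (!e x n)), ?_, ?_⟩
  · refine hU (e x) _ (fun i hi => ?_) (by simpa using hx)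
    rw [Function.update_of_ne hi.ne]
  · rintro ⟨-, h⟩
    simp at h

/-- Homeomorphisms supported in two overlapping clopen sets generate all homeomorphisms supported
in the union. -/
theorem homeoSupportedIn_union_le [IsCantorSpace 𝔛] {A B : Set 𝔛} (hA : IsClopen A)
    (hB : IsClopen B) (hAB : (A ∩ B).Nonempty) {K : Subgroup (𝔛 ≃ₜ 𝔛)}
    (hKA : homeoSupportedIn A ≤ K) (hKB : homeoSupportedIn B ≤ K) :
    homeoSupportedIn (A ∪ B) ≤ K := by
  by_cases hsub : A ⊆ B
  · rwa [Set.union_eq_right.2 hsub]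
  rw [Set.not_subset] at hsub
  have hne : (A \ B).Nonempty := hsub
  have hKA' : homeoSupportedIn A ≤ homeoSupportedIn (A ∪ B) :=
    homeoSupportedIn_mono Set.subset_union_left
  have hKB' : homeoSupportedIn B ≤ homeoSupportedIn (A ∪ B) :=
    homeoSupportedIn_mono Set.subset_union_right
  have cl : ∀ g : 𝔛 ≃ₜ 𝔛, IsClopen (g '' (A \ B)) := fun g =>
    ⟨g.isClosedMap _ (hA.diff hB).1, g.isOpenMap _ (hA.diff hB).2⟩
  have hsubU : ∀ g ∈ homeoSupportedIn (A ∪ B), g '' (A \ B) ⊆ A ∪ B := by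
    rintro g hg _ ⟨x, hx, rfl⟩
    exact mem_of_mem_homeoSupportedIn hg (Or.inl hx.1)
  -- An element `k` supported in `A` can undo `g` on `A \ B`; then `k * g` is supported in `B`.
  have hα : ∀ g ∈ homeoSupportedIn (A ∪ B), g '' (A \ B) ⊆ A → (A \ g '' (A \ B)).Nonempty →
      g ∈ K := by
    intro g hg h1 h2
    obtain ⟨k, hk, hk'⟩ := exists_supported_extension hA (cl g) (hA.diff hB) h1
      Set.sdiff_subset h2 (by simpa [Set.sdiff_sdiff_right_self] using hAB) g⁻¹ (by
        rw [← Set.image_comp]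
        convert Set.image_id _
        ext x; exact g.symm_apply_apply x)
    have : k * g ∈ homeoSupportedIn B := by
      intro x hx
      change k (g x) = x
      by_cases hxA : x ∈ A
      · rw [hk' _ ⟨x, ⟨hxA, hx⟩, rfl⟩]
        exact g.symm_apply_apply x
      · rw [hg x (by simp [hxA, hx]), hk x hxA]
    have h3 := K.mul_mem (K.inv_mem (hKA hk)) (hKB this)
    rwa [inv_mul_cancel_left] at h3
  have himg : ∀ (k g : 𝔛 ≃ₜ 𝔛) (S : Set 𝔛), (k * g) '' S = k '' (g '' S) := by
    intro k g S
    rw [← Set.image_comp]; rfl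
  -- An element supported in `B` squeezes the part of `g '' (A \ B)` inside `B` into a proper clopen
  -- piece `C` of `A ∩ B`, which leads back to `hα`.
  have hβ : ∀ g ∈ homeoSupportedIn (A ∪ B), ¬ B ⊆ g '' (A \ B) → g ∈ K := by
    intro g hg h1
    by_cases hDB : (g '' (A \ B) ∩ B).Nonempty
    · obtain ⟨C, hC, hCc, hCn, hCn'⟩ := exists_proper_clopen (hA.inter hB) hAB
      have hBC : (B \ C).Nonempty := hCn'.mono fun x hx => ⟨hx.1.2, hx.2⟩
      obtain ⟨k, hk, hk'⟩ := exists_supported_map hB ((cl g).inter hB) hCc Set.inter_subset_right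
        (fun x hx => (hC hx).2) hDB hCn (by
          obtain ⟨x, hx, hx'⟩ := Set.not_subset.1 h1
          exact ⟨x, hx, fun h => hx' h.1⟩) hBC
      have hkg : k * g ∈ K := by
        have hD : ∀ y ∈ (k * g) '' (A \ B), (y ∈ A ∧ y ∉ B) ∨ y ∈ C := by
          intro y hy
          rw [himg] at hy
          obtain ⟨z, hz, rfl⟩ := hy
          by_cases hzB : z ∈ B
          · right
            rw [← hk']
            exact ⟨z, ⟨hz, hzB⟩, rfl⟩
          · left
            rw [hk z hzB]
            exact ⟨(hsubU g hg hz).resolve_right hzB, hzB⟩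
        refine hα _ (mul_mem (hKB' hk) hg) (fun y hy => ?_) ?_
        · rcases hD y hy with h | h
          exacts [h.1, (hC h).1]
        · obtain ⟨x, hx⟩ := hCn'
          refine ⟨x, hx.1.1, fun h => ?_⟩
          rcases hD x h with h | h
          exacts [h.2 hx.1.2, hx.2 h]
      have h3 := K.mul_mem (K.inv_mem (hKB hk)) hkg
      rwa [inv_mul_cancel_left] at h3
    · rw [Set.not_nonempty_iff_eq_empty] at hDB
      refine hα g hg (fun y hy => (hsubU g hg hy).resolve_right fun hyB => ?_) ?_
      · exact (Set.eq_empty_iff_forall_notMem.1 hDB y) ⟨hy, hyB⟩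
      · obtain ⟨x, hx⟩ := hAB
        exact ⟨x, hx.1, fun h => (Set.eq_empty_iff_forall_notMem.1 hDB x) ⟨h, hx.2⟩⟩
  intro g hg
  -- If `g '' (A \ B)` swallows `B`, points of `A ∩ B` are sent into `A` outside it. Moving `A \ g
  -- '' (A \ B)` onto `A ∩ B` inside `A` frees `A ∩ B`, so that `hβ` applies.
  by_cases hB' : B ⊆ g '' (A \ B)
  · have h1 : (A \ g '' (A \ B)).Nonempty := by
      obtain ⟨x, hx⟩ := hAB
      have hgx : g x ∉ g '' (A \ B) := fun h => ((g.injective.mem_set_image).1 h).2 hx.2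
      have hgx' : g x ∈ A ∪ B := mem_of_mem_homeoSupportedIn hg (Or.inl hx.1)
      exact ⟨g x, hgx'.resolve_right fun h => hgx (hB' h), hgx⟩
    obtain ⟨k, hk, hk'⟩ := exists_supported_map hA (hA.diff (cl g)) (hA.inter hB) Set.sdiff_subset
      Set.inter_subset_left h1 hAB (by
        rw [Set.sdiff_sdiff_right_self]
        exact hAB.mono fun x hx => ⟨hx.1, hB' hx.2⟩) (by
        simpa using hne)
    have hkg : k * g ∈ K := by
      refine hβ _ (mul_mem (hKA' hk) hg) fun h => ?_
      obtain ⟨x, hx⟩ := hAB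
      have h4 := h hx.2
      rw [himg] at h4
      obtain ⟨z, hz, hzx⟩ := h4
      have h5 : x ∈ k '' (A \ g '' (A \ B)) := hk'.symm ▸ hx
      obtain ⟨z', hz', hzx'⟩ := h5
      rw [k.injective (hzx.trans hzx'.symm)] at hz
      exact hz'.2 hz
    have h3 := K.mul_mem (K.inv_mem (hKA hk)) hkg
    rwa [inv_mul_cancel_left] at h3
  · exact hβ g hg hB'

end Topology

/-! ### Clopen partitions and their fixers -/

section OpenSetoid

variable {𝔛 : Type u} [TopologicalSpace 𝔛]

/-- An equivalence relation with open classes. -/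
def Setoid.IsOpenRel (r : Setoid 𝔛) : Prop := ∀ x, IsOpen {y | r x y}

/-- The number of classes of an equivalence relation. -/
noncomputable def Setoid.numClasses (r : Setoid 𝔛) : ℕ := Nat.card (Quotient r)

/-- The group of homeomorphisms preserving each class of an equivalence relation. -/
def Setoid.fixer (r : Setoid 𝔛) : Subgroup (𝔛 ≃ₜ 𝔛) where
  carrier := {g | ∀ x, r (g x) x}
  one_mem' x := r.refl x
  mul_mem' {g h} hg hh x := r.trans (hg (h x)) (hh x)
  inv_mem' {g} hg x := by
    have := hg (g.symm x)
    rw [g.apply_symm_apply] at this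
    exact r.symm this

/-- The image of an equivalence relation under a homeomorphism. -/
def Setoid.translate (g : 𝔛 ≃ₜ 𝔛) (r : Setoid 𝔛) : Setoid 𝔛 := r.comap g.symm

theorem Setoid.translate_apply (g : 𝔛 ≃ₜ 𝔛) (r : Setoid 𝔛) (x y : 𝔛) :
    r.translate g x y ↔ r (g.symm x) (g.symm y) := Iff.rfl

theorem Setoid.translate_apply_apply (g : 𝔛 ≃ₜ 𝔛) (r : Setoid 𝔛) (x y : 𝔛) :
    r.translate g (g x) (g y) ↔ r x y := by
  rw [Setoid.translate_apply, g.symm_apply_apply, g.symm_apply_apply]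

theorem Setoid.mem_fixer {r : Setoid 𝔛} {g : 𝔛 ≃ₜ 𝔛} : g ∈ r.fixer ↔ ∀ x, r (g x) x := Iff.rfl

theorem Setoid.fixer_mono {r s : Setoid 𝔛} (h : r ≤ s) : r.fixer ≤ s.fixer :=
  fun _ hg x => h (hg x)

theorem Setoid.fixer_inf (r s : Setoid 𝔛) : (r ⊓ s).fixer = r.fixer ⊓ s.fixer := by
  ext g
  simp only [Subgroup.mem_inf, Setoid.mem_fixer]
  exact forall_and

theorem Setoid.fixer_top : (⊤ : Setoid 𝔛).fixer = ⊤ :=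
  (Subgroup.eq_top_iff' _).2 fun _ _ => trivial

theorem Setoid.mem_fixer_translate {r : Setoid 𝔛} {g k : 𝔛 ≃ₜ 𝔛} :
    k ∈ (r.translate g).fixer ↔ g⁻¹ * k * g ∈ r.fixer := by
  simp only [Setoid.mem_fixer, Setoid.translate_apply]
  constructor
  · intro h x
    have := h (g x)
    rw [g.symm_apply_apply] at this
    exact this
  · intro h x
    have := h (g.symm x)
    change r (g.symm (k (g (g.symm x)))) _ at this
    rwa [g.apply_symm_apply] at this

theorem Setoid.fixer_translate (r : Setoid 𝔛) (g : 𝔛 ≃ₜ 𝔛) :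
    (r.translate g).fixer = r.fixer.map (MulAut.conj g).toMonoidHom := by
  ext k
  rw [Setoid.mem_fixer_translate, Subgroup.mem_map_equiv]
  simp

theorem Setoid.translate_mono {r s : Setoid 𝔛} (h : r ≤ s) (g : 𝔛 ≃ₜ 𝔛) :
    r.translate g ≤ s.translate g := fun {_ _} hxy => h hxy

theorem Setoid.translate_inv_translate (r : Setoid 𝔛) (g : 𝔛 ≃ₜ 𝔛) :
    (r.translate g).translate g⁻¹ = r := by
  ext x y
  change r (g.symm (g x)) (g.symm (g y)) ↔ _
  rw [g.symm_apply_apply, g.symm_apply_apply]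

theorem Setoid.translate_translate_inv (r : Setoid 𝔛) (g : 𝔛 ≃ₜ 𝔛) :
    (r.translate g⁻¹).translate g = r := by
  conv_rhs => rw [← r.translate_inv_translate g⁻¹, inv_inv]

theorem Setoid.numClasses_translate (r : Setoid 𝔛) (g : 𝔛 ≃ₜ 𝔛) :
    (r.translate g).numClasses = r.numClasses :=
  Nat.card_congr (Quotient.congr g.symm.toEquiv fun _ _ => Iff.rfl)

namespace Setoid.IsOpenRel

theorem mono {r s : Setoid 𝔛} (hr : r.IsOpenRel) (h : r ≤ s) : s.IsOpenRel := fun _ =>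
  isOpen_iff_mem_nhds.2 fun y hy =>
    Filter.mem_of_superset ((hr y).mem_nhds (r.refl y)) fun _ hz => s.trans hy (h hz)

theorem inf {r s : Setoid 𝔛} (hr : r.IsOpenRel) (hs : s.IsOpenRel) : (r ⊓ s).IsOpenRel :=
  fun x => (hr x).inter (hs x)

theorem translate {r : Setoid 𝔛} (hr : r.IsOpenRel) (g : 𝔛 ≃ₜ 𝔛) : (r.translate g).IsOpenRel :=
  fun x => (hr (g.symm x)).preimage g.symm.continuous

theorem isOpen_of_saturated {r : Setoid 𝔛} (hr : r.IsOpenRel) {A : Set 𝔛}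
    (hA : ∀ x y, r x y → x ∈ A → y ∈ A) : IsOpen A :=
  isOpen_iff_mem_nhds.2 fun x hx =>
    Filter.mem_of_superset ((hr x).mem_nhds (r.refl x)) fun y hy => hA x y hy hx

theorem isClopen_of_saturated {r : Setoid 𝔛} (hr : r.IsOpenRel) {A : Set 𝔛}
    (hA : ∀ x y, r x y → x ∈ A → y ∈ A) : IsClopen A :=
  ⟨⟨hr.isOpen_of_saturated fun _ _ hxy hx hy => hx (hA _ _ (r.symm hxy) hy)⟩,
    hr.isOpen_of_saturated hA⟩

theorem isClopen {r : Setoid 𝔛} (hr : r.IsOpenRel) (x : 𝔛) : IsClopen {y | r x y} :=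
  hr.isClopen_of_saturated fun _ _ hyz hy => r.trans hy hyz

theorem isLocallyConstant {r : Setoid 𝔛} (hr : r.IsOpenRel) :
    IsLocallyConstant (Quotient.mk r) :=
  (IsLocallyConstant.iff_eventually_eq _).2 fun x =>
    Filter.mem_of_superset ((hr x).mem_nhds (r.refl x)) fun _ hy => Quotient.sound (r.symm hy)

theorem of_isLocallyConstant {ι : Type w} {φ : 𝔛 → ι} (hφ : IsLocallyConstant φ) :
    (Setoid.ker φ).IsOpenRel := fun x => by
  convert hφ.isOpen_fiber (φ x) using 1
  ext y
  exact eq_comm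

protected theorem top : (⊤ : Setoid 𝔛).IsOpenRel := fun _ => isOpen_univ

theorem finite [CompactSpace 𝔛] {r : Setoid 𝔛} (hr : r.IsOpenRel) : Finite (Quotient r) := by
  have h := hr.isLocallyConstant.range_finite
  rw [Set.range_eq_univ.2 Quotient.mk_surjective] at h
  exact Set.finite_univ_iff.1 h

theorem numClasses_pos [CompactSpace 𝔛] [Nonempty 𝔛] {r : Setoid 𝔛} (hr : r.IsOpenRel) :
    0 < r.numClasses := by
  have := hr.finite
  have : Nonempty (Quotient r) := ⟨Quotient.mk r (Classical.arbitrary 𝔛)⟩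
  exact Nat.card_pos

theorem numClasses_anti [CompactSpace 𝔛] {r s : Setoid 𝔛} (hr : r.IsOpenRel) (h : r ≤ s) :
    s.numClasses ≤ r.numClasses := by
  have := hr.finite
  exact Nat.card_le_card_of_surjective (Quotient.map' id h)
    (Quotient.ind fun x => ⟨Quotient.mk r x, rfl⟩)

theorem eq_of_numClasses_le [CompactSpace 𝔛] {r s : Setoid 𝔛} (hr : r.IsOpenRel) (h : r ≤ s)
    (hc : r.numClasses ≤ s.numClasses) : r = s := by
  have := hr.finite
  have := (hr.mono h).finite
  have hs : Surjective (Quotient.map' id h : Quotient r → Quotient s) :=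
    Quotient.ind fun x => ⟨Quotient.mk r x, rfl⟩
  have hb := hs.bijective_of_nat_card_le hc
  refine le_antisymm h fun {x y} hxy => ?_
  exact Quotient.exact (hb.1 (a₁ := Quotient.mk r x) (a₂ := Quotient.mk r y) (Quotient.sound hxy))

theorem isOpen_fixer [CompactSpace 𝔛] {r : Setoid 𝔛} (hr : r.IsOpenRel) :
    IsOpen (r.fixer : Set (𝔛 ≃ₜ 𝔛)) := by
  have := hr.finite
  apply Subgroup.isOpen_of_mem_nhds (g := 1)
  refine (homeoBasis 𝔛).nhds_one_hasBasis.mem_iff.2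
    ⟨_, ⟨Set.range fun q : Quotient r => {y | Quotient.mk r y = q}, Set.finite_range _, ?_, rfl⟩, ?_⟩
  · rintro _ ⟨q, rfl⟩
    exact hr.isLocallyConstant.isClopen_fiber q
  · intro g hg x
    have h := hg _ ⟨Quotient.mk r x, rfl⟩
    have hx : g x ∈ g '' {y | Quotient.mk r y = Quotient.mk r x} := ⟨x, rfl, rfl⟩
    rw [h] at hx
    exact Quotient.exact hx

end Setoid.IsOpenRel

/-- Open subgroups contain the fixer of a clopen partition. -/
theorem exists_fixer_le {U : Subgroup (𝔛 ≃ₜ 𝔛)} (hU : IsOpen (U : Set (𝔛 ≃ₜ 𝔛))) :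
    ∃ r : Setoid 𝔛, r.IsOpenRel ∧ r.fixer ≤ U := by
  obtain ⟨_, ⟨s, hs, hs', rfl⟩, h⟩ :=
    (homeoBasis 𝔛).nhds_one_hasBasis.mem_iff.1 (hU.mem_nhds U.one_mem)
  refine ⟨Setoid.ker fun x (A : s) => (x ∈ (A : Set 𝔛) : Prop), ?_, fun g hg => h ?_⟩
  · have := hs.to_subtype
    refine Setoid.IsOpenRel.of_isLocallyConstant
      ((IsLocallyConstant.iff_eventually_eq _).2 fun x => ?_)
    have h1 : ∀ A : s, ∀ᶠ y in nhds x, (y ∈ (A : Set 𝔛)) = (x ∈ (A : Set 𝔛)) := fun A =>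
      (IsLocallyConstant.iff_eventually_eq _).1 (isLocallyConstant_mem (hs' A A.2)) x
    filter_upwards [Filter.eventually_all.2 h1] with y hy
    exact funext hy
  · intro A hA
    exact image_eq_of_mem_iff fun x => (congrFun (hg x) ⟨A, hA⟩).to_iff

theorem homeoSupportedIn_class_le (r : Setoid 𝔛) (x : 𝔛) :
    homeoSupportedIn {y | r x y} ≤ r.fixer := by
  intro g hg y
  by_cases hy : r x y
  · exact r.trans (r.symm (mem_of_mem_homeoSupportedIn hg hy)) hy
  · rw [hg y hy]

variable [IsCantorSpace 𝔛]

/-- Call two points related if a clopen set contains both and all homeomorphisms supported in it lie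
in `K`. Overlapping sets may be united, so this is an equivalence relation; it contains `r` and `s`,
hence `r ⊔ s`. Compactness then produces a single such set around the whole class. -/
theorem homeoSupportedIn_sup_class_le {r s : Setoid 𝔛} (hr : r.IsOpenRel) (hs : s.IsOpenRel)
    {K : Subgroup (𝔛 ≃ₜ 𝔛)} (hrK : r.fixer ≤ K) (hsK : s.fixer ≤ K) (x : 𝔛) :
    homeoSupportedIn {y | (r ⊔ s) x y} ≤ K := by
  let R : Setoid 𝔛 :=
    { r := fun y z => ∃ A, IsClopen A ∧ y ∈ A ∧ z ∈ A ∧ homeoSupportedIn A ≤ K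
      iseqv :=
        { refl := fun y => ⟨_, hr.isClopen y, r.refl y, r.refl y,
            (homeoSupportedIn_class_le r y).trans hrK⟩
          symm := fun ⟨A, h, h1, h2, h3⟩ => ⟨A, h, h2, h1, h3⟩
          trans := fun ⟨A, h, h1, h2, h3⟩ ⟨B, h', h1', h2', h3'⟩ =>
            ⟨A ∪ B, h.union h', Or.inl h1, Or.inr h2',
              homeoSupportedIn_union_le h h' ⟨_, h2, h1'⟩ h3 h3'⟩ } }
  have hR : r ⊔ s ≤ R := sup_le
    (fun {y z} h => ⟨_, hr.isClopen y, r.refl y, h, (homeoSupportedIn_class_le r y).trans hrK⟩)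
    (fun {y z} h => ⟨_, hs.isClopen y, s.refl y, h, (homeoSupportedIn_class_le s y).trans hsK⟩)
  have hcomp : IsCompact {y | (r ⊔ s) x y} :=
    ((hr.mono le_sup_left).isClopen x).1.isCompact
  obtain ⟨A, -, -, hA, hAK⟩ : ∃ A, IsClopen A ∧ x ∈ A ∧ {y | (r ⊔ s) x y} ⊆ A ∧
      homeoSupportedIn A ≤ K := by
    refine hcomp.induction_on
      (p := fun S => ∃ A, IsClopen A ∧ x ∈ A ∧ S ⊆ A ∧ homeoSupportedIn A ≤ K) ?_ ?_ ?_ ?_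
    · exact ⟨_, hr.isClopen x, r.refl x, Set.empty_subset _,
        (homeoSupportedIn_class_le r x).trans hrK⟩
    · rintro S T hST ⟨A, h1, h2, h3, h4⟩
      exact ⟨A, h1, h2, hST.trans h3, h4⟩
    · rintro S T ⟨A, h1, h2, h3, h4⟩ ⟨B, h1', h2', h3', h4'⟩
      exact ⟨A ∪ B, h1.union h1', Or.inl h2, Set.union_subset_union h3 h3',
        homeoSupportedIn_union_le h1 h1' ⟨_, h2, h2'⟩ h4 h4'⟩
    · intro y hy
      obtain ⟨A, h1, h2, h3, h4⟩ := hR hy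
      exact ⟨A, mem_nhdsWithin_of_mem_nhds (h1.2.mem_nhds h3), A, h1, h2, subset_rfl, h4⟩
  exact (homeoSupportedIn_mono hA).trans hAK

/-- A subgroup containing all homeomorphisms supported in one class contains the fixer. -/
theorem Setoid.IsOpenRel.fixer_le {t : Setoid 𝔛} (ht : t.IsOpenRel) {K : Subgroup (𝔛 ≃ₜ 𝔛)}
    (hK : ∀ x, homeoSupportedIn {y | t x y} ≤ K) : t.fixer ≤ K := by
  -- Compactness replaces an enumeration of the classes: saturated sets `B` whose part of the fixer
  -- lies in `K` are closed under unions.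
  obtain ⟨B, -, hB, h⟩ : ∃ B : Set 𝔛, (∀ x y, t x y → x ∈ B → y ∈ B) ∧ Set.univ ⊆ B ∧
      ∀ g ∈ t.fixer, g ∈ homeoSupportedIn B → g ∈ K := by
    refine isCompact_univ.induction_on (p := fun S => ∃ B : Set 𝔛,
      (∀ x y, t x y → x ∈ B → y ∈ B) ∧ S ⊆ B ∧
      ∀ g ∈ t.fixer, g ∈ homeoSupportedIn B → g ∈ K) ?_ ?_ ?_ ?_
    · refine ⟨∅, by simp, subset_rfl, fun g _ hg => ?_⟩
      have : g = 1 := Homeomorph.ext fun x => hg x (by simp)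
      exact this ▸ K.one_mem
    · rintro S T hST ⟨B, h1, h2, h3⟩
      exact ⟨B, h1, hST.trans h2, h3⟩
    · rintro S T ⟨B, h1, h2, h3⟩ ⟨C, h1', h2', h3'⟩
      refine ⟨B ∪ C, ?_, Set.union_subset_union h2 h2', fun g hg hgs => ?_⟩
      · rintro x y hxy (hx | hx)
        exacts [Or.inl (h1 x y hxy hx), Or.inr (h1' x y hxy hx)]
      · have hgB : g '' B = B := image_eq_of_mem_iff fun x =>
          ⟨fun h => h1 _ _ (hg x) h, fun h => h1 _ _ (t.symm (hg x)) h⟩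
        -- Cut `g` along `B`: `k` is its part on `B`, and `k⁻¹ * g` is supported in `C`.
        obtain ⟨k, hk, hk'⟩ := exists_glue (ht.isClopen_of_saturated h1) g 1
          (hgB.trans (Set.image_id B).symm)
        have hkt : k ∈ t.fixer := fun x => by
          by_cases hx : x ∈ B
          · rw [hk x hx]; exact hg x
          · rw [hk' x hx]; exact t.refl x
        have hkK : k ∈ K := h3 k hkt fun x hx => hk' x hx
        have : k⁻¹ * g ∈ K := by
          refine h3' _ (mul_mem (inv_mem hkt) hg) fun x hx => ?_
          change k.symm (g x) = x
          rw [k.symm_apply_eq]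
          by_cases hxB : x ∈ B
          · exact (hk x hxB).symm
          · rw [hgs x (by simp [hx, hxB])]
            exact (hk' x hxB).symm
        have := K.mul_mem hkK this
        rwa [mul_inv_cancel_left] at this
    · intro x _
      refine ⟨{y | t x y}, mem_nhdsWithin_of_mem_nhds ((ht x).mem_nhds (t.refl x)), {y | t x y},
        fun y z hyz hy => t.trans hy hyz, subset_rfl, fun g _ hg => hK x hg⟩
  exact fun g hg => h g hg fun x hx => (hx (hB trivial)).elim

theorem fixer_sup_le {r s : Setoid 𝔛} (hr : r.IsOpenRel) (hs : s.IsOpenRel)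
    {K : Subgroup (𝔛 ≃ₜ 𝔛)} (hrK : r.fixer ≤ K) (hsK : s.fixer ≤ K) : (r ⊔ s).fixer ≤ K :=
  (hr.mono le_sup_left).fixer_le (homeoSupportedIn_sup_class_le hr hs hrK hsK)

/-- If one class of `s` contained points inequivalent under `r`, a homeomorphism supported in that
class could carry the trace of one class of `r` onto that of another, so it would fix the classes of
`s` but not those of `r`. -/
theorem le_of_fixer_le {r s : Setoid 𝔛} (hr : r.IsOpenRel) (hs : s.IsOpenRel)
    (h : s.fixer ≤ r.fixer) : s ≤ r := by
  intro x y hxy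
  by_contra hr'
  obtain ⟨k, hk, hk'⟩ := exists_supported_map (hs.isClopen x)
    (E := {z | s x z} ∩ {z | r x z}) (F := {z | s x z} ∩ {z | r y z})
    ((hs.isClopen x).inter (hr.isClopen x)) ((hs.isClopen x).inter (hr.isClopen y))
    Set.inter_subset_left Set.inter_subset_left ⟨x, s.refl x, r.refl x⟩ ⟨y, hxy, r.refl y⟩
    ⟨y, hxy, fun h => hr' h.2⟩ ⟨x, s.refl x, fun h => hr' (r.symm h.2)⟩
  have h1 : k x ∈ {z | s x z} ∩ {z | r y z} := hk' ▸ ⟨x, ⟨s.refl x, r.refl x⟩, rfl⟩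
  have h2 := h (homeoSupportedIn_class_le s x hk) x
  exact hr' (r.symm (r.trans h1.2 h2))

/-- Every open subgroup contains the fixer of a unique coarsest clopen partition. -/
theorem exists_isGreatest_fixer_le {U : Subgroup (𝔛 ≃ₜ 𝔛)} (hU : IsOpen (U : Set (𝔛 ≃ₜ 𝔛))) :
    ∃ r, IsGreatest {r : Setoid 𝔛 | r.IsOpenRel ∧ r.fixer ≤ U} r := by
  obtain ⟨r, hr, hmin⟩ : ∃ r : Setoid 𝔛, (r.IsOpenRel ∧ r.fixer ≤ U) ∧
      ∀ s : Setoid 𝔛, s.IsOpenRel ∧ s.fixer ≤ U → r.numClasses ≤ s.numClasses :=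
    ⟨_, argminOn_mem _ _ (exists_fixer_le hU), fun s hs => argminOn_le Setoid.numClasses _ hs⟩
  -- `r` has the fewest classes among admissible partitions. Its join with any admissible `s` is
  -- admissible with no more classes, so it equals `r`.
  refine ⟨r, hr, fun s hs => ?_⟩
  have h1 := hmin (r ⊔ s) ⟨hr.1.mono le_sup_left, fixer_sup_le hr.1 hs.1 hr.2 hs.2⟩
  rw [hr.1.eq_of_numClasses_le le_sup_left h1]
  exact le_sup_right

end OpenSetoid

/-! ### The coarsest partition and the symmetry index of an open subgroup -/

section Coarsest

variable {𝔛 : Type u} [TopologicalSpace 𝔛]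

/-- The coarsest clopen partition whose fixer is contained in a given open subgroup. -/
noncomputable def coarsest (U : Subgroup (𝔛 ≃ₜ 𝔛)) : Setoid 𝔛 :=
  sSup {r : Setoid 𝔛 | r.IsOpenRel ∧ r.fixer ≤ U}

theorem le_coarsest {U : Subgroup (𝔛 ≃ₜ 𝔛)} {r : Setoid 𝔛} (hr : r.IsOpenRel) (h : r.fixer ≤ U) :
    r ≤ coarsest U := le_sSup ⟨hr, h⟩

/-- The order of the group of permutations of the classes of `coarsest U` induced by `U`. -/
noncomputable def symIndex (U : Subgroup (𝔛 ≃ₜ 𝔛)) : ℕ := (coarsest U).fixer.relIndex U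

/-- `V` permutes the finitely many classes of `r`, and elements inducing the same map on classes
differ by an element of the fixer. Finiteness of the index is encoded by its being nonzero. -/
theorem relIndex_fixer_ne_zero [CompactSpace 𝔛] {r : Setoid 𝔛} (hr : r.IsOpenRel)
    {V : Subgroup (𝔛 ≃ₜ 𝔛)} (hV : ∀ v ∈ V, ∀ x y, r x y → r (v x) (v y)) :
    r.fixer.relIndex V ≠ 0 := by
  have := hr.finite
  let F : V → Quotient r → Quotient r := fun v => Quotient.map' v fun x y => hV v v.2 x y
  have hF : ∀ v w : V, F v = F w ↔ v⁻¹ * w ∈ r.fixer.subgroupOf V := by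
    intro v w
    rw [Subgroup.mem_subgroupOf, Setoid.mem_fixer, funext_iff]
    constructor
    · intro h x
      have h1 : r (v.1 x) (w.1 x) := Quotient.exact (h (Quotient.mk r x))
      have h2 := hV _ (inv_mem v.2) _ _ h1
      change r ((v.1).symm (v.1 x)) _ at h2
      rw [v.1.symm_apply_apply] at h2
      exact r.symm h2
    · intro h
      refine Quotient.ind fun x => Quotient.sound ?_
      have h2 := hV _ v.2 _ _ (h x)
      change r (v.1 (v.1.symm (w.1 x))) _ at h2
      rw [v.1.apply_symm_apply] at h2
      exact r.symm h2
  have hfin : Finite (V ⧸ r.fixer.subgroupOf V) := by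
    refine Finite.of_injective (β := Quotient r → Quotient r)
      (Quotient.lift F fun v w h => (hF v w).2 (QuotientGroup.leftRel_apply.1 h)) ?_
    refine Quotient.ind fun v => Quotient.ind fun w h => Quotient.sound ?_
    exact QuotientGroup.leftRel_apply.2 ((hF v w).1 h)
  exact Nat.card_pos.ne'

theorem symIndex_le_relIndex {U : Subgroup (𝔛 ≃ₜ 𝔛)} {r : Setoid 𝔛} (hr : r.IsOpenRel) (h : r.fixer ≤ U)
    (h0 : r.fixer.relIndex U ≠ 0) : symIndex U ≤ r.fixer.relIndex U :=
  Subgroup.relIndex_le_of_le_left (Setoid.fixer_mono (le_coarsest hr h)) h0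

theorem isOpen_of_fixer_le [CompactSpace 𝔛] {U : Subgroup (𝔛 ≃ₜ 𝔛)} {r : Setoid 𝔛} (hr : r.IsOpenRel) (h : r.fixer ≤ U) :
    IsOpen (U : Set (𝔛 ≃ₜ 𝔛)) :=
  Subgroup.isOpen_mono h hr.isOpen_fixer

variable [IsCantorSpace 𝔛] {U V : Subgroup (𝔛 ≃ₜ 𝔛)}

theorem isGreatest_coarsest (hU : IsOpen (U : Set (𝔛 ≃ₜ 𝔛))) :
    IsGreatest {r : Setoid 𝔛 | r.IsOpenRel ∧ r.fixer ≤ U} (coarsest U) := by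
  obtain ⟨r, hr⟩ := exists_isGreatest_fixer_le hU
  rwa [coarsest, hr.csSup_eq]

theorem coarsest_isOpenRel (hU : IsOpen (U : Set (𝔛 ≃ₜ 𝔛))) : (coarsest U).IsOpenRel :=
  (isGreatest_coarsest hU).1.1

theorem fixer_coarsest_le (hU : IsOpen (U : Set (𝔛 ≃ₜ 𝔛))) : (coarsest U).fixer ≤ U :=
  (isGreatest_coarsest hU).1.2

theorem coarsest_mono (hU : IsOpen (U : Set (𝔛 ≃ₜ 𝔛))) (h : U ≤ V) : coarsest U ≤ coarsest V :=
  le_coarsest (coarsest_isOpenRel hU) ((fixer_coarsest_le hU).trans h)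

theorem coarsest_fixer {r : Setoid 𝔛} (hr : r.IsOpenRel) : coarsest r.fixer = r :=
  le_antisymm (le_of_fixer_le hr (coarsest_isOpenRel hr.isOpen_fixer)
    (fixer_coarsest_le hr.isOpen_fixer)) (le_coarsest hr le_rfl)

theorem symIndex_fixer {r : Setoid 𝔛} (hr : r.IsOpenRel) : symIndex r.fixer = 1 := by
  rw [symIndex, coarsest_fixer hr, Subgroup.relIndex_self]

theorem coarsest_map_conj (hU : IsOpen (U : Set (𝔛 ≃ₜ 𝔛))) (g : 𝔛 ≃ₜ 𝔛) :
    coarsest (U.map (MulAut.conj g).toMonoidHom) = (coarsest U).translate g := by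
  have h := isGreatest_coarsest hU
  refine IsGreatest.csSup_eq ⟨⟨h.1.1.translate g, ?_⟩, fun s hs => ?_⟩
  · rw [Setoid.fixer_translate]
    exact Subgroup.map_mono h.1.2
  · rw [← Setoid.translate_translate_inv s g]
    refine Setoid.translate_mono (h.2 ⟨hs.1.translate _, fun k hk => ?_⟩) g
    rw [Setoid.mem_fixer_translate] at hk
    have := hs.2 hk
    rw [Subgroup.mem_map_equiv] at this
    simpa [mul_assoc] using this

theorem symIndex_map_conj (hU : IsOpen (U : Set (𝔛 ≃ₜ 𝔛))) (g : 𝔛 ≃ₜ 𝔛) :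
    symIndex (U.map (MulAut.conj g).toMonoidHom) = symIndex U := by
  rw [symIndex, coarsest_map_conj hU, Setoid.fixer_translate, symIndex,
    Subgroup.relIndex_map_map_of_injective _ _ (MulAut.conj g).injective]

theorem translate_coarsest (hU : IsOpen (U : Set (𝔛 ≃ₜ 𝔛))) {g : 𝔛 ≃ₜ 𝔛} (hg : g ∈ U) :
    (coarsest U).translate g = coarsest U := by
  rw [← coarsest_map_conj hU]
  congr 1
  ext k
  rw [Subgroup.mem_map_equiv]
  simp only [MulAut.conj_symm_apply]
  rw [U.mul_mem_cancel_right hg, U.mul_mem_cancel_left (U.inv_mem hg)]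

theorem coarsest_apply_apply (hU : IsOpen (U : Set (𝔛 ≃ₜ 𝔛))) {g : 𝔛 ≃ₜ 𝔛} (hg : g ∈ U)
    (x y : 𝔛) : coarsest U (g x) (g y) ↔ coarsest U x y := by
  conv_lhs => rw [← translate_coarsest hU hg]
  exact Setoid.translate_apply_apply _ _ _ _

theorem symIndex_ne_zero (hU : IsOpen (U : Set (𝔛 ≃ₜ 𝔛))) : symIndex U ≠ 0 :=
  relIndex_fixer_ne_zero (coarsest_isOpenRel hU) fun _ hv x y =>
    (coarsest_apply_apply hU hv x y).2

end Coarsest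

/-! ### Existence of clopen partitions of prescribed shape -/

section Refinement

/-- A Cantor space can be partitioned into any positive number of clopen pieces. -/
theorem exists_isLocallyConstant_surjective (𝔛 : Type u) [TopologicalSpace 𝔛] [IsCantorSpace 𝔛]
    (n : ℕ) :
    ∃ φ : 𝔛 → Fin (n + 1), IsLocallyConstant φ ∧ Surjective φ := by
  induction n with
  | zero => exact ⟨fun _ => 0, IsLocallyConstant.const _, fun i => by
      obtain ⟨x⟩ := IsCantorSpace.nonempty (𝔛 := 𝔛)
      exact ⟨x, (Fin.fin_one_eq_zero i).symm⟩⟩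
  | succ n ih =>
    obtain ⟨φ, hφ, hs⟩ := ih
    classical
    obtain ⟨B, hB, hBc, ⟨b, hb⟩, ⟨c, hc, hc'⟩⟩ := exists_proper_clopen (hφ.isClopen_fiber 0)
      (hs 0)
    refine ⟨fun x => if x ∈ B then 0 else (φ x).succ, ?_, fun i => ?_⟩
    · refine (IsLocallyConstant.iff_eventually_eq _).2 fun x => ?_
      filter_upwards [(IsLocallyConstant.iff_eventually_eq _).1 hφ x,
        (IsLocallyConstant.iff_eventually_eq _).1 (isLocallyConstant_mem hBc) x] with y hy hy'
      rw [hy]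
      simp only [eq_iff_iff] at hy'
      simp only [hy']
    · induction i using Fin.cases with
      | zero => exact ⟨b, if_pos hb⟩
      | succ i =>
        by_cases hi : i = 0
        · exact ⟨c, (if_neg hc').trans (by rw [show φ c = 0 from hc, hi])⟩
        · obtain ⟨x, hx⟩ := hs i
          refine ⟨x, (if_neg fun h => hi ?_).trans (by rw [hx])⟩
          rw [← hx]; exact hB h

variable {𝔛 : Type u} [TopologicalSpace 𝔛] [IsCantorSpace 𝔛]

/-- Realizing a prescribed refinement of a clopen partition. -/
theorem exists_refinement {r : Setoid 𝔛} (hr : r.IsOpenRel) {ι : Type w} [Finite ι]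
    {π : ι → Quotient r} (hπ : Surjective π) :
    ∃ φ : 𝔛 → ι, IsLocallyConstant φ ∧ Surjective φ ∧ ∀ x, π (φ x) = Quotient.mk r x := by
  obtain ⟨n, ⟨e⟩⟩ := Finite.exists_equiv_fin ι
  obtain ⟨x⟩ := IsCantorSpace.nonempty (𝔛 := 𝔛)
  obtain ⟨i, -⟩ := hπ (Quotient.mk r x)
  obtain ⟨m, rfl⟩ : ∃ m, n = m + 1 := Nat.exists_eq_succ_of_ne_zero fun h => by
    subst h; exact (e i).elim0
  obtain ⟨φ, hφ, hs⟩ := exists_isLocallyConstant_surjective 𝔛 m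
  have hφ' : IsLocallyConstant (e.symm ∘ φ) := hφ.comp _
  -- Any clopen partition indexed by `ι` will do, after a homeomorphism that matches its image under
  -- `π` with the partition `r`.
  obtain ⟨g, hg⟩ := exists_homeo_comp_eq hr.isLocallyConstant (hφ'.comp π) (by
    rw [Set.range_eq_univ.2 Quotient.mk_surjective,
      Set.range_eq_univ.2 (hπ.comp (e.symm.surjective.comp hs))])
  exact ⟨(e.symm ∘ φ) ∘ g, hφ'.comp_continuous g.continuous,
    (e.symm.surjective.comp hs).comp g.surjective, hg⟩

end Refinement

/-! ### Transitive sets, coset spaces and induction over orbits -/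

namespace FinGSet

section General

variable {G : Type u} [Group G] [TopologicalSpace G]

theorem IsTransitive.nonempty {X : FinGSet G} (h : X.IsTransitive) : Nonempty X := h.1

theorem IsTransitive.exists_smul_eq {X : FinGSet G} (h : X.IsTransitive) (x y : X) :
    ∃ g : G, g • x = y := h.2.exists_smul_eq x y

theorem IsTransitive.of_forall {X : FinGSet G} (x : X) (h : ∀ y : X, ∃ g : G, g • x = y) :
    X.IsTransitive := by
  refine ⟨⟨x⟩, ⟨fun y z => ?_⟩⟩
  obtain ⟨g, rfl⟩ := h y
  obtain ⟨k, rfl⟩ := h z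
  exact ⟨k * g⁻¹, by rw [smul_smul, inv_mul_cancel_right]⟩

theorem stabilizer_le_of_hom {X Y : FinGSet G} (f : X →[G] Y) (x : X) :
    MulAction.stabilizer G x ≤ MulAction.stabilizer G (f x) := by
  intro g hg
  rw [MulAction.mem_stabilizer_iff] at hg ⊢
  rw [← map_smul, hg]

theorem stabilizer_eq_of_injective {X Y : FinGSet G} (f : X →[G] Y) (hf : Injective f) (x : X) :
    MulAction.stabilizer G (f x) = MulAction.stabilizer G x := by
  refine le_antisymm (fun g hg => ?_) (stabilizer_le_of_hom f x)
  rw [MulAction.mem_stabilizer_iff] at hg ⊢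
  exact hf (by rw [map_smul, hg])

theorem IsTransitive.surjective {X Y : FinGSet G} (hY : Y.IsTransitive) [Nonempty X]
    (f : X →[G] Y) : Surjective f := by
  intro y
  obtain ⟨x⟩ := ‹Nonempty X›
  obtain ⟨g, hg⟩ := hY.exists_smul_eq (f x) y
  exact ⟨g • x, by rw [map_smul, hg]⟩

theorem IsTransitive.exists_hom {X Z : FinGSet G} (hX : X.IsTransitive) (x : X) (z : Z)
    (h : MulAction.stabilizer G x ≤ MulAction.stabilizer G z) : ∃ f : X →[G] Z, f x = z := by
  choose c hc using hX.exists_smul_eq x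
  have key : ∀ g k : G, g • x = k • x → g • z = k • z := by
    intro g k hgk
    have : k⁻¹ * g ∈ MulAction.stabilizer G x := by
      rw [MulAction.mem_stabilizer_iff, mul_smul, hgk, inv_smul_smul]
    have := h this
    rwa [MulAction.mem_stabilizer_iff, mul_smul, inv_smul_eq_iff] at this
  refine ⟨⟨fun y => c y • z, fun g y => ?_⟩, ?_⟩
  · change c (g • y) • z = g • c y • z
    rw [smul_smul]
    exact key _ _ (by rw [hc, mul_smul, hc])
  · change c x • z = z
    conv_rhs => rw [← one_smul G z]
    exact key _ _ (by rw [hc, one_smul])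

theorem IsTransitive.hom_ext {X Z : FinGSet G} (hX : X.IsTransitive) {f g : X →[G] Z} (x : X)
    (h : f x = g x) : f = g := by
  ext y
  obtain ⟨k, rfl⟩ := hX.exists_smul_eq x y
  rw [map_smul, map_smul, h]

theorem IsTransitive.bijective {X Y : FinGSet G} (hX : X.IsTransitive) (hY : Y.IsTransitive)
    (f : X →[G] Y) (x : X) (h : MulAction.stabilizer G (f x) ≤ MulAction.stabilizer G x) :
    Bijective f := by
  have : Nonempty X := ⟨x⟩
  refine ⟨fun a b hab => ?_, hY.surjective f⟩
  obtain ⟨g, rfl⟩ := hX.exists_smul_eq x a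
  obtain ⟨k, rfl⟩ := hX.exists_smul_eq x b
  have : k⁻¹ * g ∈ MulAction.stabilizer G x := by
    refine h ?_
    rw [MulAction.mem_stabilizer_iff, mul_smul, inv_smul_eq_iff, ← map_smul, hab, map_smul]
  rwa [MulAction.mem_stabilizer_iff, mul_smul, inv_smul_eq_iff] at this

/-- The transitive `G`-set of cosets of an open subgroup. -/
def coset [IsTopologicalGroup G] (U : Subgroup G) (hU : IsOpen (U : Set G)) : FinGSet G where
  carrier := G ⧸ U
  smooth := by
    refine Quotient.ind fun g => ?_
    have h : (MulAction.stabilizer G (g : G ⧸ U) : Set G) = (fun k => g⁻¹ * k * g) ⁻¹' U := by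
      ext k
      simp only [SetLike.mem_coe, Set.mem_preimage]
      change ((k * g : G) : G ⧸ U) = (g : G ⧸ U) ↔ _
      rw [eq_comm, QuotientGroup.eq, mul_assoc]
    change IsOpen (MulAction.stabilizer G (g : G ⧸ U) : Set G)
    rw [h]
    exact hU.preimage (by fun_prop)
  finitary := by
    have : Subsingleton (MulAction.orbitRel.Quotient G (G ⧸ U)) :=
      (MulAction.pretransitive_iff_subsingleton_quotient _ _).1 inferInstance
    infer_instance

theorem coset_isTransitive [IsTopologicalGroup G] (U : Subgroup G) (hU : IsOpen (U : Set G)) :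
    (coset U hU).IsTransitive :=
  ⟨⟨((1 : G) : G ⧸ U)⟩, inferInstanceAs (MulAction.IsPretransitive G (G ⧸ U))⟩

/-- The base point of the `G`-set of cosets. -/
def cosetOne [IsTopologicalGroup G] (U : Subgroup G) (hU : IsOpen (U : Set G)) : coset U hU :=
  ((1 : G) : G ⧸ U)

theorem stabilizer_cosetOne [IsTopologicalGroup G] (U : Subgroup G) (hU : IsOpen (U : Set G)) :
    MulAction.stabilizer G (cosetOne U hU) = U :=
  MulAction.stabilizer_quotient U

/-- An invariant subset of a finitary `G`-set. -/
def sub (X : FinGSet G) (S : SubMulAction G X) : FinGSet G where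
  carrier := S
  smooth x := by
    rw [SubMulAction.stabilizer_of_subMul x]
    exact X.smooth x
  finitary := by
    have := X.finitary
    refine Finite.of_injective (Quotient.map' (fun x : S => (x : X)) ?_ :
      MulAction.orbitRel.Quotient G S → MulAction.orbitRel.Quotient G X) ?_
    · rintro x y ⟨g, rfl⟩
      exact ⟨g, rfl⟩
    · refine Quotient.ind fun x => Quotient.ind fun y h => ?_
      obtain ⟨g, hg⟩ := Quotient.exact h
      exact Quotient.sound ⟨g, Subtype.ext hg⟩

/-- The inclusion of an invariant subset. -/
def subIncl (X : FinGSet G) (S : SubMulAction G X) : X.sub S →[G] X where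
  toFun x := x.1
  map_smul' _ _ := rfl

/-- The complement of an invariant subset. -/
def complSub (X : FinGSet G) (S : SubMulAction G X) : SubMulAction G X where
  carrier := (S : Set X)ᶜ
  smul_mem' g x hx h := hx (by simpa using S.smul_mem g⁻¹ h)

theorem sub_isDecomposition (X : FinGSet G) (S : SubMulAction G X) :
    IsDecomposition (X.subIncl S) (X.subIncl (X.complSub S)) := by
  refine ⟨Subtype.val_injective, Subtype.val_injective, ?_⟩
  have h1 : Set.range (X.subIncl S) = S := Subtype.range_val
  have h2 : Set.range (X.subIncl (X.complSub S)) = (S : Set X)ᶜ := Subtype.range_val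
  rw [h1, h2]
  exact isCompl_compl

/-- The orbit of a point as an invariant subset. -/
def orbitSub (X : FinGSet G) (x : X) : SubMulAction G X where
  carrier := MulAction.orbit G x
  smul_mem' g _ h := (MulAction.mem_orbit_of_mem_orbit g h)

theorem sub_orbit_isTransitive (X : FinGSet G) (x : X) : (X.sub (X.orbitSub x)).IsTransitive := by
  refine .of_forall ⟨x, MulAction.mem_orbit_self x⟩ ?_
  rintro ⟨_, g, rfl⟩
  exact ⟨g, rfl⟩

/-- To prove an additive property of all finitary `G`-sets over `Y`, it suffices to treat
transitive ones. -/
theorem induction_hom {Y : FinGSet G} {P : ∀ X : FinGSet G, (X →[G] Y) → Prop}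
    (empty : ∀ (X : FinGSet G) (f : X →[G] Y), IsEmpty X → P X f)
    (add : ∀ (X X₁ X₂ : FinGSet G) (f : X →[G] Y) (i₁ : X₁ →[G] X) (i₂ : X₂ →[G] X),
      IsDecomposition i₁ i₂ → P X₁ (f.comp i₁) → P X₂ (f.comp i₂) → P X f)
    (trans : ∀ (X : FinGSet G) (f : X →[G] Y), X.IsTransitive → P X f) (X : FinGSet G) (f : X →[G] Y) : P X f := by
  induction hn : Nat.card (MulAction.orbitRel.Quotient G X) using Nat.strong_induction_on
    generalizing X with
  | _ n ih =>
    rcases isEmpty_or_nonempty X with hX | ⟨⟨x⟩⟩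
    · exact empty X f hX
    refine add X _ _ f _ _ (X.sub_isDecomposition (X.orbitSub x))
      (trans _ _ (X.sub_orbit_isTransitive x)) (ih _ ?_ _ _ rfl)
    rw [← hn]
    have := X.finitary
    have := (X.sub (X.complSub (X.orbitSub x))).finitary
    have := Fintype.ofFinite (MulAction.orbitRel.Quotient G X)
    have := Fintype.ofFinite
      (MulAction.orbitRel.Quotient G (X.sub (X.complSub (X.orbitSub x))))
    rw [Nat.card_eq_fintype_card, Nat.card_eq_fintype_card]
    refine Fintype.card_lt_of_injective_of_notMem (Quotient.map' (X.subIncl _) ?_ :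
      MulAction.orbitRel.Quotient G (X.sub (X.complSub (X.orbitSub x))) →
      MulAction.orbitRel.Quotient G X) ?_ (b := Quotient.mk _ x) ?_
    · rintro a b ⟨g, rfl⟩
      exact ⟨g, rfl⟩
    · refine Quotient.ind fun a => Quotient.ind fun b h => ?_
      obtain ⟨g, hg⟩ := Quotient.exact h
      exact Quotient.sound ⟨g, Subtype.ext hg⟩
    · rintro ⟨a, ha⟩
      induction a using Quotient.ind with
      | _ a =>
        have h : (X.subIncl _ a) ∈ MulAction.orbit G x := Quotient.exact ha
        exact a.2 h

end General

/-! ### Sums over orbits -/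

section OrbitSum

variable {G : Type u} [Group G] [TopologicalSpace G] {k : Type v}

/-- The sum of a function of the stabilizers over the orbits of a finitary `G`-set. -/
noncomputable def orbitSum [CommRing k] (F : Subgroup G → k) (X : FinGSet G) : k :=
  ∑ᶠ o : MulAction.orbitRel.Quotient G X, F (MulAction.stabilizer G o.out)

/-- Invariance of a function on open subgroups under conjugation. -/
def ConjInvariant (F : Subgroup G → k) : Prop :=
  ∀ (U : Subgroup G) (g : G), IsOpen (U : Set G) → F (U.map (MulAut.conj g).toMonoidHom) = F U

variable {F : Subgroup G → k}

theorem ConjInvariant.smul (hF : ConjInvariant F) {X : FinGSet G} (g : G) (x : X) :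
    F (MulAction.stabilizer G (g • x)) = F (MulAction.stabilizer G x) := by
  rw [MulAction.stabilizer_smul_eq_stabilizer_map_conj]
  exact hF _ _ (X.smooth x)

theorem ConjInvariant.out (hF : ConjInvariant F) {X : FinGSet G} (x : X) :
    F (MulAction.stabilizer G (Quotient.mk (MulAction.orbitRel G X) x).out) =
      F (MulAction.stabilizer G x) := by
  obtain ⟨g, hg⟩ := Quotient.mk_out (s := MulAction.orbitRel G X) x
  rw [← hg]
  exact hF.smul g x

variable [CommRing k]

theorem orbitSum_empty (F : Subgroup G → k) (X : FinGSet G) [IsEmpty X] : orbitSum F X = 0 := by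
  have : IsEmpty (MulAction.orbitRel.Quotient G X) := inferInstanceAs (IsEmpty (Quotient _))
  exact finsum_of_isEmpty _

theorem orbitSum_transitive (hF : ConjInvariant F) {X : FinGSet G} (hX : X.IsTransitive) (x : X) :
    orbitSum F X = F (MulAction.stabilizer G x) := by
  have := hX.2
  have : Subsingleton (MulAction.orbitRel.Quotient G X) :=
    (MulAction.pretransitive_iff_subsingleton_quotient _ _).1 inferInstance
  rw [← hF.out x]
  exact finsum_eq_single _ _ fun o ho => (ho (Subsingleton.elim _ _)).elim

theorem orbitSum_add (hF : ConjInvariant F) {X X₁ X₂ : FinGSet G} {i₁ : X₁ →[G] X}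
    {i₂ : X₂ →[G] X} (h : IsDecomposition i₁ i₂) :
    orbitSum F X = orbitSum F X₁ + orbitSum F X₂ := by
  have hmap : ∀ {A : FinGSet G} (i : A →[G] X) (a b : A), MulAction.orbitRel G A a b →
      MulAction.orbitRel G X (i a) (i b) := by
    rintro A i a b ⟨g, rfl⟩
    exact ⟨g, (map_smul i g b).symm⟩
  have hinj : ∀ {A : FinGSet G} (i : A →[G] X), Injective i → ∀ (a b : A),
      MulAction.orbitRel G X (i a) (i b) → MulAction.orbitRel G A a b := by
    rintro A i hi a b ⟨g, hg⟩
    exact ⟨g, hi (by rw [map_smul]; exact hg)⟩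
  have hdis : ∀ (a : X₁) (b : X₂), ¬ MulAction.orbitRel G X (i₁ a) (i₂ b) := by
    rintro a b ⟨g, hg⟩
    refine Set.disjoint_left.1 h.2.2.disjoint ⟨a, rfl⟩ ⟨g • b, ?_⟩
    rw [map_smul]; exact hg
  let e : MulAction.orbitRel.Quotient G X₁ ⊕ MulAction.orbitRel.Quotient G X₂ →
      MulAction.orbitRel.Quotient G X :=
    Sum.elim (Quotient.map' i₁ (hmap i₁)) (Quotient.map' i₂ (hmap i₂))
  have he : Bijective e := by
    constructor
    · rintro (a | a) (b | b) hab <;> induction a using Quotient.ind <;>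
        induction b using Quotient.ind
      · exact congrArg _ (Quotient.sound (hinj i₁ h.1 _ _ (Quotient.exact hab)))
      · exact (hdis _ _ (Quotient.exact hab)).elim
      · exact (hdis _ _ ((MulAction.orbitRel G X).symm (Quotient.exact hab))).elim
      · exact congrArg _ (Quotient.sound (hinj i₂ h.2.1 _ _ (Quotient.exact hab)))
    · refine Quotient.ind fun x => ?_
      have hx : x ∈ Set.range i₁ ⊔ Set.range i₂ := h.2.2.sup_eq_top ▸ trivial
      rcases hx with ⟨a, rfl⟩ | ⟨a, rfl⟩
      exacts [⟨Sum.inl (Quotient.mk _ a), rfl⟩, ⟨Sum.inr (Quotient.mk _ a), rfl⟩]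
  have := X₁.finitary
  have := X₂.finitary
  have := Fintype.ofFinite (MulAction.orbitRel.Quotient G X₁)
  have := Fintype.ofFinite (MulAction.orbitRel.Quotient G X₂)
  rw [orbitSum, ← finsum_comp e he, finsum_eq_sum_of_fintype, Fintype.sum_sum_type, orbitSum,
    orbitSum, finsum_eq_sum_of_fintype, finsum_eq_sum_of_fintype]
  congr 1
  · refine Finset.sum_congr rfl fun o _ => ?_
    induction o using Quotient.ind with
    | _ a =>
      change F (MulAction.stabilizer G (Quotient.mk _ (i₁ a)).out) = _
      rw [hF.out, hF.out, stabilizer_eq_of_injective i₁ h.1]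
  · refine Finset.sum_congr rfl fun o _ => ?_
    induction o using Quotient.ind with
    | _ a =>
      change F (MulAction.stabilizer G (Quotient.mk _ (i₂ a)).out) = _
      rw [hF.out, hF.out, stabilizer_eq_of_injective i₂ h.2.1]

/-- Computing an orbit sum by means of an invariant classifying the orbits. -/
theorem orbitSum_eq_sum (hF : ConjInvariant F) {X : FinGSet G} {α : Type*} {γ : Type*}
    [DecidableEq γ] (o : α → X) (ho : ∀ x : X, ∃ (a : α) (g : G), g • o a = x) (S : α → γ)
    (hS : ∀ a b, S a = S b ↔ ∃ g : G, g • o a = o b) (T : Finset γ)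
    (hT : ∀ c, c ∈ T ↔ ∃ a, S a = c) (H : γ → k)
    (hH : ∀ a, F (MulAction.stabilizer G (o a)) = H (S a)) :
    orbitSum F X = ∑ c ∈ T, H c := by
  choose c hc using fun x : T => (hT x).1 x.2
  let e : T → MulAction.orbitRel.Quotient G X := fun x => Quotient.mk _ (o (c x))
  have he : Bijective e := by
    constructor
    · intro x y hxy
      obtain ⟨g, hg⟩ := Quotient.exact hxy
      have := (hS (c y) (c x)).2 ⟨g, hg⟩
      rw [hc, hc] at this
      exact Subtype.ext this.symm
    · refine Quotient.ind fun x => ?_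
      obtain ⟨a, g, rfl⟩ := ho x
      refine ⟨⟨S a, (hT _).2 ⟨a, rfl⟩⟩, Quotient.sound ?_⟩
      obtain ⟨g', hg'⟩ := (hS a _).1 (hc ⟨S a, (hT _).2 ⟨a, rfl⟩⟩).symm
      refine ⟨g' * g⁻¹, ?_⟩
      change (g' * g⁻¹) • g • o a = _
      rw [smul_smul, inv_mul_cancel_right, hg']
  rw [orbitSum, ← finsum_comp e he, finsum_eq_sum_of_fintype, ← Finset.sum_coe_sort T]
  refine Finset.sum_congr rfl fun x _ => ?_
  change F (MulAction.stabilizer G (Quotient.mk _ (o (c x))).out) = _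
  rw [hF.out, hH, hc]

end OrbitSum

end FinGSet

/-! ### Incidence of classes, products and fibre products -/

section Incidence

variable {𝔛 : Type u} [TopologicalSpace 𝔛] [IsCantorSpace 𝔛]

/-- Double cosets of fixers are determined by the incidence of classes. -/
theorem exists_mem_fixer_of_incidence_eq {r s : Setoid 𝔛} (hr : r.IsOpenRel) (hs : s.IsOpenRel)
    {g g' : 𝔛 ≃ₜ 𝔛}
    (h : Set.range (fun x => (Quotient.mk r x, Quotient.mk s (g.symm x))) =
      Set.range (fun x => (Quotient.mk r x, Quotient.mk s (g'.symm x)))) :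
    ∃ k ∈ r.fixer, g'⁻¹ * k * g ∈ s.fixer := by
  obtain ⟨k, hk⟩ := exists_homeo_comp_eq
    (hr.isLocallyConstant.prodMk (hs.isLocallyConstant.comp_continuous g.symm.continuous))
    (hr.isLocallyConstant.prodMk (hs.isLocallyConstant.comp_continuous g'.symm.continuous)) h
  refine ⟨k, fun x => Quotient.exact (congrArg Prod.fst (hk x)), fun x => ?_⟩
  have h1 : s (g'.symm (k (g x))) (g.symm (g x)) :=
    Quotient.exact (congrArg Prod.snd (hk (g x)))
  rw [g.symm_apply_apply] at h1
  exact h1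

/-- For orbit representatives `x` and `z`, the orbit of `(x, g • z)` depends only on which classes
of the coarsest partition for `x` meet the `g`-images of those for `z`, and there are finitely many
such incidence patterns. -/
theorem finite_orbits_prod (X Z : FinGSet (𝔛 ≃ₜ 𝔛)) :
    Finite (MulAction.orbitRel.Quotient (𝔛 ≃ₜ 𝔛) (X × Z)) := by
  have hX := X.finitary
  have hZ := Z.finitary
  let F : X → Z → (𝔛 ≃ₜ 𝔛) → MulAction.orbitRel.Quotient (𝔛 ≃ₜ 𝔛) (X × Z) :=
    fun x z g => Quotient.mk _ (x, g • z)
  have hF : ∀ x z, (Set.range (F x z)).Finite := by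
    intro x z
    have hr := coarsest_isOpenRel (X.smooth x)
    have hs := coarsest_isOpenRel (Z.smooth z)
    have := hr.finite
    have := hs.finite
    let inc : (𝔛 ≃ₜ 𝔛) → Set (Quotient (coarsest (MulAction.stabilizer (𝔛 ≃ₜ 𝔛) x)) ×
        Quotient (coarsest (MulAction.stabilizer (𝔛 ≃ₜ 𝔛) z))) :=
      fun g => Set.range fun u => (Quotient.mk _ u, Quotient.mk _ (g.symm u))
    have hfac : Function.FactorsThrough (F x z) inc := by
      intro g g' h
      obtain ⟨k, hk, hk'⟩ := exists_mem_fixer_of_incidence_eq hr hs h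
      refine (Quotient.sound ⟨k, ?_⟩ : F x z g' = F x z g).symm
      have h1 : k • x = x := fixer_coarsest_le (X.smooth x) hk
      have h2 : (g'⁻¹ * k * g) • z = z := fixer_coarsest_le (Z.smooth z) hk'
      rw [mul_assoc, mul_smul, inv_smul_eq_iff, mul_smul] at h2
      exact Prod.ext h1 h2
    have : Nonempty (MulAction.orbitRel.Quotient (𝔛 ≃ₜ 𝔛) (X × Z)) := ⟨F x z 1⟩
    -- The incidence patterns form a finite type, so every function on them has finite range; the
    -- default value off the range of `inc` plays no role.
    refine (Set.finite_range (Function.extend inc (F x z) fun _ => Classical.arbitrary _)).subset ?_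
    rintro _ ⟨g, rfl⟩
    exact ⟨inc g, hfac.extend_apply _ g⟩
  refine Set.finite_univ_iff.1 (((Set.finite_iUnion fun a : MulAction.orbitRel.Quotient (𝔛 ≃ₜ 𝔛) X =>
    Set.finite_iUnion fun b : MulAction.orbitRel.Quotient (𝔛 ≃ₜ 𝔛) Z => hF a.out b.out)).subset ?_)
  intro q _
  induction q using Quotient.ind with
  | _ p =>
    obtain ⟨x, z⟩ := p
    obtain ⟨g, hg⟩ := Quotient.exact
      (Quotient.out_eq (Quotient.mk (MulAction.orbitRel (𝔛 ≃ₜ 𝔛) X) x)).symm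
    obtain ⟨k, hk⟩ := Quotient.exact
      (Quotient.out_eq (Quotient.mk (MulAction.orbitRel (𝔛 ≃ₜ 𝔛) Z) z)).symm
    refine Set.mem_iUnion.2 ⟨Quotient.mk _ x, Set.mem_iUnion.2 ⟨Quotient.mk _ z, g⁻¹ * k, ?_⟩⟩
    refine Quotient.sound ⟨g⁻¹, Prod.ext ?_ ?_⟩
    · change g⁻¹ • x = _
      rw [inv_smul_eq_iff]; exact hg.symm
    · change g⁻¹ • z = (g⁻¹ * k) • _
      rw [mul_smul]; exact congrArg _ hk.symm

namespace FinGSet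

/-- The product of two finitary sets for the homeomorphism group of a Cantor space. -/
def prod (X Z : FinGSet (𝔛 ≃ₜ 𝔛)) : FinGSet (𝔛 ≃ₜ 𝔛) where
  carrier := X × Z
  smooth p := by
    have : (MulAction.stabilizer (𝔛 ≃ₜ 𝔛) p : Set (𝔛 ≃ₜ 𝔛)) =
        (MulAction.stabilizer (𝔛 ≃ₜ 𝔛) p.1 : Set (𝔛 ≃ₜ 𝔛)) ∩
          MulAction.stabilizer (𝔛 ≃ₜ 𝔛) p.2 := by
      ext g
      exact Prod.ext_iff
    rw [this]
    exact (X.smooth _).inter (Z.smooth _)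
  finitary := finite_orbits_prod X Z

variable {X Y Z : FinGSet (𝔛 ≃ₜ 𝔛)}

/-- The fiber product of finitary sets. -/
def pullback (f : X →[𝔛 ≃ₜ 𝔛] Y) (g : Z →[𝔛 ≃ₜ 𝔛] Y) : FinGSet (𝔛 ≃ₜ 𝔛) :=
  (prod X Z).sub
    { carrier := {p : X × Z | f p.1 = g p.2}
      smul_mem' := fun k p (hp : f p.1 = g p.2) => by
        change f (k • p.1) = g (k • p.2)
        rw [map_smul, map_smul, hp] }

def pullbackFst (f : X →[𝔛 ≃ₜ 𝔛] Y) (g : Z →[𝔛 ≃ₜ 𝔛] Y) : pullback f g →[𝔛 ≃ₜ 𝔛] X where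
  toFun p := p.1.1
  map_smul' _ _ := rfl

def pullbackSnd (f : X →[𝔛 ≃ₜ 𝔛] Y) (g : Z →[𝔛 ≃ₜ 𝔛] Y) : pullback f g →[𝔛 ≃ₜ 𝔛] Z where
  toFun p := p.1.2
  map_smul' _ _ := rfl

theorem pullback_isCartesian (f : X →[𝔛 ≃ₜ 𝔛] Y) (g : Z →[𝔛 ≃ₜ 𝔛] Y) :
    IsCartesian (pullbackSnd f g) (pullbackFst f g) f g :=
  ⟨fun p => p.2, fun x z h => ⟨⟨(x, z), h⟩, ⟨rfl, rfl⟩, fun _ hp =>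
    Subtype.ext (Prod.ext hp.1 hp.2)⟩⟩

end FinGSet

end Incidence

/-! ### Calculus of cartesian squares -/

namespace FinGSet

section Cartesian

variable {G : Type u} [Group G] [TopologicalSpace G] {X Y Z X' : FinGSet G}
  {f' : X' →[G] Z} {g' : X' →[G] X} {f : X →[G] Y} {g : Z →[G] Y}

theorem IsCartesian.ext (h : IsCartesian f' g' f g) {a b : X'} (h1 : g' a = g' b)
    (h2 : f' a = f' b) : a = b :=
  (h.2 (g' b) (f' b) (h.1 b)).unique ⟨h1, h2⟩ ⟨rfl, rfl⟩

theorem IsCartesian.symm (h : IsCartesian f' g' f g) : IsCartesian g' f' g f :=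
  ⟨fun z => (h.1 z).symm, fun x y hxy => by
    obtain ⟨z, hz, hz'⟩ := h.2 y x hxy.symm
    exact ⟨z, hz.symm, fun w hw => hz' w hw.symm⟩⟩

theorem IsCartesian.stabilizer (h : IsCartesian f' g' f g) (a : X') :
    MulAction.stabilizer G a = MulAction.stabilizer G (g' a) ⊓ MulAction.stabilizer G (f' a) := by
  refine le_antisymm (le_inf (stabilizer_le_of_hom g' a) (stabilizer_le_of_hom f' a)) ?_
  rintro k ⟨h1, h2⟩
  refine h.ext ?_ ?_
  · rw [map_smul]; exact h1
  · rw [map_smul]; exact h2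

/-- Horizontal pasting of cartesian squares. -/
theorem IsCartesian.paste {W X'' : FinGSet G} {f'' : X'' →[G] W} {g'' : X'' →[G] X'}
    {k : W →[G] Z} (h : IsCartesian f' g' f g) (h' : IsCartesian f'' g'' f' k) :
    IsCartesian f'' (g'.comp g'') f (g.comp k) := by
  refine ⟨fun z => ?_, fun x y hxy => ?_⟩
  · change f (g' (g'' z)) = g (k (f'' z))
    rw [h.1, h'.1]
  · obtain ⟨z, ⟨hz1, hz2⟩, -⟩ := h.2 x (k y) hxy
    obtain ⟨w, ⟨hw1, hw2⟩, -⟩ := h'.2 z y hz2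
    refine ⟨w, ⟨?_, hw2⟩, fun w' ⟨h1, h2⟩ => h'.ext (h.ext ?_ ?_) ?_⟩
    · change g' (g'' w) = x
      rw [hw1, hz1]
    · rw [hw1, hz1]; exact h1
    · rw [h'.1, h'.1, h2, hw2]
    · rw [h2, hw2]

/-- Cancellation for cartesian squares. -/
theorem IsCartesian.of_paste {W X'' : FinGSet G} {f'' : X'' →[G] W} {l : X'' →[G] X}
    {k : W →[G] Z} (h : IsCartesian f' g' f g) (h' : IsCartesian f'' l f (g.comp k)) :
    ∃ g'' : X'' →[G] X', IsCartesian f'' g'' f' k := by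
  choose c hc using fun z : X'' => (h.2 (l z) (k (f'' z)) (h'.1 z)).exists
  refine ⟨⟨c, fun a z => h.ext ?_ ?_⟩, fun z => (hc z).2, fun x y hxy => ?_⟩
  · rw [(hc _).1, map_smul, map_smul, (hc _).1]; rfl
  · rw [(hc _).2, map_smul, map_smul, map_smul, (hc _).2]; rfl
  · obtain ⟨w, ⟨hw1, hw2⟩, -⟩ := h'.2 (g' x) y ((h.1 x).trans (congrArg g hxy))
    refine ⟨w, ⟨h.ext ?_ ?_, hw2⟩, fun w' ⟨h1, h2⟩ => h'.ext ?_ (h2.trans hw2.symm)⟩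
    · exact (hc w).1.trans hw1
    · rw [hxy, ← hw2]; exact (hc w).2
    · rw [← (hc w').1, hw1, ← h1]; rfl

theorem isCartesian_of_bijective (h : ∀ z, f (g' z) = g (f' z)) (h1 : Bijective g')
    (h2 : Injective g) : IsCartesian f' g' f g := by
  refine ⟨h, fun x y hxy => ?_⟩
  obtain ⟨z, rfl⟩ := h1.2 x
  exact ⟨z, ⟨rfl, h2 ((h z).symm.trans hxy)⟩, fun w hw => h1.1 hw.1⟩

/-- Decompositions are stable under base change. -/
theorem IsCartesian.isDecomposition {X₁ X₂ X₁' X₂' : FinGSet G} {i₁ : X₁ →[G] X}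
    {i₂ : X₂ →[G] X} {p₁ : X₁' →[G] X₁} {p₂ : X₂' →[G] X₂} {j₁ : X₁' →[G] X'} {j₂ : X₂' →[G] X'}
    (h : IsDecomposition i₁ i₂) (h1 : IsCartesian p₁ j₁ g' i₁) (h2 : IsCartesian p₂ j₂ g' i₂) :
    IsDecomposition j₁ j₂ := by
  refine ⟨fun a b hab => h1.ext hab (h.1 ?_), fun a b hab => h2.ext hab (h.2.1 ?_), ?_, ?_⟩
  · rw [← h1.1, ← h1.1, hab]
  · rw [← h2.1, ← h2.1, hab]
  · rw [Set.disjoint_iff_inter_eq_empty, Set.eq_empty_iff_forall_notMem]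
    rintro _ ⟨⟨a, rfl⟩, b, hb⟩
    exact Set.disjoint_left.1 h.2.2.disjoint ⟨p₁ a, rfl⟩ ⟨p₂ b, by rw [← h1.1, ← h2.1, hb]⟩
  · rw [codisjoint_iff, eq_top_iff]
    intro a _
    have ha : g' a ∈ Set.range i₁ ⊔ Set.range i₂ := h.2.2.sup_eq_top ▸ trivial
    rcases ha with ⟨x, hx⟩ | ⟨x, hx⟩
    · obtain ⟨z, hz, -⟩ := h1.2 a x hx.symm
      exact Or.inl ⟨z, hz.1⟩
    · obtain ⟨z, hz, -⟩ := h2.2 a x hx.symm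
      exact Or.inr ⟨z, hz.1⟩

end Cartesian

end FinGSet

/-! ### Counting total relations over a split -/

section Count

/-- The map collapses exactly the two distinct points `b` and `c`. -/
def CollapsesPair {R : Type*} {B : Type*} (π : R → B) (b c : R) : Prop :=
  b ≠ c ∧ ∀ i j, π i = π j ↔ i = j ∨ (i = b ∧ j = c) ∨ (i = c ∧ j = b)

open Classical in
/-- The relations between two finite sets over `B` that are total on both sides, seen as
set-valued functions. -/
noncomputable def totalRelations {Q : Type*} {R : Type*} {B : Type*} [Fintype Q] [Fintype R]
    (σ : Q → B) (π : R → B) : Finset (Q → Finset R) :=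
  Finset.univ.filter fun S => (∀ q, (S q).Nonempty ∧ ∀ c ∈ S q, π c = σ q) ∧ ∀ c, ∃ q, c ∈ S q

/-- Choosing for each `q` a nonempty subset of the fibre of `π` over `σ q` contributes a factor `z`
for a one-point fibre and `2z + z²` for the fibre `{b, c}`. Such a choice fails to cover `R` exactly
when it omits `b` everywhere or omits `c` everywhere; each of these cases leaves one-point fibres
only and contributes `z ^ |Q|`. -/
theorem sum_totalRelations {Q : Type*} {R : Type*} {B : Type*} [Fintype Q] [Fintype R]
    [DecidableEq B] {σ : Q → B} {π : R → B} (hσ : Surjective σ) (hπ : Surjective π) {b c : R}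
    (h : CollapsesPair π b c) {k : Type*} [CommRing k] (z : k) :
    ∑ S ∈ totalRelations σ π, z ^ (∑ q, (S q).card) =
      z ^ (Finset.univ.filter fun q => σ q ≠ π b).card *
        (2 * z + z ^ 2) ^ (Finset.univ.filter fun q => σ q = π b).card -
        2 * z ^ Fintype.card Q := by
  classical
  let K : Q → Finset R := fun q => Finset.univ.filter fun i => π i = σ q
  have hKm : ∀ q i, i ∈ K q ↔ π i = σ q := by simp [K]
  let A : (Q → Finset R) → Finset (Q → Finset R) := fun K =>
    Fintype.piFinset fun q => (K q).powerset.erase ∅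
  have hA : ∀ K S, S ∈ A K ↔ ∀ q, (S q).Nonempty ∧ S q ⊆ K q := by
    intro K S
    simp [A, Fintype.mem_piFinset, Finset.nonempty_iff_ne_empty]
  have hsum : ∀ K : Q → Finset R, ∑ S ∈ A K, z ^ (∑ q, (S q).card) =
      ∏ q, ((1 + z) ^ (K q).card - 1) := by
    intro K
    simp_rw [← Finset.prod_pow_eq_pow_sum]
    refine (Finset.prod_univ_sum (fun q => (K q).powerset.erase ∅)
      fun _ (T : Finset R) => z ^ T.card).symm.trans ?_
    refine Finset.prod_congr rfl fun q _ => ?_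
    rw [Finset.sum_erase_eq_sub (Finset.empty_mem_powerset _), add_comm 1 z,
      ← Finset.sum_pow_mul_eq_add_pow]
    simp
  have hb : ∀ i, i = b ∨ i = c ↔ π i = π b := by
    intro i
    rw [h.2]
    constructor
    · rintro (rfl | rfl)
      exacts [Or.inl rfl, Or.inr (Or.inr ⟨rfl, rfl⟩)]
    · rintro (h | ⟨h, -⟩ | ⟨h, -⟩)
      exacts [Or.inl h, Or.inl h, Or.inr h]
  have hpc : π c = π b := (hb c).1 (Or.inr rfl)
  have hK1 : ∀ q, σ q = π b → K q = {b, c} := by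
    intro q hq
    ext i
    rw [hKm, hq, ← hb]; simp
  have hK2 : ∀ q, σ q ≠ π b → ∃ i, i ≠ b ∧ i ≠ c ∧ K q = {i} := by
    intro q hq
    obtain ⟨i, hi⟩ := hπ (σ q)
    have hib : ¬ (i = b ∨ i = c) := fun h' => hq (hi.symm.trans ((hb i).1 h'))
    push Not at hib
    refine ⟨i, hib.1, hib.2, ?_⟩
    ext j
    rw [hKm, ← hi, h.2, Finset.mem_singleton]
    simp [hib.1, hib.2]
  have hsingle : ∀ d, d = b ∨ d = c → ∏ q, ((1 + z) ^ ((K q).erase d).card - 1) =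
      z ^ Fintype.card Q := by
    intro d hd
    rw [Finset.prod_congr rfl (g := fun _ => z), Finset.prod_const, Finset.card_univ]
    intro q _
    have : ((K q).erase d).card = 1 := by
      by_cases hq : σ q = π b
      · rw [Finset.card_erase_of_mem (by rw [hKm, hq]; exact (hb d).1 hd), hK1 q hq,
          Finset.card_pair h.1]
      · obtain ⟨i, h1, h2, h3⟩ := hK2 q hq
        rw [h3, Finset.erase_eq_of_notMem, Finset.card_singleton]
        rw [Finset.mem_singleton]
        rintro rfl
        exact hd.elim h1 h2
    rw [this]; ring
  -- Some `q` lies over `π b`, and its nonempty subset of `{b, c}` cannot avoid both points.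
  have hdis : Disjoint (A fun q => (K q).erase b) (A fun q => (K q).erase c) := by
    rw [Finset.disjoint_left]
    intro S h1 h2
    rw [hA] at h1 h2
    obtain ⟨q, hq⟩ := hσ (π b)
    obtain ⟨i, hi⟩ := (h1 q).1
    have h3 := (h1 q).2 hi
    have h4 := (h2 q).2 hi
    rw [Finset.mem_erase, hK1 q hq] at h3 h4
    simp only [Finset.mem_insert, Finset.mem_singleton] at h3 h4
    exact h3.2.elim h3.1 h4.1
  -- Points other than `b` and `c` are alone in their fibres, so they are always covered.
  have hunion : A K = totalRelations σ π ∪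
      ((A fun q => (K q).erase b) ∪ (A fun q => (K q).erase c)) := by
    ext S
    simp only [Finset.mem_union, hA, totalRelations, Finset.mem_filter, Finset.mem_univ, true_and]
    constructor
    · intro hS
      by_cases hSb : ∃ q, b ∈ S q
      · by_cases hSc : ∃ q, c ∈ S q
        · left
          refine ⟨fun q => ⟨(hS q).1, fun i hi => (hKm q i).1 ((hS q).2 hi)⟩, fun i => ?_⟩
          by_cases hi : i = b ∨ i = c
          · rcases hi with rfl | rfl
            exacts [hSb, hSc]
          · obtain ⟨q, hq⟩ := hσ (π i)
            obtain ⟨j, hj⟩ := (hS q).1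
            have h3 := (hKm q j).1 ((hS q).2 hj)
            rw [hq, h.2] at h3
            push Not at hi
            rcases h3 with rfl | ⟨-, h3⟩ | ⟨-, h3⟩
            exacts [⟨q, hj⟩, (hi.2 h3).elim, (hi.1 h3).elim]
        · right; right
          push Not at hSc
          exact fun q => ⟨(hS q).1, Finset.subset_erase.2 ⟨(hS q).2, hSc q⟩⟩
      · right; left
        push Not at hSb
        exact fun q => ⟨(hS q).1, Finset.subset_erase.2 ⟨(hS q).2, hSb q⟩⟩
    · rintro (h1 | h1 | h1) q
      · exact ⟨(h1.1 q).1, fun i hi => (hKm q i).2 ((h1.1 q).2 i hi)⟩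
      · exact ⟨(h1 q).1, (h1 q).2.trans (Finset.erase_subset _ _)⟩
      · exact ⟨(h1 q).1, (h1 q).2.trans (Finset.erase_subset _ _)⟩
  have hdis2 : Disjoint (totalRelations σ π)
      ((A fun q => (K q).erase b) ∪ (A fun q => (K q).erase c)) := by
    rw [Finset.disjoint_left]
    intro S h1 h2
    simp only [totalRelations, Finset.mem_filter, Finset.mem_univ, true_and] at h1
    rw [Finset.mem_union, hA, hA] at h2
    rcases h2 with h2 | h2
    · obtain ⟨q, hq⟩ := h1.2 b
      exact Finset.notMem_erase _ _ ((h2 q).2 hq)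
    · obtain ⟨q, hq⟩ := h1.2 c
      exact Finset.notMem_erase _ _ ((h2 q).2 hq)
  have key := hsum K
  rw [hunion, Finset.sum_union hdis2, Finset.sum_union hdis, hsum, hsum, hsingle b (Or.inl rfl),
    hsingle c (Or.inr rfl)] at key
  have hprod : ∏ q, ((1 + z) ^ (K q).card - 1) =
      z ^ (Finset.univ.filter fun q => σ q ≠ π b).card *
        (2 * z + z ^ 2) ^ (Finset.univ.filter fun q => σ q = π b).card := by
    rw [← Finset.prod_filter_mul_prod_filter_not Finset.univ (fun q => σ q = π b), mul_comm]
    congr 1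
    · rw [← Finset.prod_const]
      refine Finset.prod_congr rfl fun q hq => ?_
      obtain ⟨i, -, -, h3⟩ := hK2 q (Finset.mem_filter.1 hq).2
      rw [h3, Finset.card_singleton]; ring
    · rw [← Finset.prod_const]
      refine Finset.prod_congr rfl fun q hq => ?_
      rw [hK1 q (Finset.mem_filter.1 hq).2, Finset.card_pair h.1]; ring
  rw [← hprod, ← key]; ring

end Count

/-! ### Orbits of fibre products as incidence relations -/

section CartesianCount

theorem numClasses_ker {A : Type*} {Q : Type*} {R : Type*} [Fintype Q] [Fintype R] [DecidableEq Q]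
    (φ : A → Q × R) (S : Q → Finset R) (hS : ∀ q c, c ∈ S q ↔ ∃ u, φ u = (q, c)) :
    Nat.card (Quotient (Setoid.ker φ)) = ∑ q, (S q).card := by
  classical
  have h : Set.range φ = ((Finset.univ.filter fun p : Q × R => p.2 ∈ S p.1 : Finset (Q × R)) :
      Set (Q × R)) := by
    ext ⟨q, c⟩
    simp [hS]
  rw [Nat.card_congr (Setoid.quotientKerEquivRange φ), h, Nat.card_coe_set_eq,
    Set.ncard_coe_finset, Finset.card_eq_sum_card_fiberwise (f := Prod.fst) (t := Finset.univ)
      fun _ _ => Finset.mem_coe.2 (Finset.mem_univ _)]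
  refine Finset.sum_congr rfl fun q _ => ?_
  refine Eq.trans (congrArg Finset.card ?_)
    (Finset.card_image_of_injective (f := fun c : R => (q, c)) (S q)
      fun _ _ h => (Prod.ext_iff.1 h).2)
  ext ⟨q', c⟩
  simp only [Finset.mem_filter, Finset.mem_univ, true_and, Finset.mem_image,
    Prod.mk.injEq]
  constructor
  · rintro ⟨h1, rfl⟩
    exact ⟨c, h1, rfl, rfl⟩
  · rintro ⟨d, h1, rfl, rfl⟩
    exact ⟨h1, rfl⟩

/-- The natural map from the classes of a finer partition to those of a coarser one. -/
def Setoid.quotientMap {A : Type*} {r s : Setoid A} (h : r ≤ s) : Quotient r → Quotient s := Quotient.map' id h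

theorem Setoid.quotientMap_surjective {A : Type*} {r s : Setoid A} (h : r ≤ s) :
    Surjective (Setoid.quotientMap h) := Quotient.ind fun x => ⟨Quotient.mk r x, rfl⟩

variable {𝔛 : Type u} [TopologicalSpace 𝔛] [IsCantorSpace 𝔛]

open FinGSet in
/-- The orbits of a fiber product of coset spaces of fixers correspond to incidence relations. -/
theorem orbitSum_cartesian {X Y Z X' : FinGSet (𝔛 ≃ₜ 𝔛)} {f' : X' →[𝔛 ≃ₜ 𝔛] Z}
    {g' : X' →[𝔛 ≃ₜ 𝔛] X} {f : X →[𝔛 ≃ₜ 𝔛] Y} {p : Z →[𝔛 ≃ₜ 𝔛] Y} (hc : IsCartesian f' g' f p)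
    (hX : X.IsTransitive) (hZ : Z.IsTransitive) {x₀ : X} {z₀ : Z} (h₀ : f x₀ = p z₀)
    {r r₁ s : Setoid 𝔛} (hr₁ : r₁.IsOpenRel) (hs : s.IsOpenRel)
    (hx : MulAction.stabilizer (𝔛 ≃ₜ 𝔛) x₀ = s.fixer)
    (hz : MulAction.stabilizer (𝔛 ≃ₜ 𝔛) z₀ = r₁.fixer)
    (hy : MulAction.stabilizer (𝔛 ≃ₜ 𝔛) (f x₀) = r.fixer) (hsr : s ≤ r) (h1r : r₁ ≤ r)
    {k : Type v} [CommRing k] {F : Subgroup (𝔛 ≃ₜ 𝔛) → k} (hF : ConjInvariant F) (H : ℕ → k)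
    (hFH : ∀ t : Setoid 𝔛, t.IsOpenRel → F t.fixer = H t.numClasses) [Fintype (Quotient s)]
    [Fintype (Quotient r₁)] :
    orbitSum F X' = ∑ S ∈ totalRelations (Setoid.quotientMap hsr) (Setoid.quotientMap h1r),
      H (∑ q, (S q).card) := by
  classical
  -- Every orbit of `X'` meets the fibre over `z₀`, where the points have the form `(l • x₀, z₀)`
  -- with `l` fixing the common image, that is, `l ∈ r.fixer`.
  have hex : ∀ l : r.fixer, ∃ a : X', g' a = l.1 • x₀ ∧ f' a = z₀ := by
    intro l
    refine (hc.2 _ _ ?_).exists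
    have : l.1 ∈ MulAction.stabilizer (𝔛 ≃ₜ 𝔛) (f x₀) := by rw [hy]; exact l.2
    rw [map_smul, MulAction.mem_stabilizer_iff.1 this, h₀]
  choose o ho1 ho2 using hex
  -- The invariant of `l`: the classes of `r₁` met by the `l`-image of each class of `s`.
  let S : r.fixer → Quotient s → Finset (Quotient r₁) := fun l q =>
    Finset.univ.filter fun c => ∃ u, Quotient.mk s u = q ∧ Quotient.mk r₁ (l.1 u) = c
  have hS : ∀ l q c, c ∈ S l q ↔ ∃ u, Quotient.mk s u = q ∧ Quotient.mk r₁ (l.1 u) = c := by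
    simp [S]
  have hmove : ∀ (l l' : r.fixer) (g : 𝔛 ≃ₜ 𝔛),
      g • o l = o l' ↔ g ∈ r₁.fixer ∧ l'.1⁻¹ * g * l.1 ∈ s.fixer := by
    intro l l' g
    rw [← hz, ← hx, MulAction.mem_stabilizer_iff, MulAction.mem_stabilizer_iff, mul_assoc,
      mul_smul, inv_smul_eq_iff, mul_smul]
    constructor
    · intro h
      rw [← ho2 l, ← map_smul, h, ho2 l', ho2 l, ← ho1 l, ← map_smul, h, ho1 l']
      exact ⟨rfl, rfl⟩
    · rintro ⟨h1, h2⟩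
      refine hc.ext ?_ ?_
      · rw [map_smul, ho1, ho1, h2]
      · rw [map_smul, ho2, ho2, h1]
  have hsub : ∀ (l l' : r.fixer) (g : 𝔛 ≃ₜ 𝔛), g ∈ r₁.fixer → l'.1⁻¹ * g * l.1 ∈ s.fixer →
      ∀ q c, c ∈ S l q → c ∈ S l' q := by
    intro l l' g h1 h2 q c
    rw [hS, hS]
    rintro ⟨u, rfl, rfl⟩
    refine ⟨(l'.1⁻¹ * g * l.1) u, Quotient.sound (h2 u), Quotient.sound ?_⟩
    change r₁ (l'.1 (l'.1.symm (g (l.1 u)))) _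
    rw [l'.1.apply_symm_apply]
    exact h1 _
  refine orbitSum_eq_sum hF o ?_ S ?_ _ ?_ (fun S => H (∑ q, (S q).card)) ?_
  · intro a
    obtain ⟨g, hg⟩ := hZ.exists_smul_eq z₀ (f' a)
    obtain ⟨l, hl⟩ := hX.exists_smul_eq x₀ (g' (g⁻¹ • a))
    have hl' : l ∈ r.fixer := by
      rw [← hy, MulAction.mem_stabilizer_iff, ← map_smul, hl, hc.1, map_smul, ← hg,
        inv_smul_smul, h₀]
    refine ⟨⟨l, hl'⟩, g, hc.ext ?_ ?_⟩
    · rw [map_smul, ho1, hl, map_smul, smul_inv_smul]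
    · rw [map_smul, ho2, hg]
  · intro l l'
    constructor
    · intro h
      obtain ⟨g, h1, h2⟩ := exists_mem_fixer_of_incidence_eq hr₁ hs (g := l.1) (g' := l'.1) (by
        have key : ∀ l : r.fixer, Set.range (fun x => (Quotient.mk r₁ x,
            Quotient.mk s (l.1.symm x))) = {p | p.1 ∈ S l p.2} := by
          intro l
          ext ⟨c, q⟩
          simp only [Set.mem_range, Set.mem_ofPred_eq, hS, Prod.mk.injEq]
          constructor
          · rintro ⟨u, rfl, rfl⟩
            exact ⟨l.1.symm u, rfl, by rw [l.1.apply_symm_apply]⟩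
          · rintro ⟨u, rfl, rfl⟩
            exact ⟨l.1 u, rfl, by rw [l.1.symm_apply_apply]⟩
        rw [key, key, h])
      exact ⟨g, (hmove l l' g).2 ⟨h1, h2⟩⟩
    · rintro ⟨g, hg⟩
      obtain ⟨h1, h2⟩ := (hmove l l' g).1 hg
      obtain ⟨h3, h4⟩ := (hmove l' l g⁻¹).1 (by rw [← hg, inv_smul_smul])
      exact funext fun q => Finset.ext fun c => ⟨hsub l l' g h1 h2 q c, hsub l' l _ h3 h4 q c⟩
  · intro T
    simp only [totalRelations, Finset.mem_filter, Finset.mem_univ, true_and]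
    constructor
    · rintro ⟨h1, h2⟩
      -- To realize a prescribed relation `T`, cut both `s` and `r₁` into pieces indexed by the
      -- incident pairs and let `l` match the pieces. As `T` lives over the classes of `r`, this `l`
      -- fixes them.
      obtain ⟨φ, hφ, hφs, hφ1⟩ := exists_refinement hs
        (π := fun p : {p : Quotient s × Quotient r₁ // p.2 ∈ T p.1} => p.1.1) fun q => by
          obtain ⟨c, hc⟩ := (h1 q).1
          exact ⟨⟨(q, c), hc⟩, rfl⟩
      obtain ⟨ψ, hψ, hψs, hψ1⟩ := exists_refinement hr₁
        (π := fun p : {p : Quotient s × Quotient r₁ // p.2 ∈ T p.1} => p.1.2) fun c => by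
          obtain ⟨q, hq⟩ := h2 c
          exact ⟨⟨(q, c), hq⟩, rfl⟩
      obtain ⟨l, hl⟩ := exists_homeo_comp_eq hφ hψ
        (by rw [Set.range_eq_univ.2 hφs, Set.range_eq_univ.2 hψs])
      have hl1 : ∀ u, Quotient.mk r₁ (l u) = (φ u).1.2 := fun u => by rw [← hψ1, hl]
      have hlr : l ∈ r.fixer := fun u => by
        have h3 := (h1 (φ u).1.1).2 _ (φ u).2
        rw [hφ1, ← hl1] at h3
        exact Quotient.exact h3
      refine ⟨⟨l, hlr⟩, funext fun q => Finset.ext fun c => ?_⟩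
      rw [hS]
      constructor
      · rintro ⟨u, rfl, rfl⟩
        change Quotient.mk r₁ (l u) ∈ _
        rw [hl1, ← hφ1]
        exact (φ u).2
      · intro hc
        obtain ⟨u, hu⟩ := hφs ⟨(q, c), hc⟩
        exact ⟨u, by rw [← hφ1, hu], by change Quotient.mk r₁ (l u) = c; rw [hl1, hu]⟩
    · rintro ⟨l, rfl⟩
      refine ⟨fun q => ⟨?_, fun c => ?_⟩, fun c => ?_⟩
      · induction q using Quotient.ind with
        | _ u => exact ⟨Quotient.mk r₁ (l.1 u), (hS _ _ _).2 ⟨u, rfl, rfl⟩⟩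
      · rw [hS]
        rintro ⟨u, rfl, rfl⟩
        exact Quotient.sound (l.2 u)
      · induction c using Quotient.ind with
        | _ u => exact ⟨Quotient.mk s (l.1.symm u), (hS _ _ _).2
            ⟨l.1.symm u, rfl, by rw [l.1.apply_symm_apply]⟩⟩
  · intro l
    rw [hc.stabilizer, ho1, ho2, hz, MulAction.stabilizer_smul_eq_stabilizer_map_conj, hx,
      ← Setoid.fixer_translate, ← Setoid.fixer_inf, hFH _ ((hs.translate _).inf hr₁)]
    congr 1
    -- The stabilizer is the fixer of the common refinement of `r₁` and the translate of `s`, which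
    -- has one class for each incident pair.
    have ht : s.translate l.1 ⊓ r₁ =
        Setoid.ker fun u => (Quotient.mk s (l.1.symm u), Quotient.mk r₁ u) := by
      ext u v
      simp only [Setoid.ker_def, Prod.mk.injEq, Quotient.eq]
      rfl
    rw [ht]
    refine numClasses_ker _ _ fun q c => ?_
    rw [hS]
    simp only [Prod.mk.injEq]
    constructor
    · rintro ⟨u, rfl, rfl⟩
      exact ⟨l.1 u, by rw [l.1.symm_apply_apply], rfl⟩
    · rintro ⟨u, rfl, rfl⟩
      exact ⟨l.1.symm u, rfl, by rw [l.1.apply_symm_apply]⟩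

end CartesianCount

/-! ### Splits of one class and chains of splits -/

section Split

/-- The partition `r₁` arises from `r` by splitting one class in two. -/
def IsSplit {𝔛 : Type u} (r₁ r : Setoid 𝔛) : Prop :=
  ∃ h : r₁ ≤ r, ∃ b c, CollapsesPair (Setoid.quotientMap h) b c

variable {𝔛 : Type u} [TopologicalSpace 𝔛]

theorem IsSplit.numClasses [CompactSpace 𝔛] {r₁ r : Setoid 𝔛} (h : IsSplit r₁ r)
    (hr : r₁.IsOpenRel) : r₁.numClasses = r.numClasses + 1 := by
  classical
  obtain ⟨hle, b, c, hbc⟩ := h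
  have := hr.finite
  have := Fintype.ofFinite (Quotient r₁)
  have e : Bijective fun i : {i : Quotient r₁ // i ≠ c} => Setoid.quotientMap hle i.1 := by
    constructor
    · intro i j hij
      rcases (hbc.2 _ _).1 hij with h | ⟨-, h⟩ | ⟨h, -⟩
      exacts [Subtype.ext h, (j.2 h).elim, (i.2 h).elim]
    · intro q
      obtain ⟨i, rfl⟩ := Setoid.quotientMap_surjective hle q
      by_cases hi : i = c
      · exact ⟨⟨b, hbc.1⟩, (hbc.2 _ _).2 (Or.inr (Or.inl ⟨rfl, hi⟩))⟩
      · exact ⟨⟨i, hi⟩, rfl⟩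
  have h1 : r.numClasses = Fintype.card {i : Quotient r₁ // i ≠ c} := by
    rw [Setoid.numClasses, ← Nat.card_congr (Equiv.ofBijective _ e), Nat.card_eq_fintype_card]
  rw [h1, Fintype.card_subtype_compl, Fintype.card_subtype_eq, Setoid.numClasses,
    Nat.card_eq_fintype_card]
  have : 0 < Fintype.card (Quotient r₁) := Fintype.card_pos_iff.2 ⟨b⟩
  omega

/-- Any proper refinement of a partition factors through a split. -/
theorem exists_isSplit {𝔛 : Type u} {t r : Setoid 𝔛} (h : t ≤ r) (hne : t ≠ r) :
    ∃ r', IsSplit t r' ∧ r' ≤ r := by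
  classical
  obtain ⟨x, y, hxy, hn⟩ : ∃ x y, r x y ∧ ¬ t x y := by
    by_contra! hcon
    exact hne (le_antisymm h fun {x y} hxy => hcon x y hxy)
  -- The coarser partition absorbs the class of `y` into the class of `x`.
  have hle : t ≤ Setoid.ker fun z => if Quotient.mk t z = Quotient.mk t y then Quotient.mk t x
      else Quotient.mk t z := by
    intro z w hzw
    rw [Setoid.ker_def, (Quotient.sound hzw : Quotient.mk t z = Quotient.mk t w)]
  refine ⟨_, ⟨hle, Quotient.mk t x, Quotient.mk t y, fun he => hn (Quotient.exact he), ?_⟩, ?_⟩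
  · have hxy' : Quotient.mk t x ≠ Quotient.mk t y := fun he => hn (Quotient.exact he)
    refine Quotient.ind fun z => Quotient.ind fun w => ?_
    change (Quotient.mk _ z = Quotient.mk _ w) ↔ _
    rw [Quotient.eq, Setoid.ker_def]
    split_ifs with h1 h2 h2
    · simp [h1, h2]
    · simp only [h1, Ne.symm h2, hxy'.symm, false_and, true_and, false_or]
      exact eq_comm
    · simp [h1, h2]
    · simp [h1, h2]
  · intro z w hzw
    rw [Setoid.ker_def] at hzw
    split_ifs at hzw with h1 h2 h2
    · exact r.trans (h (Quotient.exact h1)) (r.symm (h (Quotient.exact h2)))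
    · exact r.trans (h (Quotient.exact h1)) (r.trans (r.symm hxy) (h (Quotient.exact hzw)))
    · exact r.trans (h (Quotient.exact hzw)) (r.trans hxy (r.symm (h (Quotient.exact h2))))
    · exact h (Quotient.exact hzw)

theorem refinement_induction [CompactSpace 𝔛] {r : Setoid 𝔛} {P : Setoid 𝔛 → Prop} (base : P r)
    (step : ∀ t r' : Setoid 𝔛, t.IsOpenRel → IsSplit t r' → r' ≤ r → P r' → P t)
    {t : Setoid 𝔛} (ht : t.IsOpenRel) (h : t ≤ r) : P t := by
  induction hn : t.numClasses using Nat.strong_induction_on generalizing t with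
  | _ n ih =>
    by_cases he : t = r
    · exact he ▸ base
    obtain ⟨r', h1, h2⟩ := exists_isSplit h he
    refine step t r' ht h1 h2 (ih _ ?_ (ht.mono h1.1) h2 rfl)
    have := h1.numClasses ht
    omega

end Split

/-! ### Fibres and finite covers -/

namespace FinGSet

section Fibers

variable {G : Type u} [Group G] [TopologicalSpace G]

/-- The fibre is an orbit of the stabilizer of `f x`. For an infinite fibre both sides are zero by
convention. -/
theorem ncard_fiber {X Y : FinGSet G} (hX : X.IsTransitive) (f : X →[G] Y) (x : X) :
    (f ⁻¹' {f x}).ncard =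
      (MulAction.stabilizer G x).relIndex (MulAction.stabilizer G (f x)) := by
  have h : f ⁻¹' {f x} = MulAction.orbit (MulAction.stabilizer G (f x)) x := by
    ext y
    constructor
    · intro hy
      obtain ⟨g, rfl⟩ := hX.exists_smul_eq x y
      exact ⟨⟨g, by rw [MulAction.mem_stabilizer_iff, ← map_smul]; exact hy⟩, rfl⟩
    · rintro ⟨g, rfl⟩
      change f (g.1 • x) = f x
      rw [map_smul]
      exact g.2
  rw [h, ← MulAction.index_stabilizer]
  rfl

theorem IsDecomposition.preimage_eq {X X₁ X₂ Y : FinGSet G} {i₁ : X₁ →[G] X} {i₂ : X₂ →[G] X}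
    (h : IsDecomposition i₁ i₂) (f : X →[G] Y) (y : Y) :
    f ⁻¹' {y} = i₁ '' (f.comp i₁ ⁻¹' {y}) ∪ i₂ '' (f.comp i₂ ⁻¹' {y}) := by
  ext x
  constructor
  · intro hx
    have hx' : x ∈ Set.range i₁ ⊔ Set.range i₂ := h.2.2.sup_eq_top ▸ trivial
    rcases hx' with ⟨a, rfl⟩ | ⟨a, rfl⟩
    exacts [Or.inl ⟨a, hx, rfl⟩, Or.inr ⟨a, hx, rfl⟩]
  · rintro (⟨a, ha, rfl⟩ | ⟨a, ha, rfl⟩)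
    exacts [ha, ha]

theorem IsDecomposition.finite_preimage {X X₁ X₂ Y : FinGSet G} {i₁ : X₁ →[G] X}
    {i₂ : X₂ →[G] X} (h : IsDecomposition i₁ i₂) (f : X →[G] Y) (y : Y)
    (h1 : (f.comp i₁ ⁻¹' {y}).Finite) (h2 : (f.comp i₂ ⁻¹' {y}).Finite) : (f ⁻¹' {y}).Finite := by
  rw [h.preimage_eq]
  exact (h1.image _).union (h2.image _)

theorem IsDecomposition.ncard_preimage {X X₁ X₂ Y : FinGSet G} {i₁ : X₁ →[G] X}
    {i₂ : X₂ →[G] X} (h : IsDecomposition i₁ i₂) (f : X →[G] Y) (y : Y)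
    (h1 : (f.comp i₁ ⁻¹' {y}).Finite) (h2 : (f.comp i₂ ⁻¹' {y}).Finite) :
    (f ⁻¹' {y}).ncard = (f.comp i₁ ⁻¹' {y}).ncard + (f.comp i₂ ⁻¹' {y}).ncard := by
  rw [h.preimage_eq, Set.ncard_union_eq _ (h1.image _) (h2.image _),
    Set.ncard_image_of_injective _ h.1, Set.ncard_image_of_injective _ h.2.1]
  exact h.2.2.disjoint.mono (Set.image_subset_range _ _) (Set.image_subset_range _ _)

theorem IsCartesian.ncard_fiber {X Y Z X' : FinGSet G} {f' : X' →[G] Z} {g' : X' →[G] X}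
    {f : X →[G] Y} {g : Z →[G] Y} (h : IsCartesian f' g' f g) (z : Z) :
    (f' ⁻¹' {z}).ncard = (f ⁻¹' {g z}).ncard := by
  refine Set.ncard_congr (fun a _ => g' a) ?_ ?_ ?_
  · intro a (ha : f' a = z)
    change f (g' a) = g z
    rw [h.1, ha]
  · intro a b (ha : f' a = z) (hb : f' b = z) hab
    exact h.ext hab (ha.trans hb.symm)
  · intro x hx
    obtain ⟨a, ha, -⟩ := h.2 x z hx
    exact ⟨a, ha.2, ha.1⟩

end Fibers

section Covers

variable {𝔛 : Type u} [TopologicalSpace 𝔛]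

/-- A finite covering: point stabilizers upstairs contain the same fixers as those downstairs. -/
def IsCover {X Y : FinGSet (𝔛 ≃ₜ 𝔛)} (f : X →[𝔛 ≃ₜ 𝔛] Y) : Prop :=
  ∀ (x : X) (t : Setoid 𝔛), t.IsOpenRel → t.fixer ≤ MulAction.stabilizer (𝔛 ≃ₜ 𝔛) (f x) →
    t.fixer ≤ MulAction.stabilizer (𝔛 ≃ₜ 𝔛) x

theorem IsCartesian.isCover {X Y Z X' : FinGSet (𝔛 ≃ₜ 𝔛)} {f' : X' →[𝔛 ≃ₜ 𝔛] Z}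
    {g' : X' →[𝔛 ≃ₜ 𝔛] X} {f : X →[𝔛 ≃ₜ 𝔛] Y} {g : Z →[𝔛 ≃ₜ 𝔛] Y} (h : IsCartesian f' g' f g)
    (hf : IsCover f) : IsCover f' := by
  intro a t ht hta
  rw [h.stabilizer]
  refine le_inf (hf _ t ht ?_) hta
  rw [h.1]
  exact hta.trans (stabilizer_le_of_hom g _)

theorem isCover_of_injective {X Y : FinGSet (𝔛 ≃ₜ 𝔛)} {f : X →[𝔛 ≃ₜ 𝔛] Y} (hf : Injective f) :
    IsCover f := fun x t _ h => by rwa [stabilizer_eq_of_injective f hf] at h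

theorem IsCover.comp_injective {X X₁ Y : FinGSet (𝔛 ≃ₜ 𝔛)} {f : X →[𝔛 ≃ₜ 𝔛] Y} (hf : IsCover f)
    {i : X₁ →[𝔛 ≃ₜ 𝔛] X} (hi : Injective i) : IsCover (f.comp i) := fun x t ht h =>
  isCover_of_injective hi x t ht (hf (i x) t ht h)

variable [IsCantorSpace 𝔛]

/-- Being a cover can be tested at one point, because `coarsest` is compatible with conjugation. -/
theorem isCover_of_coarsest {X Y : FinGSet (𝔛 ≃ₜ 𝔛)} (hX : X.IsTransitive)
    {f : X →[𝔛 ≃ₜ 𝔛] Y} (x : X)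
    (h : (coarsest (MulAction.stabilizer (𝔛 ≃ₜ 𝔛) (f x))).fixer ≤
      MulAction.stabilizer (𝔛 ≃ₜ 𝔛) x) : IsCover f := by
  intro x' t ht htx
  obtain ⟨g, rfl⟩ := hX.exists_smul_eq x x'
  rw [map_smul, MulAction.stabilizer_smul_eq_stabilizer_map_conj] at htx
  have h1 := le_coarsest ht htx
  rw [coarsest_map_conj (Y.smooth _)] at h1
  have h2 := Setoid.fixer_mono h1
  rw [Setoid.fixer_translate] at h2
  rw [MulAction.stabilizer_smul_eq_stabilizer_map_conj]
  exact h2.trans (Subgroup.map_mono h)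

theorem IsCover.coarsest_eq {X Y : FinGSet (𝔛 ≃ₜ 𝔛)} {f : X →[𝔛 ≃ₜ 𝔛] Y} (hf : IsCover f) (x : X) :
    coarsest (MulAction.stabilizer (𝔛 ≃ₜ 𝔛) x) =
      coarsest (MulAction.stabilizer (𝔛 ≃ₜ 𝔛) (f x)) :=
  le_antisymm (coarsest_mono (X.smooth x) (stabilizer_le_of_hom f x))
    (le_coarsest (coarsest_isOpenRel (Y.smooth _))
      (hf x _ (coarsest_isOpenRel (Y.smooth _)) (fixer_coarsest_le (Y.smooth _))))

/-- Both symmetry indices are measured against the same fixer, so this is the tower law for indices.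
-/
theorem IsCover.symIndex_mul {X Y : FinGSet (𝔛 ≃ₜ 𝔛)} {f : X →[𝔛 ≃ₜ 𝔛] Y} (hf : IsCover f)
    (x : X) : symIndex (MulAction.stabilizer (𝔛 ≃ₜ 𝔛) x) *
      (MulAction.stabilizer (𝔛 ≃ₜ 𝔛) x).relIndex (MulAction.stabilizer (𝔛 ≃ₜ 𝔛) (f x)) =
      symIndex (MulAction.stabilizer (𝔛 ≃ₜ 𝔛) (f x)) := by
  rw [symIndex, symIndex, ← hf.coarsest_eq]
  exact Subgroup.relIndex_mul_relIndex _ _ _ (fixer_coarsest_le (X.smooth x))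
    (stabilizer_le_of_hom f x)

theorem IsCover.finite_fiber {X Y : FinGSet (𝔛 ≃ₜ 𝔛)} {f : X →[𝔛 ≃ₜ 𝔛] Y} (hf : IsCover f)
    (y : Y) : (f ⁻¹' {y}).Finite := by
  revert hf
  refine induction_hom (P := fun X f => IsCover f → (f ⁻¹' {y}).Finite) ?_ ?_ ?_ X f
  · intro X f _ _
    exact Set.toFinite _
  · intro X X₁ X₂ f i₁ i₂ h h1 h2 hf
    exact h.finite_preimage f y (h1 (hf.comp_injective h.1)) (h2 (hf.comp_injective h.2.1))
  · intro X f hX hf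
    rcases (f ⁻¹' {y}).eq_empty_or_nonempty with he | ⟨x, rfl⟩
    · rw [he]; exact Set.finite_empty
    · refine Set.finite_of_ncard_ne_zero ?_
      rw [FinGSet.ncard_fiber hX]
      refine right_ne_zero_of_mul (a := symIndex (MulAction.stabilizer (𝔛 ≃ₜ 𝔛) x)) ?_
      rw [hf.symIndex_mul]
      exact symIndex_ne_zero (Y.smooth _)

/-- Every orbit has a finite covering by the coset space of a fixer. -/
theorem exists_fixer_cover {X : FinGSet (𝔛 ≃ₜ 𝔛)} (x : X) :
    ∃ (W : FinGSet (𝔛 ≃ₜ 𝔛)) (w : W) (q : W →[𝔛 ≃ₜ 𝔛] X), W.IsTransitive ∧ q w = x ∧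
      MulAction.stabilizer (𝔛 ≃ₜ 𝔛) w =
        (coarsest (MulAction.stabilizer (𝔛 ≃ₜ 𝔛) x)).fixer ∧ IsCover q := by
  have hr := coarsest_isOpenRel (X.smooth x)
  have hs := stabilizer_cosetOne _ hr.isOpen_fixer
  have hW := coset_isTransitive _ hr.isOpen_fixer
  obtain ⟨q, hq⟩ := hW.exists_hom (cosetOne _ hr.isOpen_fixer) x
    (hs.le.trans (fixer_coarsest_le (X.smooth x)))
  exact ⟨_, _, q, hW, hq, hs, isCover_of_coarsest hW (cosetOne _ hr.isOpen_fixer)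
    (by rw [hq, hs])⟩

end Covers

end FinGSet

/-! ### Volumes and the construction of the two measures -/

namespace FinGSet

section Volume

variable {𝔛 : Type u} [TopologicalSpace 𝔛]

/-- The weight of an open subgroup. -/
noncomputable def weight (a : ℚ) (U : Subgroup (𝔛 ≃ₜ 𝔛)) : ℚ :=
  a ^ (coarsest U).numClasses / symIndex U

/-- The total weight of the orbits of a finitary set. -/
noncomputable def volume (a : ℚ) (X : FinGSet (𝔛 ≃ₜ 𝔛)) : ℚ := orbitSum (weight a) X

variable [IsCantorSpace 𝔛] {a : ℚ}

theorem weight_conjInvariant (a : ℚ) : ConjInvariant (weight (𝔛 := 𝔛) a) := fun U g hU => by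
  rw [weight, symIndex_map_conj hU, coarsest_map_conj hU, Setoid.numClasses_translate, weight]

theorem weight_fixer {r : Setoid 𝔛} (hr : r.IsOpenRel) :
    weight a r.fixer = a ^ r.numClasses := by
  rw [weight, coarsest_fixer hr, symIndex_fixer hr, Nat.cast_one, div_one]

theorem weight_ne_zero (ha : a ≠ 0) {U : Subgroup (𝔛 ≃ₜ 𝔛)} (hU : IsOpen (U : Set (𝔛 ≃ₜ 𝔛))) :
    weight a U ≠ 0 :=
  div_ne_zero (pow_ne_zero _ ha) (Nat.cast_ne_zero.2 (symIndex_ne_zero hU))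

theorem volume_transitive {X : FinGSet (𝔛 ≃ₜ 𝔛)} (hX : X.IsTransitive) (x : X) :
    volume a X = weight a (MulAction.stabilizer (𝔛 ≃ₜ 𝔛) x) :=
  orbitSum_transitive (weight_conjInvariant a) hX x

theorem volume_ne_zero (ha : a ≠ 0) {X : FinGSet (𝔛 ≃ₜ 𝔛)} (hX : X.IsTransitive) :
    volume a X ≠ 0 := by
  obtain ⟨x⟩ := hX.nonempty
  rw [volume_transitive hX x]
  exact weight_ne_zero ha (X.smooth x)

theorem volume_add {X X₁ X₂ : FinGSet (𝔛 ≃ₜ 𝔛)} {i₁ : X₁ →[𝔛 ≃ₜ 𝔛] X} {i₂ : X₂ →[𝔛 ≃ₜ 𝔛] X}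
    (h : IsDecomposition i₁ i₂) : volume a X = volume a X₁ + volume a X₂ :=
  orbitSum_add (weight_conjInvariant a) h

theorem IsCover.weight_eq {X Y : FinGSet (𝔛 ≃ₜ 𝔛)} {f : X →[𝔛 ≃ₜ 𝔛] Y} (hf : IsCover f) (x : X) :
    weight a (MulAction.stabilizer (𝔛 ≃ₜ 𝔛) x) =
      (MulAction.stabilizer (𝔛 ≃ₜ 𝔛) x).relIndex (MulAction.stabilizer (𝔛 ≃ₜ 𝔛) (f x)) *
        weight a (MulAction.stabilizer (𝔛 ≃ₜ 𝔛) (f x)) := by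
  have h := hf.symIndex_mul x
  have h0 : (symIndex (MulAction.stabilizer (𝔛 ≃ₜ 𝔛) x) : ℚ) ≠ 0 :=
    Nat.cast_ne_zero.2 (symIndex_ne_zero (X.smooth x))
  have h1 : (symIndex (MulAction.stabilizer (𝔛 ≃ₜ 𝔛) (f x)) : ℚ) ≠ 0 :=
    Nat.cast_ne_zero.2 (symIndex_ne_zero (Y.smooth _))
  rw [weight, weight, hf.coarsest_eq x]
  field_simp
  rw [← h]
  push_cast
  ring

/-- Dividing by the symmetry index in the weight is designed for this: a cover scales volumes by its
degree, whatever `a` is. -/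
theorem IsCover.volume_eq {X Y : FinGSet (𝔛 ≃ₜ 𝔛)} (hY : Y.IsTransitive) {f : X →[𝔛 ≃ₜ 𝔛] Y}
    (hf : IsCover f) (y : Y) : volume a X = (f ⁻¹' {y}).ncard * volume a Y := by
  revert hf
  refine induction_hom
    (P := fun X f => IsCover f → volume a X = (f ⁻¹' {y}).ncard * volume a Y) ?_ ?_ ?_ X f
  · intro X f _ _
    rw [volume, orbitSum_empty, Set.eq_empty_of_isEmpty (f ⁻¹' {y}), Set.ncard_empty,
      Nat.cast_zero, zero_mul]
  · intro X X₁ X₂ f i₁ i₂ h h1 h2 hf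
    have hf1 := hf.comp_injective h.1
    have hf2 := hf.comp_injective h.2.1
    rw [volume_add h, h.ncard_preimage f y (hf1.finite_fiber y) (hf2.finite_fiber y), h1 hf1,
      h2 hf2]
    push_cast
    ring
  · intro X f hX hf
    have := hX.nonempty
    obtain ⟨x, rfl⟩ := hY.surjective f y
    rw [ncard_fiber hX, volume_transitive hX x, volume_transitive hY (f x), hf.weight_eq]

/-- Base change along `p` is compatible with volumes. -/
def IsGoodBase (a : ℚ) {Y Z : FinGSet (𝔛 ≃ₜ 𝔛)} (p : Z →[𝔛 ≃ₜ 𝔛] Y) : Prop :=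
  ∀ (X X' : FinGSet (𝔛 ≃ₜ 𝔛)) (f' : X' →[𝔛 ≃ₜ 𝔛] Z) (g' : X' →[𝔛 ≃ₜ 𝔛] X)
    (f : X →[𝔛 ≃ₜ 𝔛] Y), IsCartesian f' g' f p → volume a X' * volume a Y = volume a X * volume a Z

theorem isGoodBase_of_transitive {Y Z : FinGSet (𝔛 ≃ₜ 𝔛)} {p : Z →[𝔛 ≃ₜ 𝔛] Y}
    (h : ∀ (X X' : FinGSet (𝔛 ≃ₜ 𝔛)) (f' : X' →[𝔛 ≃ₜ 𝔛] Z) (g' : X' →[𝔛 ≃ₜ 𝔛] X)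
      (f : X →[𝔛 ≃ₜ 𝔛] Y), X.IsTransitive → IsCartesian f' g' f p →
      volume a X' * volume a Y = volume a X * volume a Z) : IsGoodBase a p := by
  intro X X' f' g' f
  revert X' f' g'
  refine induction_hom (P := fun X f => ∀ (X' : FinGSet (𝔛 ≃ₜ 𝔛)) (f' : X' →[𝔛 ≃ₜ 𝔛] Z)
    (g' : X' →[𝔛 ≃ₜ 𝔛] X), IsCartesian f' g' f p →
    volume a X' * volume a Y = volume a X * volume a Z) ?_ ?_ ?_ X f
  · intro X f _ X' f' g' _
    have : IsEmpty X' := Function.isEmpty g'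
    rw [show volume a X' = 0 from orbitSum_empty _ _, show volume a X = 0 from orbitSum_empty _ _,
      zero_mul, zero_mul]
  · intro X X₁ X₂ f i₁ i₂ hd h1 h2 X' f' g' hc
    have hc1 := pullback_isCartesian g' i₁
    have hc2 := pullback_isCartesian g' i₂
    rw [volume_add hd, volume_add (hc1.isDecomposition hd hc2), add_mul, add_mul,
      h1 _ _ _ (hc.symm.paste hc1).symm, h2 _ _ _ (hc.symm.paste hc2).symm]
  · intro X f hX X' f' g' hc
    exact h X X' f' g' f hX hc

/-- The degree of a cover is unchanged by base change, and it is the factor between the volumes on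
both sides. -/
theorem IsCover.isGoodBase {Y Z : FinGSet (𝔛 ≃ₜ 𝔛)} (hY : Y.IsTransitive) {p : Z →[𝔛 ≃ₜ 𝔛] Y}
    (hp : IsCover p) : IsGoodBase a p := by
  refine isGoodBase_of_transitive fun X X' f' g' f hX hc => ?_
  obtain ⟨x⟩ := hX.nonempty
  rw [(hc.symm.isCover hp).volume_eq hX x, hp.volume_eq hY (f x), hc.symm.ncard_fiber]
  ring

theorem IsGoodBase.comp (ha : a ≠ 0) {Y Z W : FinGSet (𝔛 ≃ₜ 𝔛)} (hZ : Z.IsTransitive)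
    {p : Z →[𝔛 ≃ₜ 𝔛] Y} {q : W →[𝔛 ≃ₜ 𝔛] Z} (hp : IsGoodBase a p) (hq : IsGoodBase a q) :
    IsGoodBase a (p.comp q) := by
  intro X X'' f'' l f hc
  have h1 := pullback_isCartesian f p
  obtain ⟨g'', h2⟩ := h1.of_paste hc
  have e1 := hp _ _ _ _ _ h1
  have e2 := hq _ _ _ _ _ h2
  refine mul_right_cancel₀ (volume_ne_zero ha hZ) ?_
  linear_combination volume a Y * e2 + volume a W * e1

/-- Pull the square back further along `q` and cancel the nonzero volume of `W`. With
`IsGoodBase.comp`, this allows sources and targets to be replaced by covers. -/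
theorem IsGoodBase.of_comp (ha : a ≠ 0) {Y Z W : FinGSet (𝔛 ≃ₜ 𝔛)} (hW : W.IsTransitive)
    {p : Z →[𝔛 ≃ₜ 𝔛] Y} {q : W →[𝔛 ≃ₜ 𝔛] Z} (hp : IsGoodBase a (p.comp q)) (hq : IsGoodBase a q) :
    IsGoodBase a p := by
  intro X X' f' g' f hc
  have h1 := pullback_isCartesian f' q
  have e1 := hq _ _ _ _ _ h1
  have e2 := hp _ _ _ _ _ (hc.paste h1)
  refine mul_right_cancel₀ (volume_ne_zero ha hW) ?_
  linear_combination volume a Z * e2 - volume a Y * e1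

/-- The core of existence. A cover reduces `X` to the coset space `W` of a fixer; the volume of the
fibre product is then the generating function of total relations at `a`, and the condition `ha2`,
which says that `2 + a` is `0` or `1`, makes it `a` times the volume of `W`. -/
theorem isGoodBase_of_isSplit (ha : a ≠ 0) (ha2 : ∀ n : ℕ, n ≠ 0 → (2 + a) ^ n = 2 + a)
    {Y Z : FinGSet (𝔛 ≃ₜ 𝔛)} (hY : Y.IsTransitive) (hZ : Z.IsTransitive) (p : Z →[𝔛 ≃ₜ 𝔛] Y)
    (z : Z) {r₁ r : Setoid 𝔛} (hr₁ : r₁.IsOpenRel) (h : IsSplit r₁ r)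
    (hz : MulAction.stabilizer (𝔛 ≃ₜ 𝔛) z = r₁.fixer)
    (hy : MulAction.stabilizer (𝔛 ≃ₜ 𝔛) (p z) = r.fixer) : IsGoodBase a p := by
  classical
  refine isGoodBase_of_transitive fun X X' f' g' f hX hc => ?_
  have := hX.nonempty
  have hnum := h.numClasses hr₁
  obtain ⟨h1r, b, c, hbc⟩ := h
  have hr := hr₁.mono h1r
  obtain ⟨x, hx⟩ := hY.surjective f (p z)
  obtain ⟨W, w, q, hW, rfl, hw, hq⟩ := exists_fixer_cover x
  set s := coarsest (MulAction.stabilizer (𝔛 ≃ₜ 𝔛) (q w)) with hs_def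
  have hs : s.IsOpenRel := coarsest_isOpenRel (X.smooth _)
  have hsr : s ≤ r := by
    refine le_of_fixer_le hr hs ?_
    rw [← hw, ← hy, ← hx]
    exact (stabilizer_le_of_hom q w).trans (stabilizer_le_of_hom f (q w))
  have h1 := pullback_isCartesian g' q
  have e1 := hq.isGoodBase (a := a) hX _ _ _ _ _ h1
  have h2 : IsCartesian (f'.comp (pullbackFst g' q)) (pullbackSnd g' q) (f.comp q) p :=
    (hc.symm.paste h1).symm
  have hfs := hs.finite
  have hf1 := hr₁.finite
  have hfr := hr.finite
  have := Fintype.ofFinite (Quotient s)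
  have := Fintype.ofFinite (Quotient r₁)
  have e2 := orbitSum_cartesian h2 hW hZ hx hr₁ hs hw hz ((congrArg _ hx).trans hy) hsr h1r
    (weight_conjInvariant a) (fun n => a ^ n) (fun t ht => weight_fixer ht)
  rw [sum_totalRelations (Setoid.quotientMap_surjective hsr) (Setoid.quotientMap_surjective h1r)
    hbc] at e2
  have hpos : (Finset.univ.filter fun q => Setoid.quotientMap hsr q =
      Setoid.quotientMap h1r b).card ≠ 0 := by
    obtain ⟨i, hi⟩ := Setoid.quotientMap_surjective hsr (Setoid.quotientMap h1r b)
    exact Finset.card_ne_zero_of_mem (Finset.mem_filter.2 ⟨Finset.mem_univ _, hi⟩)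
  have hcard : (Finset.univ.filter fun q => Setoid.quotientMap hsr q =
        Setoid.quotientMap h1r b).card + (Finset.univ.filter fun q => Setoid.quotientMap hsr q ≠
        Setoid.quotientMap h1r b).card = s.numClasses := by
    rw [Finset.card_filter_add_card_filter_not, Setoid.numClasses, Nat.card_eq_fintype_card,
      Finset.card_univ]
  -- With `n ≥ 1` classes over the split class and `l` others, `a^l (2a + a²)^n - 2a^(n+l) = a^(n+l)
  -- ((2 + a)^n - 2)`, and `ha2` turns the last factor into `a`.
  have e3 : volume a (pullback g' q) = a ^ s.numClasses * a := by
    rw [volume, e2, show 2 * a + a ^ 2 = a * (2 + a) by ring, mul_pow, ha2 _ hpos,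
      ← Nat.card_eq_fintype_card, ← Setoid.numClasses, ← hcard, pow_add]
    ring
  have e4 : volume a W = a ^ s.numClasses := by
    rw [volume_transitive hW w, hw, weight_fixer hs]
  have e5 : volume a Z = a ^ r.numClasses * a := by
    rw [volume_transitive hZ z, hz, weight_fixer hr₁, hnum, pow_succ]
  have e6 : volume a Y = a ^ r.numClasses := by
    rw [volume_transitive hY (p z), hy, weight_fixer hr]
  refine mul_right_cancel₀ (volume_ne_zero ha hW) ?_
  rw [e3] at e1
  rw [e5, e6]
  rw [e4] at e1 ⊢
  linear_combination -a ^ r.numClasses * e1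

/-- A refinement is reached by a chain of splits, and good base changes compose. -/
theorem isGoodBase_of_fixer (ha : a ≠ 0) (ha2 : ∀ n : ℕ, n ≠ 0 → (2 + a) ^ n = 2 + a)
    {Y : FinGSet (𝔛 ≃ₜ 𝔛)} (hY : Y.IsTransitive) {y : Y} {r : Setoid 𝔛}
    (hy : MulAction.stabilizer (𝔛 ≃ₜ 𝔛) y = r.fixer) {s : Setoid 𝔛} (hs : s.IsOpenRel)
    (hsr : s ≤ r) : ∀ (Z : FinGSet (𝔛 ≃ₜ 𝔛)) (p : Z →[𝔛 ≃ₜ 𝔛] Y) (z : Z), Z.IsTransitive →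
      p z = y → MulAction.stabilizer (𝔛 ≃ₜ 𝔛) z = s.fixer → IsGoodBase a p := by
  refine refinement_induction (P := fun s => ∀ (Z : FinGSet (𝔛 ≃ₜ 𝔛)) (p : Z →[𝔛 ≃ₜ 𝔛] Y) (z : Z),
    Z.IsTransitive → p z = y → MulAction.stabilizer (𝔛 ≃ₜ 𝔛) z = s.fixer → IsGoodBase a p)
    ?_ ?_ hs hsr
  · rintro Z p z hZ rfl hz
    exact (isCover_of_injective (hZ.bijective hY p z (hy.trans hz.symm).le).1).isGoodBase hY
  · rintro t r' ht hsp hr'r ih Z p z hZ rfl hz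
    have hr' := ht.mono hsp.1
    have hV := coset_isTransitive _ hr'.isOpen_fixer
    have hv := stabilizer_cosetOne _ hr'.isOpen_fixer
    obtain ⟨q, hq⟩ := hZ.exists_hom z (cosetOne _ hr'.isOpen_fixer)
      (by rw [hv, hz]; exact Setoid.fixer_mono hsp.1)
    obtain ⟨p', hp'⟩ := hV.exists_hom (cosetOne _ hr'.isOpen_fixer) (p z)
      (by rw [hv, hy]; exact Setoid.fixer_mono hr'r)
    have : p = p'.comp q := hZ.hom_ext z (by rw [← hp', ← hq]; rfl)
    rw [this]
    exact (ih _ p' _ hV hp' hv).comp ha hV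
      (isGoodBase_of_isSplit ha ha2 hV hZ q z ht hsp hz (by rw [hq, hv]))

/-- Covers `q` and `q'` of source and target by coset spaces of fixers give `p.comp q = q'.comp l`
with `l` a map between such spaces; the right side is good, and `q` cancels on the left. -/
theorem isGoodBase (ha : a ≠ 0) (ha2 : ∀ n : ℕ, n ≠ 0 → (2 + a) ^ n = 2 + a)
    {Y Z : FinGSet (𝔛 ≃ₜ 𝔛)} (hY : Y.IsTransitive) (hZ : Z.IsTransitive)
    (p : Z →[𝔛 ≃ₜ 𝔛] Y) : IsGoodBase a p := by
  obtain ⟨z⟩ := hZ.nonempty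
  obtain ⟨W, w, q, hW, hqw, hw, hq⟩ := exists_fixer_cover z
  obtain ⟨V, v, q', hV, hqv, hv, hq'⟩ := exists_fixer_cover (p z)
  have hs := coarsest_isOpenRel (Z.smooth z)
  have hsr := coarsest_mono (Z.smooth z) (stabilizer_le_of_hom p z)
  obtain ⟨l, hl⟩ := hW.exists_hom w v (by rw [hw, hv]; exact Setoid.fixer_mono hsr)
  have hcomp : p.comp q = q'.comp l := hW.hom_ext w (by
    change p (q w) = q' (l w)
    rw [hqw, hl, hqv])
  refine IsGoodBase.of_comp ha hW ?_ (hq.isGoodBase hZ)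
  rw [hcomp]
  exact (hq'.isGoodBase hY).comp ha hV (isGoodBase_of_fixer ha ha2 hV hv hs hsr W l w hW hl hw)

/-- The measure given by the quotients of volumes. -/
noncomputable def volumeMeasure (a : ℚ) (ha : a ≠ 0)
    (ha2 : ∀ n : ℕ, n ≠ 0 → (2 + a) ^ n = 2 + a) : GMeasure (𝔛 ≃ₜ 𝔛) ℚ where
  toFun f := volume a f.src / volume a f.tgt
  map_iso f hf := by
    have := f.transitive.nonempty
    obtain ⟨y⟩ := this
    obtain ⟨x, rfl⟩ := hf.2 y
    have hX : f.src.IsTransitive := .of_forall x fun x' => by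
      obtain ⟨g, hg⟩ := f.transitive.exists_smul_eq (f.hom x) (f.hom x')
      exact ⟨g, hf.1 (by rw [map_smul, hg])⟩
    rw [div_eq_one_iff_eq (volume_ne_zero ha f.transitive), volume_transitive hX x,
      volume_transitive f.transitive (f.hom x), stabilizer_eq_of_injective _ hf.1]
  map_add X X₁ X₂ Y hY f i₁ i₂ h := by
    rw [← add_div]
    exact congrArg (· / volume a Y) (volume_add h)
  map_comp X Y Z hY hZ f g := by
    have := volume_ne_zero ha hY
    have := volume_ne_zero ha hZ
    field_simp
  map_baseChange X Y X' Y' hY hY' f' g' f g h := by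
    rw [div_eq_div_iff (volume_ne_zero ha hY') (volume_ne_zero ha hY)]
    exact isGoodBase ha ha2 hY hY' g X X' f' g' f h

end Volume

end FinGSet

/-! ### Existence and conjugacy of splits -/

section SplitExistence

theorem Setoid.numClasses_ker_of_surjective {𝔛 : Type u} {n : ℕ} {φ : 𝔛 → Fin n} (hs : Surjective φ) :
    (Setoid.ker φ).numClasses = n := by
  rw [Setoid.numClasses, Nat.card_congr (Setoid.quotientKerEquivOfSurjective φ hs), Nat.card_fin]

theorem Setoid.numClasses_top {𝔛 : Type u} [Nonempty 𝔛] : (⊤ : Setoid 𝔛).numClasses = 1 := by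
  have : Subsingleton (Quotient (⊤ : Setoid 𝔛)) :=
    ⟨Quotient.ind fun x => Quotient.ind fun y => Quotient.sound trivial⟩
  have : Nonempty (Quotient (⊤ : Setoid 𝔛)) := ⟨Quotient.mk _ (Classical.arbitrary 𝔛)⟩
  exact Nat.card_of_subsingleton (Classical.arbitrary _)

theorem exists_numClasses_eq (𝔛 : Type u) [TopologicalSpace 𝔛] [IsCantorSpace 𝔛] {n : ℕ} (hn : n ≠ 0) :
    ∃ r : Setoid 𝔛, r.IsOpenRel ∧ r.numClasses = n := by
  obtain ⟨m, rfl⟩ := Nat.exists_eq_succ_of_ne_zero hn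
  obtain ⟨φ, hφ, hs⟩ := exists_isLocallyConstant_surjective 𝔛 m
  exact ⟨_, .of_isLocallyConstant hφ, Setoid.numClasses_ker_of_surjective hs⟩

variable {𝔛 : Type u} [TopologicalSpace 𝔛] [IsCantorSpace 𝔛]

/-- Every class of a clopen partition can be split. -/
theorem exists_split_at {r : Setoid 𝔛} (hr : r.IsOpenRel) (q : Quotient r) :
    ∃ (r₁ : Setoid 𝔛) (h : r₁ ≤ r) (b c : Quotient r₁), r₁.IsOpenRel ∧
      CollapsesPair (Setoid.quotientMap h) b c ∧ Setoid.quotientMap h b = q := by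
  have := hr.finite
  -- The new classes are indexed by `Option (Quotient r)`; exactly `none` and `some q` lie over `q`.
  obtain ⟨φ, hφ, hs, hπ⟩ := exists_refinement hr (ι := Option (Quotient r))
    (π := fun o => o.elim q id) fun q' => ⟨some q', rfl⟩
  obtain ⟨x, hx⟩ := hs none
  obtain ⟨y, hy⟩ := hs (some q)
  have hle : Setoid.ker φ ≤ r := fun {z w} h => Quotient.exact (by rw [← hπ, ← hπ, h])
  refine ⟨Setoid.ker φ, hle, Quotient.mk _ x, Quotient.mk _ y, .of_isLocallyConstant hφ, ⟨?_, ?_⟩,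
    ?_⟩
  · intro h
    have h' : φ x = φ y := Quotient.exact h
    rw [hx, hy] at h'
    cases h'
  · refine Quotient.ind fun z => Quotient.ind fun w => ?_
    change Quotient.mk r z = Quotient.mk r w ↔ _
    have hk : ∀ u v, (Quotient.mk (Setoid.ker φ) u = Quotient.mk (Setoid.ker φ) v) ↔ φ u = φ v :=
      fun u v => Quotient.eq
    rw [hk, hk, hk, hk, hk, ← hπ, ← hπ, hx, hy]
    cases φ z <;> cases φ w <;> simp [eq_comm]
  · change Quotient.mk r x = q
    rw [← hπ, hx]; rfl

/-- Splits of partitions with the same number of classes are conjugate. -/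
theorem IsSplit.exists_translate {r₁ r r₁' r' : Setoid 𝔛} (h : IsSplit r₁ r) (h' : IsSplit r₁' r')
    (hr₁ : r₁.IsOpenRel) (hr₁' : r₁'.IsOpenRel) (hn : r.numClasses = r'.numClasses) :
    ∃ g : 𝔛 ≃ₜ 𝔛, r₁.translate g = r₁' ∧ r.translate g = r' := by
  classical
  have hn1 : r₁.numClasses = r₁'.numClasses := by rw [h.numClasses hr₁, h'.numClasses hr₁', hn]
  obtain ⟨hle, b, c, hbc⟩ := h
  obtain ⟨hle', b', c', hbc'⟩ := h'
  have := hr₁.finite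
  have := hr₁'.finite
  -- Any bijection of the classes, corrected by two transpositions so that it carries the split pair
  -- to the split pair.
  obtain ⟨e, heb, hec⟩ : ∃ e : Quotient r₁ ≃ Quotient r₁', e b = b' ∧ e c = c' := by
    obtain ⟨e₀⟩ := Finite.card_eq.1 hn1
    let e₁ := e₀.trans (Equiv.swap (e₀ b) b')
    have h1 : e₁ b = b' := Equiv.swap_apply_left _ _
    refine ⟨e₁.trans (Equiv.swap (e₁ c) c'), ?_, Equiv.swap_apply_left _ _⟩
    change Equiv.swap (e₁ c) c' (e₁ b) = b'
    rw [h1, Equiv.swap_apply_of_ne_of_ne _ hbc'.1]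
    rw [← h1]
    exact fun h => hbc.1 (e₁.injective h)
  obtain ⟨g, hg⟩ := exists_homeo_comp_eq (hr₁.isLocallyConstant.comp e) hr₁'.isLocallyConstant (by
    rw [Set.range_eq_univ.2 (e.surjective.comp Quotient.mk_surjective),
      Set.range_eq_univ.2 Quotient.mk_surjective])
  have hg' : ∀ x, Quotient.mk r₁ x = e.symm (Quotient.mk r₁' (g x)) := fun x => by
    rw [hg]; exact (e.symm_apply_apply _).symm
  refine ⟨g, ?_, ?_⟩
  · ext x y
    rw [Setoid.translate_apply, ← Quotient.eq, hg', hg', e.symm.injective.eq_iff, Quotient.eq,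
      g.apply_symm_apply, g.apply_symm_apply]
  · ext x y
    have k1 : r (g.symm x) (g.symm y) ↔ _ :=
      Quotient.eq.symm.trans (hbc.2 (Quotient.mk r₁ (g.symm x)) (Quotient.mk r₁ (g.symm y)))
    have k2 : r' x y ↔ _ := Quotient.eq.symm.trans (hbc'.2 (Quotient.mk r₁' x) (Quotient.mk r₁' y))
    rw [Setoid.translate_apply, k1, k2, hg', hg', e.symm.injective.eq_iff, ← heb, ← hec,
      e.symm_apply_eq, e.symm_apply_eq, e.symm_apply_eq, e.symm_apply_eq, g.apply_symm_apply,
      g.apply_symm_apply]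

end SplitExistence

/-! ### Values of an arbitrary measure on covers and on maps between fixers -/

namespace GMeasure

open FinGSet

section General

variable {G : Type u} [Group G] [TopologicalSpace G] {k : Type v} [CommRing k] (m : GMeasure G k)

/-- An empty set is the disjoint union of two copies of itself, so its value `v` satisfies `v = v +
v`. -/
theorem map_isEmpty {X Y : FinGSet G} (hY : Y.IsTransitive) (f : X →[G] Y) [IsEmpty X] :
    m.toFun ⟨X, Y, f, hY⟩ = 0 := by
  have h := m.map_add X X X Y hY f (MulActionHom.id G) (MulActionHom.id G)
    ⟨fun _ _ h => h, fun _ _ h => h, by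
      rw [Set.range_eq_empty]
      have : (∅ : Set X) = Set.univ := Set.eq_univ_of_forall isEmptyElim
      exact ⟨Set.disjoint_empty _, by rw [codisjoint_iff, sup_idem]; exact this⟩⟩
  rw [MulActionHom.comp_id] at h
  exact left_eq_add.1 h

theorem map_square {X Y X' Y' : FinGSet G} (hY : Y.IsTransitive) (hY' : Y'.IsTransitive)
    {f' : X' →[G] Y'} {i : X' →[G] X} {f : X →[G] Y} {j : Y' →[G] Y} (hi : Bijective i)
    (hj : Bijective j) (h : ∀ z, f (i z) = j (f' z)) :
    m.toFun ⟨X', Y', f', hY'⟩ = m.toFun ⟨X, Y, f, hY⟩ :=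
  m.map_baseChange X Y X' Y' hY hY' f' i f j (isCartesian_of_bijective h hi hj.1)

theorem map_eq_of_stabilizer_eq {X Y X' Y' : FinGSet G} (hX : X.IsTransitive)
    (hX' : X'.IsTransitive) (hY : Y.IsTransitive) (hY' : Y'.IsTransitive) (f : X →[G] Y)
    (f' : X' →[G] Y') (x : X) (x' : X')
    (h : MulAction.stabilizer G x = MulAction.stabilizer G x')
    (h' : MulAction.stabilizer G (f x) = MulAction.stabilizer G (f' x')) :
    m.toFun ⟨X', Y', f', hY'⟩ = m.toFun ⟨X, Y, f, hY⟩ := by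
  obtain ⟨i, hi⟩ := hX'.exists_hom x' x h.ge
  obtain ⟨j, hj⟩ := hY'.exists_hom (f' x') (f x) h'.ge
  refine m.map_square hY hY' (hX'.bijective hX i x' (by rw [hi, h]))
    (hY'.bijective hY j (f' x') (by rw [hj, h'])) fun z => ?_
  have : f.comp i = j.comp f' := hX'.hom_ext x' (by
    change f (i x') = j (f' x')
    rw [hi, hj])
  exact DFunLike.congr_fun this z

/-- The hypothesis makes every orbit of `X` map isomorphically onto `Y`, contributing one point to
the fibre and the value `1`. -/
theorem map_trivial_cover {X Y : FinGSet G} (hY : Y.IsTransitive) (f : X →[G] Y) (y : Y)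
    (hfin : (f ⁻¹' {y}).Finite)
    (h : ∀ x, f x = y → MulAction.stabilizer G y ≤ MulAction.stabilizer G x) :
    m.toFun ⟨X, Y, f, hY⟩ = (f ⁻¹' {y}).ncard := by
  revert hfin h
  refine induction_hom (P := fun X f => (f ⁻¹' {y}).Finite →
    (∀ x, f x = y → MulAction.stabilizer G y ≤ MulAction.stabilizer G x) →
    m.toFun ⟨X, Y, f, hY⟩ = (f ⁻¹' {y}).ncard) ?_ ?_ ?_ X f
  · intro X f _ _ _
    rw [m.map_isEmpty hY f, Set.eq_empty_of_isEmpty (f ⁻¹' {y}), Set.ncard_empty, Nat.cast_zero]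
  · intro X X₁ X₂ f i₁ i₂ hd h1 h2 hfin h
    have hfin1 : (f.comp i₁ ⁻¹' {y}).Finite := Set.Finite.preimage (f := i₁) hd.1.injOn hfin
    have hfin2 : (f.comp i₂ ⁻¹' {y}).Finite := Set.Finite.preimage (f := i₂) hd.2.1.injOn hfin
    rw [m.map_add _ _ _ _ hY f i₁ i₂ hd, hd.ncard_preimage f y hfin1 hfin2, Nat.cast_add,
      h1 hfin1 fun x hx => (h _ hx).trans (stabilizer_eq_of_injective i₁ hd.1 x).le,
      h2 hfin2 fun x hx => (h _ hx).trans (stabilizer_eq_of_injective i₂ hd.2.1 x).le]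
  · intro X f hX _ h
    have := hX.nonempty
    obtain ⟨x, rfl⟩ := hY.surjective f y
    rw [m.map_iso _ (hX.bijective hY f x (h x rfl)), ncard_fiber hX,
      Subgroup.relIndex_eq_one.2 (h x rfl), Nat.cast_one]

end General

section Cantor

variable {𝔛 : Type u} [TopologicalSpace 𝔛] {k : Type v} [CommRing k] (m : GMeasure (𝔛 ≃ₜ 𝔛) k)

/-- `v` is the value of the measure on the map between the coset spaces of the fixers of `s` and
`r`. -/
def IsRelValue (s r : Setoid 𝔛) (v : k) : Prop :=
  ∃ (X Y : FinGSet (𝔛 ≃ₜ 𝔛)) (hY : Y.IsTransitive) (f : X →[𝔛 ≃ₜ 𝔛] Y) (x : X),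
    X.IsTransitive ∧ MulAction.stabilizer (𝔛 ≃ₜ 𝔛) x = s.fixer ∧
    MulAction.stabilizer (𝔛 ≃ₜ 𝔛) (f x) = r.fixer ∧ v = m.toFun ⟨X, Y, f, hY⟩

variable {m}

theorem IsRelValue.eq {s r : Setoid 𝔛} {v : k} (h : m.IsRelValue s r v)
    {X Y : FinGSet (𝔛 ≃ₜ 𝔛)} (hX : X.IsTransitive) (hY : Y.IsTransitive) (f : X →[𝔛 ≃ₜ 𝔛] Y) (x : X)
    (hx : MulAction.stabilizer (𝔛 ≃ₜ 𝔛) x = s.fixer)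
    (hy : MulAction.stabilizer (𝔛 ≃ₜ 𝔛) (f x) = r.fixer) : m.toFun ⟨X, Y, f, hY⟩ = v := by
  obtain ⟨X', Y', hY', f', x', hX', h1, h2, rfl⟩ := h
  exact m.map_eq_of_stabilizer_eq hX' hX hY' hY f' f x' x (h1.trans hx.symm) (h2.trans hy.symm)

theorem IsRelValue.translate {s r : Setoid 𝔛} {v : k} (h : m.IsRelValue s r v) (g : 𝔛 ≃ₜ 𝔛) :
    m.IsRelValue (s.translate g) (r.translate g) v := by
  obtain ⟨X, Y, hY, f, x, hX, h1, h2, rfl⟩ := h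
  refine ⟨X, Y, hY, f, g • x, hX, ?_, ?_, rfl⟩
  · rw [MulAction.stabilizer_smul_eq_stabilizer_map_conj, h1, Setoid.fixer_translate]
  · rw [map_smul, MulAction.stabilizer_smul_eq_stabilizer_map_conj, h2, Setoid.fixer_translate]

variable [IsCantorSpace 𝔛] (m)

/-- Base change to the coset space of a fixer covering `Y` trivializes the cover: a fixer that
stabilizes a point downstairs stabilizes every point above it. -/
theorem map_cover {X Y : FinGSet (𝔛 ≃ₜ 𝔛)} (hY : Y.IsTransitive) {f : X →[𝔛 ≃ₜ 𝔛] Y}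
    (hf : IsCover f) (y : Y) : m.toFun ⟨X, Y, f, hY⟩ = (f ⁻¹' {y}).ncard := by
  obtain ⟨W, w, q, hW, rfl, hw, -⟩ := exists_fixer_cover y
  have hc := pullback_isCartesian f q
  have hf' := hc.isCover hf
  rw [← m.map_baseChange _ _ _ _ hY hW _ _ _ _ hc, ← hc.ncard_fiber w]
  refine m.map_trivial_cover hW _ w (hf'.finite_fiber w) fun a ha => ?_
  have h := hf' a (coarsest (MulAction.stabilizer (𝔛 ≃ₜ 𝔛) (q w)))
    (coarsest_isOpenRel (Y.smooth _))
  rw [ha] at h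
  rw [hw] at h ⊢
  exact h le_rfl

theorem map_cover_transitive {X Y : FinGSet (𝔛 ≃ₜ 𝔛)} (hX : X.IsTransitive) (hY : Y.IsTransitive)
    {f : X →[𝔛 ≃ₜ 𝔛] Y} (hf : IsCover f) (x : X) : m.toFun ⟨X, Y, f, hY⟩ =
      (MulAction.stabilizer (𝔛 ≃ₜ 𝔛) x).relIndex (MulAction.stabilizer (𝔛 ≃ₜ 𝔛) (f x)) := by
  rw [m.map_cover hY hf (f x), ncard_fiber hX]

variable {m}

theorem IsRelValue.comp {s t r : Setoid 𝔛} (hs : s.IsOpenRel) (hst : s ≤ t) (htr : t ≤ r)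
    {v v' : k} (h : m.IsRelValue s t v) (h' : m.IsRelValue t r v') :
    m.IsRelValue s r (v' * v) := by
  have ht := hs.mono hst
  have hr := ht.mono htr
  have hS := coset_isTransitive _ hs.isOpen_fixer
  have hs' := stabilizer_cosetOne _ hs.isOpen_fixer
  have hT := coset_isTransitive _ ht.isOpen_fixer
  have ht' := stabilizer_cosetOne _ ht.isOpen_fixer
  have hR := coset_isTransitive _ hr.isOpen_fixer
  have hr' := stabilizer_cosetOne _ hr.isOpen_fixer
  obtain ⟨f, hf⟩ := hS.exists_hom (cosetOne _ hs.isOpen_fixer) (cosetOne _ ht.isOpen_fixer)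
    (by rw [hs', ht']; exact Setoid.fixer_mono hst)
  obtain ⟨g, hg⟩ := hT.exists_hom (cosetOne _ ht.isOpen_fixer) (cosetOne _ hr.isOpen_fixer)
    (by rw [ht', hr']; exact Setoid.fixer_mono htr)
  refine ⟨_, _, hR, g.comp f, cosetOne _ hs.isOpen_fixer, hS, hs', ?_, ?_⟩
  · change MulAction.stabilizer _ (g (f _)) = _
    rw [hf, hg, hr']
  · rw [m.map_comp _ _ _ hT hR, h.eq hS hT f _ hs' (by rw [hf, ht']),
      h'.eq hT hR g _ ht' (by rw [hg, hr'])]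

variable (m)

theorem exists_isRelValue {s r : Setoid 𝔛} (hs : s.IsOpenRel) (hsr : s ≤ r) :
    ∃ v, m.IsRelValue s r v := by
  have hr := hs.mono hsr
  have hS := coset_isTransitive _ hs.isOpen_fixer
  have hs' := stabilizer_cosetOne _ hs.isOpen_fixer
  have hR := coset_isTransitive _ hr.isOpen_fixer
  have hr' := stabilizer_cosetOne _ hr.isOpen_fixer
  obtain ⟨f, hf⟩ := hS.exists_hom (cosetOne _ hs.isOpen_fixer) (cosetOne _ hr.isOpen_fixer)
    (by rw [hs', hr']; exact Setoid.fixer_mono hsr)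
  exact ⟨_, _, _, hR, f, _, hS, hs', by rw [hf, hr'], rfl⟩

theorem isRelValue_self {r : Setoid 𝔛} (hr : r.IsOpenRel) : m.IsRelValue r r 1 := by
  have hR := coset_isTransitive _ hr.isOpen_fixer
  have hr' := stabilizer_cosetOne _ hr.isOpen_fixer
  exact ⟨_, _, hR, MulActionHom.id _, _, hR, hr', hr', (m.map_iso _ bijective_id).symm⟩

/-- The value on splits only depends on the number of classes. -/
theorem exists_splitValue : ∃ A : ℕ → k, ∀ r₁ r : Setoid 𝔛, r₁.IsOpenRel → IsSplit r₁ r →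
    m.IsRelValue r₁ r (A r.numClasses) := by
  have h : ∀ n : ℕ, ∃ v : k, ∀ r₁ r : Setoid 𝔛, r₁.IsOpenRel → IsSplit r₁ r →
      r.numClasses = n → m.IsRelValue r₁ r v := by
    intro n
    by_cases hex : ∃ r₁ r : Setoid 𝔛, r₁.IsOpenRel ∧ IsSplit r₁ r ∧ r.numClasses = n
    · obtain ⟨r₁, r, hr₁, hsp, hn⟩ := hex
      obtain ⟨v, hv⟩ := m.exists_isRelValue hr₁ hsp.1
      refine ⟨v, fun r₁' r' hr₁' hsp' hn' => ?_⟩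
      obtain ⟨g, rfl, rfl⟩ := hsp.exists_translate hsp' hr₁ hr₁' (hn.trans hn'.symm)
      exact hv.translate g
    -- Without a split of an `n`-class partition the condition is vacuous and any value serves.
    · exact ⟨0, fun r₁ r h1 h2 h3 => (hex ⟨r₁, r, h1, h2, h3⟩).elim⟩
  choose A hA using h
  exact ⟨A, fun r₁ r h1 h2 => hA _ r₁ r h1 h2 rfl⟩

variable {m}

theorem isRelValue_prod {A : ℕ → k} (hA : ∀ r₁ r : Setoid 𝔛, r₁.IsOpenRel → IsSplit r₁ r →
    m.IsRelValue r₁ r (A r.numClasses)) {t r : Setoid 𝔛} (ht : t.IsOpenRel) (htr : t ≤ r) :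
    m.IsRelValue t r (∏ i ∈ Finset.range (t.numClasses - r.numClasses), A (r.numClasses + i)) := by
  refine refinement_induction (P := fun t => m.IsRelValue t r
    (∏ i ∈ Finset.range (t.numClasses - r.numClasses), A (r.numClasses + i))) ?_ ?_ ht htr
  · rw [Nat.sub_self, Finset.prod_range_zero]
    exact m.isRelValue_self (ht.mono htr)
  · intro t r' ht hsp hr'r ih
    have h1 := hsp.numClasses ht
    have h2 := (ht.mono hsp.1).numClasses_anti hr'r
    have h3 := (hA t r' ht hsp).comp ht hsp.1 hr'r ih
    have h4 : t.numClasses - r.numClasses = (r'.numClasses - r.numClasses) + 1 := by omega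
    rw [h4, Finset.prod_range_succ, Nat.add_sub_cancel' h2]
    exact h3

/-- The base change formula along a split, in terms of incidence relations. -/
theorem IsRelValue.eq_sum {A : ℕ → k} (hA : ∀ r₁ r : Setoid 𝔛, r₁.IsOpenRel → IsSplit r₁ r →
    m.IsRelValue r₁ r (A r.numClasses)) {s r₁ r : Setoid 𝔛} (hs : s.IsOpenRel)
    (hr₁ : r₁.IsOpenRel) (hsr : s ≤ r) (h1r : r₁ ≤ r) [Fintype (Quotient s)]
    [Fintype (Quotient r₁)] {v : k} (hv : m.IsRelValue s r v) :
    v = ∑ S ∈ totalRelations (Setoid.quotientMap hsr) (Setoid.quotientMap h1r),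
      ∏ i ∈ Finset.range (∑ q, (S q).card - r₁.numClasses), A (r₁.numClasses + i) := by
  obtain ⟨X, Y, hY, f, x, hX, hx, hy, rfl⟩ := hv
  have hZ := coset_isTransitive _ hr₁.isOpen_fixer
  have hz := stabilizer_cosetOne _ hr₁.isOpen_fixer
  obtain ⟨p, hp⟩ := hZ.exists_hom (cosetOne _ hr₁.isOpen_fixer) (f x)
    (by rw [hz, hy]; exact Setoid.fixer_mono h1r)
  -- `H n` is the value on a chain of splits leading from `r₁` to a partition with `n` classes.
  let H : ℕ → k := fun n => ∏ i ∈ Finset.range (n - r₁.numClasses), A (r₁.numClasses + i)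
  let F : Subgroup (𝔛 ≃ₜ 𝔛) → k := fun U => H (coarsest U).numClasses
  have hF : ConjInvariant F := fun U g hU => by
    change H _ = H _
    rw [coarsest_map_conj hU, Setoid.numClasses_translate]
  have hFH : ∀ t : Setoid 𝔛, t.IsOpenRel → F t.fixer = H t.numClasses := fun t ht => by
    change H _ = H _
    rw [coarsest_fixer ht]
  have hc := pullback_isCartesian f p
  rw [← m.map_baseChange _ _ _ _ hY hZ _ _ _ _ hc]
  refine Eq.trans ?_ (orbitSum_cartesian hc hX hZ hp.symm hr₁ hs hx hz hy hsr h1r hF H hFH)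
  -- All stabilizers in this fibre product are fixers, so its value over the coset space of
  -- `r₁.fixer` is an orbit sum of `H`.
  have key : ∀ (X' : FinGSet (𝔛 ≃ₜ 𝔛)) (f' : X' →[𝔛 ≃ₜ 𝔛] coset r₁.fixer hr₁.isOpen_fixer),
      (∀ a : X', ∃ t : Setoid 𝔛, t.IsOpenRel ∧ MulAction.stabilizer (𝔛 ≃ₜ 𝔛) a = t.fixer) →
      m.toFun ⟨X', _, f', hZ⟩ = orbitSum F X' := by
    refine induction_hom ?_ ?_ ?_
    · intro X' f' _ _
      rw [m.map_isEmpty, orbitSum_empty]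
    · intro X' X₁ X₂ f' i₁ i₂ hd h1 h2 ha
      rw [m.map_add _ _ _ _ hZ f' i₁ i₂ hd, orbitSum_add hF hd,
        h1 fun a => stabilizer_eq_of_injective i₁ hd.1 a ▸ ha (i₁ a),
        h2 fun a => stabilizer_eq_of_injective i₂ hd.2.1 a ▸ ha (i₂ a)]
    · intro X' f' hX' ha
      have := hX'.nonempty
      obtain ⟨a, haz⟩ := hZ.surjective f' (cosetOne _ hr₁.isOpen_fixer)
      obtain ⟨t, ht, hta⟩ := ha a
      have htr : t ≤ r₁ := by
        refine le_of_fixer_le hr₁ ht ?_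
        rw [← hta, ← hz, ← haz]
        exact stabilizer_le_of_hom f' a
      rw [orbitSum_transitive hF hX' a, hta, hFH t ht]
      exact (isRelValue_prod hA ht htr).eq hX' hZ f' a hta (by rw [haz, hz])
  refine key _ _ fun a => ?_
  obtain ⟨g, hg⟩ := hX.exists_smul_eq x (pullbackFst f p a)
  obtain ⟨g', hg'⟩ := hZ.exists_smul_eq (cosetOne _ hr₁.isOpen_fixer) (pullbackSnd f p a)
  refine ⟨s.translate g ⊓ r₁.translate g', (hs.translate g).inf (hr₁.translate g'), ?_⟩
  rw [hc.stabilizer, ← hg, ← hg', MulAction.stabilizer_smul_eq_stabilizer_map_conj,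
    MulAction.stabilizer_smul_eq_stabilizer_map_conj, hx, hz, Setoid.fixer_inf,
    Setoid.fixer_translate, Setoid.fixer_translate]

end Cantor

end GMeasure

/-! ### Counting total relations with arbitrary weights -/

section WeightedCount

theorem Polynomial.lsum_toSpanSingleton_monomial {k : Type*} [CommRing k] (H : ℕ → k) (j : ℕ) :
    Polynomial.lsum (fun j => LinearMap.toSpanSingleton ℤ k (H j)) (Polynomial.monomial j 1) =
      H j := by
  rw [Polynomial.lsum_apply]
  exact (Polynomial.sum_monomial_index _ _ (LinearMap.map_zero _)).trans (one_smul ℤ (H j))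

/-- The count is an identity in `ℤ[X]`, so the additive map `X^j ↦ H j` transfers it from powers to
arbitrary weights. -/
theorem sum_totalRelations_eq_lsum {Q : Type*} {R : Type*} {B : Type*} [Fintype Q] [Fintype R]
    [DecidableEq B] {σ : Q → B} {π : R → B} (hσ : Surjective σ) (hπ : Surjective π) {b c : R}
    (h : CollapsesPair π b c) {k : Type*} [CommRing k] (H : ℕ → k) {n l : ℕ}
    (hl : (Finset.univ.filter fun q => σ q ≠ π b).card = l)
    (hn : (Finset.univ.filter fun q => σ q = π b).card = n) :
    ∑ S ∈ totalRelations σ π, H (∑ q, (S q).card) =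
      Polynomial.lsum (fun j => LinearMap.toSpanSingleton ℤ k (H j))
        (Polynomial.X ^ l * (2 * Polynomial.X + Polynomial.X ^ 2) ^ n -
          2 * Polynomial.X ^ (n + l) : Polynomial ℤ) := by
  classical
  have hcard : Fintype.card Q = n + l := by
    rw [← hl, ← hn, Finset.card_filter_add_card_filter_not, Finset.card_univ]
  have h1 := sum_totalRelations hσ hπ h (Polynomial.X : Polynomial ℤ)
  rw [hl, hn, hcard] at h1
  rw [← h1, map_sum]
  refine Finset.sum_congr rfl fun S _ => ?_
  rw [← Polynomial.monomial_one_right_eq_X_pow, Polynomial.lsum_toSpanSingleton_monomial]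

theorem sum_totalRelations_one {Q : Type*} {R : Type*} {B : Type*} [Fintype Q] [Fintype R]
    [DecidableEq B] {σ : Q → B} {π : R → B} (hσ : Surjective σ) (hπ : Surjective π) {b c : R}
    (h : CollapsesPair π b c) {k : Type*} [CommRing k] (H : ℕ → k)
    (hn : (Finset.univ.filter fun q => σ q = π b).card = 1) :
    ∑ S ∈ totalRelations σ π, H (∑ q, (S q).card) = H (Fintype.card Q + 1) := by
  classical
  have hcard : Fintype.card Q = 1 + (Finset.univ.filter fun q => σ q ≠ π b).card := by
    rw [← hn, Finset.card_filter_add_card_filter_not, Finset.card_univ]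
  rw [sum_totalRelations_eq_lsum hσ hπ h H rfl hn, hcard]
  generalize (Finset.univ.filter fun q => σ q ≠ π b).card = l
  have : (Polynomial.X ^ l * (2 * Polynomial.X + Polynomial.X ^ 2) ^ 1 -
      2 * Polynomial.X ^ (1 + l) : Polynomial ℤ) = Polynomial.monomial (1 + l + 1) 1 := by
    rw [Polynomial.monomial_one_right_eq_X_pow]; ring
  rw [this, Polynomial.lsum_toSpanSingleton_monomial]

theorem sum_totalRelations_two {Q : Type*} {R : Type*} {B : Type*} [Fintype Q] [Fintype R]
    [DecidableEq B] {σ : Q → B} {π : R → B} (hσ : Surjective σ) (hπ : Surjective π) {b c : R}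
    (h : CollapsesPair π b c) {k : Type*} [CommRing k] (H : ℕ → k)
    (hn : (Finset.univ.filter fun q => σ q = π b).card = 2) :
    ∑ S ∈ totalRelations σ π, H (∑ q, (S q).card) =
      2 * H (Fintype.card Q) + 4 * H (Fintype.card Q + 1) + H (Fintype.card Q + 2) := by
  classical
  have hcard : Fintype.card Q = 2 + (Finset.univ.filter fun q => σ q ≠ π b).card := by
    rw [← hn, Finset.card_filter_add_card_filter_not, Finset.card_univ]
  rw [sum_totalRelations_eq_lsum hσ hπ h H rfl hn, hcard]
  generalize (Finset.univ.filter fun q => σ q ≠ π b).card = l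
  have : (Polynomial.X ^ l * (2 * Polynomial.X + Polynomial.X ^ 2) ^ 2 -
      2 * Polynomial.X ^ (2 + l) : Polynomial ℤ) = (2 : ℤ) • Polynomial.monomial (2 + l) 1 +
      (4 : ℤ) • Polynomial.monomial (2 + l + 1) 1 + Polynomial.monomial (2 + l + 2) 1 := by
    simp only [Polynomial.monomial_one_right_eq_X_pow, zsmul_eq_mul]
    push_cast
    ring
  rw [this, map_add, map_add, map_smul, map_smul]
  rw [Polynomial.lsum_toSpanSingleton_monomial, Polynomial.lsum_toSpanSingleton_monomial,
    Polynomial.lsum_toSpanSingleton_monomial, zsmul_eq_mul, zsmul_eq_mul]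
  push_cast
  ring

theorem CollapsesPair.card_fiber_self {R : Type*} {B : Type*} [Fintype R] [DecidableEq B]
    {π : R → B} {b c : R} (h : CollapsesPair π b c) :
    (Finset.univ.filter fun q => π q = π b).card = 2 := by
  classical
  rw [← Finset.card_pair h.1]
  congr 1
  ext i
  simp only [Finset.mem_filter, Finset.mem_univ, true_and, Finset.mem_insert,
    Finset.mem_singleton]
  rw [h.2]
  constructor
  · rintro (h | ⟨h, -⟩ | ⟨h, -⟩)
    exacts [Or.inl h, Or.inl h, Or.inr h]
  · rintro (rfl | rfl)
    exacts [Or.inl rfl, Or.inr (Or.inr ⟨rfl, rfl⟩)]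

theorem CollapsesPair.card_fiber_other {R : Type*} {B : Type*} [Fintype R] [DecidableEq B]
    {π : R → B} (hπ : Surjective π) {b c : R} (h : CollapsesPair π b c) {q : B} (hq : q ≠ π b) :
    (Finset.univ.filter fun i => π i = q).card = 1 := by
  obtain ⟨i, rfl⟩ := hπ q
  refine Finset.card_eq_one.2 ⟨i, ?_⟩
  ext j
  simp only [Finset.mem_filter, Finset.mem_univ, true_and, Finset.mem_singleton]
  have hpc : π c = π b := (h.2 c b).2 (Or.inr (Or.inr ⟨rfl, rfl⟩))
  rw [h.2]
  constructor
  · rintro (h | ⟨-, rfl⟩ | ⟨-, rfl⟩)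
    exacts [h, (hq hpc).elim, (hq rfl).elim]
  · exact Or.inl

end WeightedCount

/-! ### The sets `X(n)` and the equations for the split values -/

namespace FinGSet

theorem stabilizer_cantorX {𝔛 : Type u} [TopologicalSpace 𝔛] {n : ℕ} (φ : ContSurj 𝔛 n) :
    MulAction.stabilizer (𝔛 ≃ₜ 𝔛) φ = (Setoid.ker φ.1).fixer := by
  ext g
  rw [MulAction.mem_stabilizer_iff, Setoid.mem_fixer]
  constructor
  · intro hg x
    have := contSurj_smul_apply g φ (g x)
    rw [g.symm_apply_apply] at this
    exact Eq.trans (congrArg (fun ψ : ContSurj 𝔛 n => ψ.1 (g x)) hg).symm this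
  · intro hg
    refine Subtype.ext (ContinuousMap.ext fun x => ?_)
    rw [contSurj_smul_apply]
    have : φ.1 (g (g.symm x)) = φ.1 (g.symm x) := hg (g.symm x)
    rw [← this, g.apply_symm_apply]

theorem isOpenRel_ker_contSurj {𝔛 : Type u} [TopologicalSpace 𝔛] {n : ℕ} (φ : ContSurj 𝔛 n) :
    (Setoid.ker φ.1).IsOpenRel :=
  Setoid.IsOpenRel.of_isLocallyConstant ((IsLocallyConstant.iff_continuous _).2 φ.1.continuous)

end FinGSet

namespace GMeasure

open FinGSet

variable {𝔛 : Type u} [TopologicalSpace 𝔛] [IsCantorSpace 𝔛] {k : Type v} [CommRing k]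

/-- Splits of two different classes are independent: their fibre product is a single orbit, so
splitting one class costs the same before and after the other is split. Two different classes
require `2 ≤ n`. -/
theorem splitValue_eq_succ {m : GMeasure (𝔛 ≃ₜ 𝔛) k} {A : ℕ → k}
    (hA : ∀ r₁ r : Setoid 𝔛, r₁.IsOpenRel → IsSplit r₁ r → m.IsRelValue r₁ r (A r.numClasses))
    {n : ℕ} (hn : 2 ≤ n) : A n = A (n + 1) := by
  classical
  obtain ⟨r, hr, rfl⟩ := exists_numClasses_eq 𝔛 (n := n) (by omega)
  have := hr.finite
  obtain ⟨q, q', hqq⟩ : ∃ q q' : Quotient r, q ≠ q' := by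
    have := Finite.one_lt_card_iff_nontrivial.1 (show 1 < Nat.card (Quotient r) from hn)
    exact exists_pair_ne _
  obtain ⟨s, hsr, b, c, hs, hsc, hsq⟩ := exists_split_at hr q
  obtain ⟨r₁, h1r, b', c', hr₁, h1c, h1q⟩ := exists_split_at hr q'
  have := hs.finite
  have := hr₁.finite
  have := Fintype.ofFinite (Quotient s)
  have := Fintype.ofFinite (Quotient r₁)
  have e1 := (hA s r hs ⟨hsr, b, c, hsc⟩).eq_sum hA hs hr₁ hsr h1r
  have n1 := IsSplit.numClasses ⟨hsr, b, c, hsc⟩ hs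
  have n2 := IsSplit.numClasses ⟨h1r, b', c', h1c⟩ hr₁
  rw [sum_totalRelations_one (Setoid.quotientMap_surjective hsr)
    (Setoid.quotientMap_surjective h1r) h1c
    (fun j => ∏ i ∈ Finset.range (j - r₁.numClasses), A (r₁.numClasses + i))
    (hsc.card_fiber_other (Setoid.quotientMap_surjective hsr) (by rw [hsq, h1q]; exact hqq.symm)),
    ← Nat.card_eq_fintype_card, ← Setoid.numClasses, n1, n2] at e1
  simpa using e1

/-- Base change of a split along itself: of the relations between the two halves and the two halves,
two add no class, four add one and one adds two. -/
theorem splitValue_quadratic {m : GMeasure (𝔛 ≃ₜ 𝔛) k} {A : ℕ → k}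
    (hA : ∀ r₁ r : Setoid 𝔛, r₁.IsOpenRel → IsSplit r₁ r → m.IsRelValue r₁ r (A r.numClasses))
    {n : ℕ} (hn : n ≠ 0) : A n = 2 + 4 * A (n + 1) + A (n + 1) * A (n + 2) := by
  classical
  obtain ⟨r, hr, rfl⟩ := exists_numClasses_eq 𝔛 hn
  have := hr.finite
  obtain ⟨x⟩ := IsCantorSpace.nonempty (𝔛 := 𝔛)
  obtain ⟨r₁, h1r, b, c, hr₁, h1c, -⟩ := exists_split_at hr (Quotient.mk r x)
  have := hr₁.finite
  have := Fintype.ofFinite (Quotient r₁)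
  have e1 := (hA r₁ r hr₁ ⟨h1r, b, c, h1c⟩).eq_sum hA hr₁ hr₁ h1r h1r
  have n1 := IsSplit.numClasses ⟨h1r, b, c, h1c⟩ hr₁
  rw [sum_totalRelations_two (Setoid.quotientMap_surjective h1r)
    (Setoid.quotientMap_surjective h1r) h1c
    (fun j => ∏ i ∈ Finset.range (j - r₁.numClasses), A (r₁.numClasses + i))
    h1c.card_fiber_self,
    ← Nat.card_eq_fintype_card, ← Setoid.numClasses, n1] at e1
  simpa [Finset.prod_range_succ, Nat.add_assoc] using e1

/-- The split values are a constant `a` from two classes on. The quadratic relation at two classes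
then reads `a = 2 + 4a + a²`, and at one class it shows that the first split also has value `2 + 4a
+ a² = a`. -/
theorem exists_isRelValue_pow (m : GMeasure (𝔛 ≃ₜ 𝔛) k) : ∃ a : k, (a + 1) * (a + 2) = 0 ∧
    ∀ s r : Setoid 𝔛, s.IsOpenRel → s ≤ r →
      m.IsRelValue s r (a ^ (s.numClasses - r.numClasses)) := by
  obtain ⟨A, hA⟩ := m.exists_splitValue
  have h2 : ∀ n, A (n + 2) = A 2 := by
    intro n
    induction n with
    | zero => rfl
    | succ n ih => rw [← ih, splitValue_eq_succ hA (show 2 ≤ n + 2 by omega)]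
  have h3 := splitValue_quadratic hA (n := 2) (by norm_num)
  have h4 := splitValue_quadratic hA (n := 1) (by norm_num)
  have e3 : A 3 = A 2 := h2 1
  have e4 : A 4 = A 2 := h2 2
  norm_num at h3 h4
  rw [e3, e4] at h3
  rw [e3] at h4
  have h1 : ∀ n, n ≠ 0 → A n = A 2 := by
    intro n hn
    match n, hn with
    | 1, _ => rw [h4]; exact h3.symm
    | n + 2, _ => exact h2 n
  refine ⟨A 2, by linear_combination -h3, fun s r hs hsr => ?_⟩
  have h5 := isRelValue_prod hA hs hsr
  rwa [Finset.prod_congr rfl (g := fun _ => A 2), Finset.prod_const, Finset.card_range] at h5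
  intro i _
  have := (hs.mono hsr).numClasses_pos
  exact h1 _ (by omega)

/-- The value of a measure on `X(2)`. -/
noncomputable def base (m : GMeasure (𝔛 ≃ₜ 𝔛) k) : k := m.ofSet (cantorX 𝔛 2)

theorem _root_.FinGSet.cantorX_isTransitive {n : ℕ} (hn : n ≠ 0) :
    (cantorX 𝔛 n).IsTransitive := by
  obtain ⟨l, rfl⟩ := Nat.exists_eq_succ_of_ne_zero hn
  obtain ⟨φ, hφ, hs⟩ := exists_isLocallyConstant_surjective 𝔛 l
  exact ⟨⟨(⟨⟨φ, hφ.continuous⟩, hs⟩ : ContSurj 𝔛 (l + 1))⟩, contSurj_isPretransitive _⟩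

theorem ofSet_cantorX_of_isRelValue {m : GMeasure (𝔛 ≃ₜ 𝔛) k} {a : k}
    (h : ∀ s r : Setoid 𝔛, s.IsOpenRel → s ≤ r →
      m.IsRelValue s r (a ^ (s.numClasses - r.numClasses))) {n : ℕ} (hn : n ≠ 0) :
    m.ofSet (cantorX 𝔛 n) = a ^ (n - 1) := by
  obtain ⟨φ⟩ := (cantorX_isTransitive (𝔛 := 𝔛) hn).nonempty
  have h1 := (h (Setoid.ker φ.1) ⊤ (isOpenRel_ker_contSurj φ) le_top).eq
    (cantorX_isTransitive hn) (point_isTransitive) (toPoint _) (x := φ) (stabilizer_cantorX φ) (by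
      rw [Setoid.fixer_top]; exact eq_top_iff.2 fun _ _ => rfl)
  rw [Setoid.numClasses_ker_of_surjective φ.2, Setoid.numClasses_top] at h1
  exact h1

theorem base_eq (m : GMeasure (𝔛 ≃ₜ 𝔛) k) : (m.base + 1) * (m.base + 2) = 0 ∧
    ∀ s r : Setoid 𝔛, s.IsOpenRel → s ≤ r →
      m.IsRelValue s r (m.base ^ (s.numClasses - r.numClasses)) := by
  obtain ⟨a, ha, h⟩ := m.exists_isRelValue_pow
  have : m.base = a := (ofSet_cantorX_of_isRelValue h two_ne_zero).trans (pow_one a)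
  rw [this]
  exact ⟨ha, h⟩

theorem isRelValue (m : GMeasure (𝔛 ≃ₜ 𝔛) k) {s r : Setoid 𝔛} (hs : s.IsOpenRel) (hsr : s ≤ r) :
    m.IsRelValue s r (m.base ^ (s.numClasses - r.numClasses)) :=
  m.base_eq.2 s r hs hsr

end GMeasure

/-! ### A measure is determined by its value on `X(2)` up to symmetry indices -/

namespace GMeasure

open FinGSet

theorem ext_of_isTransitive {G : Type u} [Group G] [TopologicalSpace G] {k : Type v} [CommRing k]
    {m m' : GMeasure G k}
    (h : ∀ (X Y : FinGSet G) (_ : X.IsTransitive) (hY : Y.IsTransitive)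
      (f : X →[G] Y), m.toFun ⟨X, Y, f, hY⟩ = m'.toFun ⟨X, Y, f, hY⟩) : m = m' := by
  ext ⟨X, Y, f, hY⟩
  refine induction_hom (P := fun X f => m.toFun ⟨X, Y, f, hY⟩ = m'.toFun ⟨X, Y, f, hY⟩)
    ?_ ?_ ?_ X f
  · intro X f hX
    rw [map_isEmpty, map_isEmpty]
  · intro X X₁ X₂ f i₁ i₂ hd h1 h2
    rw [m.map_add _ _ _ _ hY f i₁ i₂ hd, m'.map_add _ _ _ _ hY f i₁ i₂ hd, h1, h2]
  · intro X f hX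
    exact h X Y hX hY f

variable {𝔛 : Type u} [TopologicalSpace 𝔛] [IsCantorSpace 𝔛] {k : Type v} [CommRing k]

/-- Compute the value of the map from a fixer cover of `X` to `Y` in two ways, through `X` and
through a fixer cover of `Y`. The covers contribute their degrees, which are the symmetry indices.
No division is made, since `k` may have torsion. -/
theorem symIndex_mul_map (m : GMeasure (𝔛 ≃ₜ 𝔛) k) {X Y : FinGSet (𝔛 ≃ₜ 𝔛)}
    (hX : X.IsTransitive) (hY : Y.IsTransitive) (f : X →[𝔛 ≃ₜ 𝔛] Y) (x : X) :
    (symIndex (MulAction.stabilizer (𝔛 ≃ₜ 𝔛) x) : k) * m.toFun ⟨X, Y, f, hY⟩ =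
      symIndex (MulAction.stabilizer (𝔛 ≃ₜ 𝔛) (f x)) *
        m.base ^ ((coarsest (MulAction.stabilizer (𝔛 ≃ₜ 𝔛) x)).numClasses -
          (coarsest (MulAction.stabilizer (𝔛 ≃ₜ 𝔛) (f x))).numClasses) := by
  obtain ⟨W, w, q, hW, hq, hw, hc⟩ := exists_fixer_cover x
  obtain ⟨W', w', q', hW', hq', hw', hc'⟩ := exists_fixer_cover (f x)
  have hle : coarsest (MulAction.stabilizer (𝔛 ≃ₜ 𝔛) x) ≤
      coarsest (MulAction.stabilizer (𝔛 ≃ₜ 𝔛) (f x)) :=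
    coarsest_mono (X.smooth x) (stabilizer_le_of_hom f x)
  obtain ⟨p, hp⟩ := hW.exists_hom w w' (by rw [hw, hw']; exact Setoid.fixer_mono hle)
  have he : q'.comp p = f.comp q := hW.hom_ext w (by
    change q' (p w) = f (q w)
    rw [hp, hq, hq'])
  have h1 := m.map_comp W W' Y hW' hY p q'
  rw [he, m.map_comp W X Y hX hY q f, m.map_cover_transitive hW hX hc w,
    m.map_cover_transitive hW' hY hc' w', hw, hw', hq, hq',
    (m.isRelValue (coarsest_isOpenRel (X.smooth x)) hle).eq hW hW' p w hw (by rw [hp, hw'])] at h1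
  rw [symIndex, symIndex, ← h1, mul_comm]

theorem ext_of_base_eq {K : Type v} [Field K] [CharZero K] {m m' : GMeasure (𝔛 ≃ₜ 𝔛) K}
    (h : m.base = m'.base) : m = m' := by
  refine ext_of_isTransitive fun X Y hX hY f => ?_
  obtain ⟨x⟩ := hX.nonempty
  have h1 := m.symIndex_mul_map hX hY f x
  rw [h, ← m'.symIndex_mul_map hX hY f x] at h1
  exact mul_left_cancel₀ (Nat.cast_ne_zero.2 (symIndex_ne_zero (X.smooth x))) h1

theorem base_map {l : Type w} [CommRing l] (φ : k →+* l) (m : GMeasure (𝔛 ≃ₜ 𝔛) k) :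
    (m.map φ).base = φ m.base := rfl

end GMeasure

/-! ### Inverting integers by means of cyclic symmetries -/

section Translations

variable {𝔛 : Type u} [TopologicalSpace 𝔛] {A : Type*} [AddCommGroup A]

/-- The homeomorphisms that act on the fibers of `φ` by a translation of the index group. -/
def translationSubgroup (φ : 𝔛 → A) : Subgroup (𝔛 ≃ₜ 𝔛) where
  carrier := {g | ∃ c, ∀ x, φ (g x) = φ x + c}
  one_mem' := ⟨0, fun x => (add_zero (φ x)).symm⟩
  mul_mem' := by
    rintro g h ⟨c, hc⟩ ⟨d, hd⟩
    refine ⟨d + c, fun x => ?_⟩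
    change φ (g (h x)) = _
    rw [hc, hd, add_assoc]
  inv_mem' := by
    rintro g ⟨c, hc⟩
    refine ⟨-c, fun x => ?_⟩
    have := hc (g.symm x)
    rw [g.apply_symm_apply] at this
    rw [this, add_neg_cancel_right]
    rfl

theorem fixer_ker_le_translationSubgroup (φ : 𝔛 → A) :
    (Setoid.ker φ).fixer ≤ translationSubgroup φ :=
  fun _ hg => ⟨0, fun x => (hg x).trans (add_zero _).symm⟩

/-- If a class of a coarser partition met two fibres of `φ`, a homeomorphism supported there could
push its part `E` of one fibre onto a proper part `D` of itself. It would have to translate by zero,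
and hence map `E` onto `E`. -/
theorem coarsest_translationSubgroup_le [IsCantorSpace 𝔛] {φ : 𝔛 → A}
    (hφ : IsLocallyConstant φ) : coarsest (translationSubgroup φ) ≤ Setoid.ker φ := by
  have hV := isOpen_of_fixer_le (Setoid.IsOpenRel.of_isLocallyConstant hφ)
    (fixer_ker_le_translationSubgroup φ)
  set t := coarsest (translationSubgroup φ)
  have ht : t.IsOpenRel := coarsest_isOpenRel hV
  intro x y hxy
  by_contra hne
  have hA := ht.isClopen x
  have hE : IsClopen ({z | t x z} ∩ {z | φ z = φ x}) := hA.inter (hφ.isClopen_fiber (φ x))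
  obtain ⟨D, hDE, hD, hDn, ⟨z, hzE, hzD⟩⟩ := exists_proper_clopen hE ⟨x, t.refl x, rfl⟩
  have hy : y ∈ {z | t x z} \ ({z | t x z} ∩ {z | φ z = φ x}) :=
    ⟨hxy, fun h => hne h.2.symm⟩
  obtain ⟨g, hg, hgE⟩ := exists_supported_map hA hE hD Set.inter_subset_left
    (hDE.trans Set.inter_subset_left) ⟨x, t.refl x, rfl⟩ hDn ⟨y, hy⟩ ⟨z, hzE.1, hzD⟩
  obtain ⟨c, hc⟩ := fixer_coarsest_le hV (homeoSupportedIn_class_le t x hg)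
  obtain ⟨d, hd⟩ := hDn
  obtain ⟨e, he, rfl⟩ := hgE.symm ▸ hd
  have h1 := hc e
  rw [(hDE hd).2, he.2, left_eq_add] at h1
  have h2 := hc (g.symm z)
  rw [g.apply_symm_apply, h1, add_zero] at h2
  refine hzD (hgE ▸ ⟨g.symm z, ⟨?_, h2.symm.trans hzE.2⟩, g.apply_symm_apply z⟩)
  exact mem_of_mem_homeoSupportedIn ((homeoSupportedIn _).inv_mem hg) hzE.1

/-- The amount of translation is a homomorphism onto `A` whose kernel is the fixer. -/
theorem relIndex_fixer_ker_translationSubgroup [IsCantorSpace 𝔛] {φ : 𝔛 → A}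
    (hφ : IsLocallyConstant φ) (hs : Surjective φ) :
    (Setoid.ker φ).fixer.relIndex (translationSubgroup φ) = Nat.card A := by
  obtain ⟨x₀⟩ := IsCantorSpace.nonempty (𝔛 := 𝔛)
  have hsub : ∀ (g : translationSubgroup φ) (x y : 𝔛), φ (g.1 x) - φ x = φ (g.1 y) - φ y := by
    rintro ⟨g, c, hc⟩ x y
    simp only [hc, add_sub_cancel_left]
  let χ : translationSubgroup φ →* Multiplicative A :=
    { toFun := fun g => Multiplicative.ofAdd (φ (g.1 x₀) - φ x₀)
      map_one' := by
        rw [← ofAdd_zero, ← sub_self (φ x₀)]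
        rfl
      map_mul' := fun g h => by
        rw [← ofAdd_add, hsub g x₀ (h.1 x₀), sub_add_sub_cancel]
        rfl }
  have hker : χ.ker = (Setoid.ker φ).fixer.subgroupOf (translationSubgroup φ) := by
    ext g
    rw [MonoidHom.mem_ker, Subgroup.mem_subgroupOf, Setoid.mem_fixer]
    constructor
    · intro h x
      have h' : φ (g.1 x₀) - φ x₀ = 0 := h
      rw [hsub g x₀ x] at h'
      exact sub_eq_zero.1 h'
    · intro h
      have h' : φ (g.1 x₀) - φ x₀ = 0 := sub_eq_zero.2 (h x₀)
      exact h'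
  have hsurj : Surjective χ := by
    intro c
    obtain ⟨g, hg⟩ := exists_homeo_comp_eq (φ := fun x => φ x + Multiplicative.toAdd c) (ψ := φ)
      (hφ.comp (· + Multiplicative.toAdd c)) hφ (by
        rw [hs.range_eq, Set.range_eq_univ]
        intro a
        obtain ⟨x, hx⟩ := hs (a - Multiplicative.toAdd c)
        exact ⟨x, by simp only [hx, sub_add_cancel]⟩)
    refine ⟨⟨g, _, hg⟩, ?_⟩
    change Multiplicative.ofAdd (φ (g x₀) - φ x₀) = c
    rw [hg, add_sub_cancel_left]
    rfl
  rw [Subgroup.relIndex, ← hker, Subgroup.index_ker, MonoidHom.range_eq_top.2 hsurj]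
  exact Nat.card_congr Subgroup.topEquiv.toEquiv

end Translations

namespace GMeasure

open FinGSet

variable {𝔛 : Type u} [TopologicalSpace 𝔛] [IsCantorSpace 𝔛] {k : Type v} [CommRing k]

/-- Let `Fin d` act by translation on `d` classes. The coset space of the fixer has measure `base ^
(d - 1)` and covers that of the translation group with degree `d`. -/
theorem exists_natCast_mul_eq_base_pow (m : GMeasure (𝔛 ≃ₜ 𝔛) k) {d : ℕ} (hd : d ≠ 0) :
    ∃ X : FinGSet (𝔛 ≃ₜ 𝔛), (d : k) * m.ofSet X = m.base ^ (d - 1) := by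
  obtain ⟨n, rfl⟩ := Nat.exists_eq_succ_of_ne_zero hd
  obtain ⟨φ, hφ, hs⟩ := exists_isLocallyConstant_surjective 𝔛 n
  have hr := Setoid.IsOpenRel.of_isLocallyConstant hφ
  have hle := fixer_ker_le_translationSubgroup φ
  have hV := isOpen_of_fixer_le hr hle
  have hX := coset_isTransitive _ hr.isOpen_fixer
  have hx := stabilizer_cosetOne _ hr.isOpen_fixer
  have hY := coset_isTransitive _ hV
  have hy := stabilizer_cosetOne _ hV
  obtain ⟨f, hf⟩ := hX.exists_hom (cosetOne _ hr.isOpen_fixer) (cosetOne _ hV)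
    (by rw [hx, hy]; exact hle)
  refine ⟨coset _ hV, ?_⟩
  have h1 := m.map_comp _ _ _ hY point_isTransitive f (toPoint _)
  have h2 : m.toFun ⟨_, _, (toPoint _).comp f, point_isTransitive⟩ = _ :=
    (m.isRelValue hr le_top).eq hX point_isTransitive
    ((toPoint _).comp f) _ hx (by rw [Setoid.fixer_top]; exact eq_top_iff.2 fun _ _ => rfl)
  rw [h2, Setoid.numClasses_ker_of_surjective hs, Setoid.numClasses_top,
    m.map_cover_transitive hX hY (isCover_of_coarsest hX (cosetOne _ hr.isOpen_fixer) (by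
      rw [hf, hx, hy]
      exact Setoid.fixer_mono (coarsest_translationSubgroup_le hφ))) (cosetOne _ hr.isOpen_fixer),
    hf, hx, hy, relIndex_fixer_ker_translationSubgroup hφ hs, Nat.card_eq_fintype_card,
    Fintype.card_fin] at h1
  rw [mul_comm]
  exact h1.symm

end GMeasure

/-! ### Index lemmas and cartesian squares of coset spaces -/

theorem Subgroup.exists_mul_of_relIndex_le {G : Type u} [Group G] {F U V : Subgroup G}
    (hUV : U ≤ V) (h0 : F.relIndex V ≠ 0) (h : F.relIndex V ≤ F.relIndex U) {v : G} (hv : v ∈ V) :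
    ∃ a ∈ U, ∃ b ∈ F, v = a * b := by
  have hfin : Finite (V ⧸ F.subgroupOf V) := Nat.finite_of_card_ne_zero h0
  have hi := (Subgroup.quotientSubgroupOfEmbeddingOfLE F hUV).injective
  have hb := (Nat.bijective_iff_injective_and_card _).2
    ⟨hi, le_antisymm (Nat.card_le_card_of_injective _ hi) h⟩
  obtain ⟨q, hq⟩ := hb.2 (QuotientGroup.mk ⟨v, hv⟩)
  obtain ⟨a, rfl⟩ := QuotientGroup.mk_surjective q
  rw [Subgroup.quotientSubgroupOfEmbeddingOfLE_apply_mk, QuotientGroup.eq,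
    Subgroup.mem_subgroupOf] at hq
  exact ⟨a.1, a.2, _, hq, by simp⟩

theorem Subgroup.exists_mul_of_mem_sup {G : Type u} [Group G] {F U : Subgroup G}
    (h : U ≤ Subgroup.normalizer (F : Set G)) {v : G} (hv : v ∈ U ⊔ F) :
    ∃ a ∈ U, ∃ b ∈ F, a * b = v := by
  rw [← SetLike.mem_coe, Subgroup.coe_mul_of_left_le_normalizer_right _ _ h] at hv
  exact hv

theorem Subgroup.relIndex_sup_le {G : Type u} [Group G] {F U : Subgroup G}
    (h : U ≤ Subgroup.normalizer (F : Set G)) (h0 : F.relIndex U ≠ 0) :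
    F.relIndex (U ⊔ F) ≤ F.relIndex U := by
  have hfin : Finite (U ⧸ F.subgroupOf U) := Nat.finite_of_card_ne_zero h0
  refine Nat.card_le_card_of_surjective
    (Subgroup.quotientSubgroupOfEmbeddingOfLE F (le_sup_left : U ≤ U ⊔ F)) fun q => ?_
  obtain ⟨⟨v, hv⟩, rfl⟩ := QuotientGroup.mk_surjective q
  obtain ⟨a, ha, b, hb, rfl⟩ := Subgroup.exists_mul_of_mem_sup h hv
  refine ⟨QuotientGroup.mk ⟨a, ha⟩, ?_⟩
  rw [Subgroup.quotientSubgroupOfEmbeddingOfLE_apply_mk, QuotientGroup.eq,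
    Subgroup.mem_subgroupOf]
  simpa using hb

namespace FinGSet

/-- Uniqueness in the fibre product holds because the stabilizer upstairs contains the intersection;
existence holds because the stabilizer in the base is the product of the other two. -/
theorem isCartesian_of_stabilizer {G : Type u} [Group G] [TopologicalSpace G]
    {X Y X' Y' : FinGSet G} (hX : X.IsTransitive) (hY' : Y'.IsTransitive) (hX' : X'.IsTransitive)
    {f' : X' →[G] Y'} {g' : X' →[G] X} {f : X →[G] Y} {g : Y' →[G] Y} (a : X')
    (hsq : f (g' a) = g (f' a))
    (hinf : MulAction.stabilizer G (g' a) ⊓ MulAction.stabilizer G (f' a) ≤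
      MulAction.stabilizer G a)
    (hmul : ∀ k ∈ MulAction.stabilizer G (f (g' a)), ∃ c ∈ MulAction.stabilizer G (g' a),
      ∃ d ∈ MulAction.stabilizer G (f' a), c * d = k) : IsCartesian f' g' f g := by
  constructor
  · intro z
    obtain ⟨k, rfl⟩ := hX'.exists_smul_eq a z
    rw [map_smul, map_smul, map_smul, map_smul, hsq]
  · intro x y hxy
    obtain ⟨k, rfl⟩ := hX.exists_smul_eq (g' a) x
    obtain ⟨l, rfl⟩ := hY'.exists_smul_eq (f' a) y
    rw [map_smul, map_smul, ← hsq] at hxy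
    obtain ⟨c, hc, d, hd, hcd⟩ := hmul (k⁻¹ * l) (by
      rw [MulAction.mem_stabilizer_iff, mul_smul, ← hxy, inv_smul_smul])
    rw [MulAction.mem_stabilizer_iff] at hc hd
    -- The element `k * c = l * d⁻¹` has the prescribed effect on both base points at once.
    have hl : k * c = l * d⁻¹ := by
      rw [eq_mul_inv_iff_mul_eq, mul_assoc, hcd, mul_inv_cancel_left]
    refine ⟨(k * c) • a, ⟨?_, ?_⟩, ?_⟩
    · rw [map_smul, mul_smul, hc]
    · rw [hl, map_smul, mul_smul, inv_smul_eq_iff.2 hd.symm]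
    · rintro z ⟨h1, h2⟩
      obtain ⟨j, rfl⟩ := hX'.exists_smul_eq a z
      rw [map_smul] at h1 h2
      have : j⁻¹ * (k * c) ∈ MulAction.stabilizer G a := hinf ⟨?_, ?_⟩
      · rw [MulAction.mem_stabilizer_iff, mul_smul, inv_smul_eq_iff] at this
        exact this.symm
      · change _ ∈ MulAction.stabilizer _ _
        rw [MulAction.mem_stabilizer_iff, mul_smul, inv_smul_eq_iff, mul_smul,
          hc, h1]
      · change _ ∈ MulAction.stabilizer _ _
        rw [MulAction.mem_stabilizer_iff, mul_smul, inv_smul_eq_iff, hl, mul_smul,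
          inv_smul_eq_iff.2 hd.symm, h2]

end FinGSet

/-! ### Cutting an orbit of classes and merging one side -/

section Merge

variable {𝔛 : Type u} [TopologicalSpace 𝔛] [IsCantorSpace 𝔛]

theorem coarsest_inf_fixer {U : Subgroup (𝔛 ≃ₜ 𝔛)} (hU : IsOpen (U : Set (𝔛 ≃ₜ 𝔛)))
    {r : Setoid 𝔛} (hr : r.IsOpenRel) : coarsest (U ⊓ r.fixer) = coarsest U ⊓ r := by
  have hc := coarsest_isOpenRel hU
  have ho : IsOpen ((U ⊓ r.fixer : Subgroup (𝔛 ≃ₜ 𝔛)) : Set (𝔛 ≃ₜ 𝔛)) := hU.inter hr.isOpen_fixer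
  refine le_antisymm (le_inf (coarsest_mono ho inf_le_left) ?_) (le_coarsest (hc.inf hr) ?_)
  · exact le_of_fixer_le hr (coarsest_isOpenRel ho) ((fixer_coarsest_le ho).trans inf_le_right)
  · rw [Setoid.fixer_inf]
    exact inf_le_inf_right _ (fixer_coarsest_le hU)

theorem symIndex_inf_fixer {U : Subgroup (𝔛 ≃ₜ 𝔛)} (hU : IsOpen (U : Set (𝔛 ≃ₜ 𝔛)))
    {r : Setoid 𝔛} (hr : r.IsOpenRel) :
    symIndex (U ⊓ r.fixer) = (coarsest U).fixer.relIndex (U ⊓ r.fixer) := by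
  rw [symIndex, coarsest_inf_fixer hU hr, Setoid.fixer_inf, ← Subgroup.inf_relIndex_right,
    ← Subgroup.inf_relIndex_right (coarsest U).fixer]
  congr 1
  exact le_antisymm (le_inf (inf_le_left.trans inf_le_left) inf_le_right)
    (le_inf (le_inf inf_le_left (inf_le_right.trans inf_le_right)) inf_le_right)

/-- The partition `s` with all its classes inside `C` that are equivalent under `r` merged. -/
def Setoid.merge (s r : Setoid 𝔛) (C : Set 𝔛) (hC : ∀ x y, r x y → x ∈ C → y ∈ C) :
    Setoid 𝔛 where
  r x y := r x y ∧ (x ∈ C ∨ s x y)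
  iseqv :=
    { refl := fun x => ⟨r.refl x, Or.inr (s.refl x)⟩
      symm := fun {x y} h => ⟨r.symm h.1, h.2.imp (hC x y h.1) s.symm⟩
      trans := fun {x y z} h h' => ⟨r.trans h.1 h'.1, by
        rcases h.2 with hx | hx
        · exact Or.inl hx
        rcases h'.2 with hy | hy
        · exact Or.inl (hC y x (r.symm h.1) hy)
        · exact Or.inr (s.trans hx hy)⟩ }

/-- If cutting an orbit `O` of classes of `coarsest U` in two pieces does not decrease the
symmetry index, the classes inside one of the pieces can be merged. -/
theorem exists_merge {U : Subgroup (𝔛 ≃ₜ 𝔛)} (hU : IsOpen (U : Set (𝔛 ≃ₜ 𝔛))) {r r₁ : Setoid 𝔛}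
    (hr₁ : r₁.IsOpenRel) {O B : Set 𝔛}
    (hO : ∀ x ∈ O, ∀ y ∈ O, ∃ g ∈ U, coarsest U y (g x))
    (hne : ∃ x ∈ O, ∃ y ∈ O, ¬ coarsest U x y)
    (hrO : ∀ x ∈ O, ∀ y ∈ O, r x y)
    (hr : ∀ x y, r x y → x ∈ O → y ∈ O)
    (hr₁B : ∀ x y, r₁ x y ↔ r x y ∧ (x ∈ B ↔ y ∈ B))
    (hB : ∃ x ∈ O, x ∈ B) (hC : ∃ x ∈ O, x ∉ B)
    (hle : symIndex U ≤ symIndex (U ⊓ r₁.fixer)) :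
    ∃ t, coarsest (U ⊓ r₁.fixer) ≤ t ∧ coarsest (U ⊓ r₁.fixer) ≠ t ∧ t ≤ r₁ ∧
      (∀ g ∈ U ⊓ r₁.fixer, ∀ x y, t x y → t (g x) (g y)) ∧
      U ⊓ r₁.fixer ⊓ t.fixer ≤ (coarsest (U ⊓ r₁.fixer)).fixer := by
  rw [symIndex_inf_fixer hU hr₁] at hle
  have hcls := coarsest_inf_fixer hU hr₁
  have hsr : coarsest (U ⊓ r₁.fixer) ≤ r₁ := hcls.trans_le inf_le_right
  have hr₁r : ∀ {x y}, r₁ x y → r x y := fun {x y} h => ((hr₁B x y).1 h).1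
  have hCs : ∀ x y, r₁ x y → x ∈ O \ B → y ∈ O \ B := fun x y h hx =>
    ⟨hr x y (hr₁r h) hx.1, fun hy => hx.2 (((hr₁B x y).1 h).2.2 hy)⟩
  -- the smaller group acts transitively on the classes in `O`
  have htrans : ∀ x ∈ O, ∀ y ∈ O, ∃ g ∈ U ⊓ r₁.fixer, coarsest U y (g x) := by
    intro x hx y hy
    obtain ⟨g, hg, hgx⟩ := hO x hx y hy
    obtain ⟨a, ha, b, hb, rfl⟩ := Subgroup.exists_mul_of_relIndex_le inf_le_left
      (symIndex_ne_zero hU) hle hg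
    exact ⟨a, ha, (coarsest U).trans hgx ((coarsest_apply_apply hU ha.1 _ _).2 (hb x))⟩
  have hBO : ∀ x ∈ O, ∃ y, y ∈ B ∧ coarsest U x y := by
    intro x hx
    obtain ⟨b, hbO, hb⟩ := hB
    obtain ⟨g, hg, hgb⟩ := htrans b hbO x hx
    exact ⟨g b, (((hr₁B _ _).1 (hg.2 b)).2).2 hb, hgb⟩
  have hCO : ∀ x ∈ O, ∃ y, y ∈ O \ B ∧ coarsest U x y := by
    intro x hx
    obtain ⟨b, hbO, hb⟩ := hC
    obtain ⟨g, hg, hgb⟩ := htrans b hbO x hx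
    exact ⟨g b, hCs _ _ (r₁.symm (hg.2 b)) ⟨hbO, hb⟩, hgb⟩
  have hinv : ∀ g ∈ U ⊓ r₁.fixer, ∀ x y, coarsest (U ⊓ r₁.fixer) (g x) (g y) ↔
      coarsest (U ⊓ r₁.fixer) x y := fun g hg x y =>
    coarsest_apply_apply (hU.inter hr₁.isOpen_fixer) hg x y
  refine ⟨Setoid.merge _ r₁ (O \ B) hCs, fun {x y} h => ⟨hsr h, Or.inr h⟩, ?_, fun {x y} h => h.1,
    ?_, ?_⟩
  -- Two different classes in `O` both meet `O \ B`, and the merge identifies these pieces.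
  · intro heq
    obtain ⟨x, hx, y, hy, hxy⟩ := hne
    obtain ⟨x', hx', hxx'⟩ := hCO x hx
    obtain ⟨y', hy', hyy'⟩ := hCO y hy
    have h1 : coarsest (U ⊓ r₁.fixer) x' y' := by
      rw [heq]
      exact ⟨(hr₁B _ _).2 ⟨hrO _ hx'.1 _ hy'.1, iff_of_false hx'.2 hy'.2⟩, Or.inl hx'⟩
    rw [hcls] at h1
    exact hxy ((coarsest U).trans hxx' ((coarsest U).trans h1.1 ((coarsest U).symm hyy')))
  · rintro g hg x y ⟨hxy, h⟩
    refine ⟨r₁.trans (hg.2 x) (r₁.trans hxy (r₁.symm (hg.2 y))), h.imp (fun hx => ?_) fun h => ?_⟩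
    · exact hCs _ _ (r₁.symm (hg.2 x)) hx
    · exact (hinv g hg x y).2 h
  · rintro g ⟨hg, hgt⟩ x
    rw [hcls]
    refine ⟨?_, hg.2 x⟩
    -- The class of a point of `O \ B` also meets `B`, where nothing was merged. An element fixing
    -- the pieces in `B` fixes the whole class, so the merge loses no information about the action.
    by_cases hx : x ∈ O \ B
    · obtain ⟨y, hy, hxy⟩ := hBO x hx.1
      have hgy : coarsest U (g y) y := by
        have := (hgt y).2
        rw [hcls] at this
        rcases this with h | h
        · exact (h.2 ((((hr₁B _ _).1 (hg.2 y)).2).2 hy)).elim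
        · exact h.1
      exact (coarsest U).trans ((coarsest_apply_apply hU hg.1 _ _).2 hxy)
        ((coarsest U).trans hgy ((coarsest U).symm hxy))
    · have := (hgt x).2
      rw [hcls] at this
      rcases this with h | h
      · exact (hx (hCs _ _ (hg.2 x) h)).elim
      · exact h.1

end Merge

theorem Setoid.le_normalizer_fixer {𝔛 : Type u} [TopologicalSpace 𝔛] {t : Setoid 𝔛}
    {U : Subgroup (𝔛 ≃ₜ 𝔛)} (h : ∀ g ∈ U, ∀ x y, t x y → t (g x) (g y)) :
    U ≤ Subgroup.normalizer (t.fixer : Set (𝔛 ≃ₜ 𝔛)) := by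
  have key : ∀ g ∈ U, ∀ n ∈ t.fixer, g * n * g⁻¹ ∈ t.fixer := by
    intro g hg n hn x
    have := h g hg _ _ (hn (g⁻¹ x))
    change t _ (g (g.symm x)) at this
    rwa [g.apply_symm_apply] at this
  intro g hg n
  refine ⟨key g hg n, fun hn => ?_⟩
  have := key g⁻¹ (U.inv_mem hg) _ hn
  rwa [inv_inv, ← mul_assoc, inv_mul_cancel_left, inv_mul_cancel_right] at this

namespace GMeasure

open FinGSet

variable {𝔛 : Type u} [TopologicalSpace 𝔛] [IsCantorSpace 𝔛] {k : Type v} [CommRing k]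

/-- Let `U` be the stabilizer of `x` and take `X₂` to be the coset space of `U ⊔ t.fixer`. Since `U`
normalizes `t.fixer` and meets it in the fixer of `coarsest U`, the map to `X₂` becomes, after base
change, the map from the coset space of that fixer to that of `t.fixer`, whose value is a power of
`base`. -/
theorem exists_map_eq_mul_base_pow (m : GMeasure (𝔛 ≃ₜ 𝔛) k) {X Z : FinGSet (𝔛 ≃ₜ 𝔛)}
    (hX : X.IsTransitive) (hZ : Z.IsTransitive) (f : X →[𝔛 ≃ₜ 𝔛] Z) (x : X) {r t : Setoid 𝔛}
    (hr : MulAction.stabilizer (𝔛 ≃ₜ 𝔛) (f x) = r.fixer)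
    (hst : coarsest (MulAction.stabilizer (𝔛 ≃ₜ 𝔛) x) ≤ t)
    (hne : coarsest (MulAction.stabilizer (𝔛 ≃ₜ 𝔛) x) ≠ t) (htr : t ≤ r)
    (hinv : ∀ g ∈ MulAction.stabilizer (𝔛 ≃ₜ 𝔛) x, ∀ y z, t y z → t (g y) (g z))
    (hfix : MulAction.stabilizer (𝔛 ≃ₜ 𝔛) x ⊓ t.fixer ≤
      (coarsest (MulAction.stabilizer (𝔛 ≃ₜ 𝔛) x)).fixer) :
    ∃ (X₂ : FinGSet (𝔛 ≃ₜ 𝔛)) (_ : X₂.IsTransitive) (f₂ : X₂ →[𝔛 ≃ₜ 𝔛] Z) (x₂ : X₂) (j : ℕ),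
      f₂ x₂ = f x ∧ symIndex (MulAction.stabilizer (𝔛 ≃ₜ 𝔛) x₂) ≤
        symIndex (MulAction.stabilizer (𝔛 ≃ₜ 𝔛) x) ∧
      m.toFun ⟨X, Z, f, hZ⟩ = m.toFun ⟨X₂, Z, f₂, hZ⟩ * m.base ^ (j + 1) := by
  set U := MulAction.stabilizer (𝔛 ≃ₜ 𝔛) x with hU_def
  have hU : IsOpen (U : Set (𝔛 ≃ₜ 𝔛)) := X.smooth x
  have hs := coarsest_isOpenRel hU
  have ht := hs.mono hst
  have hV : IsOpen ((U ⊔ t.fixer : Subgroup (𝔛 ≃ₜ 𝔛)) : Set (𝔛 ≃ₜ 𝔛)) :=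
    Subgroup.isOpen_mono le_sup_left hU
  have hVr : U ⊔ t.fixer ≤ r.fixer :=
    sup_le ((stabilizer_le_of_hom f x).trans hr.le) (Setoid.fixer_mono htr)
  have hnorm := Setoid.le_normalizer_fixer hinv
  have hX₂ := coset_isTransitive _ hV
  have hx₂ := stabilizer_cosetOne _ hV
  have hT := coset_isTransitive _ ht.isOpen_fixer
  have hx₃ := stabilizer_cosetOne _ ht.isOpen_fixer
  have hW := coset_isTransitive _ hs.isOpen_fixer
  have hw := stabilizer_cosetOne _ hs.isOpen_fixer
  obtain ⟨p, hp⟩ := hX.exists_hom x (cosetOne _ hV) (by rw [hx₂]; exact le_sup_left)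
  obtain ⟨f₂, hf₂⟩ := hX₂.exists_hom (cosetOne _ hV) (f x) (by rw [hx₂, hr]; exact hVr)
  obtain ⟨q, hq⟩ := hT.exists_hom (cosetOne _ ht.isOpen_fixer) (cosetOne _ hV)
    (by rw [hx₂, hx₃]; exact le_sup_right)
  obtain ⟨l, hl⟩ := hW.exists_hom (cosetOne _ hs.isOpen_fixer) (cosetOne _ ht.isOpen_fixer)
    (by rw [hx₃, hw]; exact Setoid.fixer_mono hst)
  obtain ⟨g', hg'⟩ := hW.exists_hom (cosetOne _ hs.isOpen_fixer) x
    (by rw [hw]; exact fixer_coarsest_le hU)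
  have hc : IsCartesian l g' p q := by
    refine isCartesian_of_stabilizer hX hT hW (cosetOne _ hs.isOpen_fixer) ?_ ?_ ?_
    · rw [hg', hp, hl, hq]
    · rw [hg', hl, hx₃, hw]
      exact hfix
    · rw [hg', hp, hl, hx₂, hx₃]
      exact fun v hv => Subgroup.exists_mul_of_mem_sup hnorm hv
  have hval := (m.isRelValue hs hst).eq hW hT l _ hw (by rw [hl, hx₃])
  rw [m.map_baseChange _ _ _ _ hX₂ hT _ _ _ _ hc] at hval
  have hlt : t.numClasses < (coarsest U).numClasses :=
    lt_of_not_ge fun h => hne (hs.eq_of_numClasses_le hst h)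
  -- The exponent `j + 1` is the number of classes lost in passing to `t`, positive because `t` is
  -- strictly coarser.
  refine ⟨_, hX₂, f₂, cosetOne _ hV, (coarsest U).numClasses - t.numClasses - 1, hf₂, ?_, ?_⟩
  · have h1 : t.fixer.relIndex U = symIndex U := by
      rw [symIndex, ← Subgroup.inf_relIndex_left U, ← Subgroup.inf_relIndex_left U (coarsest U).fixer]
      congr 1
      exact le_antisymm (le_inf inf_le_left hfix)
        (le_inf inf_le_left (inf_le_right.trans (Setoid.fixer_mono hst)))
    have h2 : t.fixer.relIndex (U ⊔ t.fixer) ≤ symIndex U :=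
      (Subgroup.relIndex_sup_le hnorm (h1 ▸ symIndex_ne_zero hU)).trans h1.le
    rw [hx₂]
    refine (symIndex_le_relIndex ht le_sup_right ?_).trans h2
    refine relIndex_fixer_ne_zero ht fun v hv y z hyz => ?_
    obtain ⟨a, ha, b, hb, rfl⟩ := Subgroup.exists_mul_of_mem_sup hnorm hv
    exact hinv a ha _ _ (t.trans (hb y) (t.trans hyz (t.symm (hb z))))
  · have hcomp : f = f₂.comp p := hX.hom_ext x (by rw [← hf₂, ← hp]; rfl)
    rw [hcomp, m.map_comp _ _ _ hX₂ hZ, hval]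
    congr 2
    omega

end GMeasure

/-! ### Rings of fractions without division -/

/-- The elements that become integers after multiplication by an element of `S`. -/
def fractionSubring (S : Submonoid ℕ) (k : Type v) [CommRing k] : Subring k where
  carrier := {z | ∃ d ∈ S, ∃ n : ℤ, (d : k) * z = n}
  mul_mem' := by
    rintro z w ⟨d, hd, n, h⟩ ⟨e, he, l, h'⟩
    refine ⟨d * e, S.mul_mem hd he, n * l, ?_⟩
    push_cast
    rw [← h, ← h']
    ring
  one_mem' := ⟨1, S.one_mem, 1, by simp⟩
  add_mem' := by
    rintro z w ⟨d, hd, n, h⟩ ⟨e, he, l, h'⟩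
    refine ⟨d * e, S.mul_mem hd he, e * n + d * l, ?_⟩
    push_cast
    rw [← h, ← h']
    ring
  zero_mem' := ⟨1, S.one_mem, 0, by simp⟩
  neg_mem' := by
    rintro z ⟨d, hd, n, h⟩
    exact ⟨d, hd, -n, by rw [mul_neg, h, Int.cast_neg]⟩

theorem mem_fractionSubring_of_mul {S : Submonoid ℕ} {k : Type v} [CommRing k] {z : k} {d : ℕ}
    (hd : d ∈ S) (h : (d : k) * z ∈ fractionSubring S k) : z ∈ fractionSubring S k := by
  obtain ⟨e, he, n, h⟩ := h
  exact ⟨e * d, S.mul_mem he hd, n, by rw [← h]; push_cast; ring⟩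

/-- The odd natural numbers. -/
def oddSubmonoid : Submonoid ℕ where
  carrier := {n | Odd n}
  mul_mem' := Odd.mul
  one_mem' := odd_one

/-- Iterating `h` writes `z = y + 2 ^ e * w` with `y` a fraction and `w ∈ M`. If `c = 2 ^ e * o`
with `o` odd, then `o * z = o * y + c * w` is a fraction by `h'`. This remains valid when `k` has
`2`-torsion. -/
theorem le_fractionSubring_of_le_sup {k : Type v} [CommRing k] {M : AddSubgroup k} {c : ℕ}
    (hc : c ≠ 0)
    (h : M ≤ (fractionSubring oddSubmonoid k).toAddSubgroup ⊔ M.map (AddMonoidHom.mulLeft 2))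
    (h' : ∀ z ∈ M, (c : k) * z ∈ fractionSubring oddSubmonoid k) :
    M ≤ (fractionSubring oddSubmonoid k).toAddSubgroup := by
  have key : ∀ e : ℕ, ∀ z ∈ M, ∃ y ∈ fractionSubring oddSubmonoid k, ∃ w ∈ M,
      z = y + 2 ^ e * w := by
    intro e
    induction e with
    | zero => exact fun z hz => ⟨0, zero_mem _, z, hz, by simp⟩
    | succ e ih =>
      intro z hz
      obtain ⟨y, hy, w, hw, rfl⟩ := ih z hz
      obtain ⟨y', hy', _, ⟨w', hw', rfl⟩, rfl⟩ := AddSubgroup.mem_sup.1 (h hw)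
      refine ⟨y + 2 ^ e * y', add_mem hy (mul_mem (pow_mem ?_ _) hy'), w', hw', ?_⟩
      · exact_mod_cast natCast_mem (fractionSubring oddSubmonoid k) 2
      · rw [AddMonoidHom.coe_mulLeft]
        ring
  intro z hz
  obtain ⟨e, o, ho, rfl⟩ := Nat.exists_eq_two_pow_mul_odd hc
  obtain ⟨y, hy, w, hw, rfl⟩ := key e z hz
  refine mem_fractionSubring_of_mul (S := oddSubmonoid) ho ?_
  have h1 := h' w hw
  push_cast at h1
  rw [mul_add, ← mul_assoc, mul_comm (o : k)]
  exact add_mem (by rw [mul_comm]; exact mul_mem (natCast_mem _ _) hy) (by rwa [mul_comm (o : k)])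

/-! ### Orbits of classes -/

section Orbits

variable {𝔛 : Type u} [TopologicalSpace 𝔛] [IsCantorSpace 𝔛]

/-- `O` is covered by a single orbit of at least two classes of the coarsest partition of `U`. -/
def IsClassOrbit (U : Subgroup (𝔛 ≃ₜ 𝔛)) (O : Set 𝔛) : Prop :=
  (∀ x ∈ O, ∀ y ∈ O, ∃ g ∈ U, coarsest U y (g x)) ∧ ∃ x ∈ O, ∃ y ∈ O, ¬ coarsest U x y

theorem IsClassOrbit.map_conj {U : Subgroup (𝔛 ≃ₜ 𝔛)} (hU : IsOpen (U : Set (𝔛 ≃ₜ 𝔛)))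
    {O : Set 𝔛} (h : IsClassOrbit U O) {g : 𝔛 ≃ₜ 𝔛} (hg : ∀ x, g x ∈ O ↔ x ∈ O) :
    IsClassOrbit (U.map (MulAut.conj g).toMonoidHom) O := by
  have hg' : ∀ x ∈ O, g.symm x ∈ O := fun x hx => (hg _).1 (by rwa [g.apply_symm_apply])
  rw [IsClassOrbit, coarsest_map_conj hU]
  constructor
  · intro x hx y hy
    obtain ⟨v, hv, h1⟩ := h.1 _ (hg' x hx) _ (hg' y hy)
    refine ⟨_, ⟨v, hv, rfl⟩, ?_⟩
    change coarsest U (g.symm y) (g.symm (g (v (g.symm x))))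
    rwa [g.symm_apply_apply]
  · obtain ⟨x, hx, y, hy, h1⟩ := h.2
    exact ⟨g x, (hg x).2 hx, g y, (hg y).2 hy, by rwa [Setoid.translate_apply_apply]⟩

/-- Some class is moved by `U`. The union `O` of its translates is clopen and stable under `U`, so
separating it from its complement refines `r` without leaving `U` outside the fixer. -/
theorem exists_isClassOrbit {U : Subgroup (𝔛 ≃ₜ 𝔛)} (hU : IsOpen (U : Set (𝔛 ≃ₜ 𝔛)))
    {r : Setoid 𝔛} (hr : r.IsOpenRel) (hUr : U ≤ r.fixer) (h : ¬ U ≤ (coarsest U).fixer) :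
    ∃ (r' : Setoid 𝔛) (O : Set 𝔛), r'.IsOpenRel ∧ r' ≤ r ∧ U ≤ r'.fixer ∧ IsClassOrbit U O ∧
      (∀ x ∈ O, ∀ y ∈ O, r' x y) ∧ ∀ x y, r' x y → x ∈ O → y ∈ O := by
  obtain ⟨v, hv, hvs⟩ := Set.not_subset.1 h
  obtain ⟨u, hu⟩ : ∃ u, ¬ coarsest U (v u) u := not_forall.1 hvs
  have hs := coarsest_isOpenRel hU
  have hsr : coarsest U ≤ r := le_of_fixer_le hr hs ((fixer_coarsest_le hU).trans hUr)
  let O : Set 𝔛 := {z | ∃ g ∈ U, coarsest U z (g u)}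
  have hO : IsClopen O := hs.isClopen_of_saturated fun x y hxy ⟨g, hg, h1⟩ =>
    ⟨g, hg, (coarsest U).trans ((coarsest U).symm hxy) h1⟩
  have hUO : ∀ g ∈ U, ∀ x ∈ O, g x ∈ O := by
    rintro g hg x ⟨g', hg', h1⟩
    exact ⟨g * g', U.mul_mem hg hg', (coarsest_apply_apply hU hg _ _).2 h1⟩
  have hUO' : ∀ g ∈ U, ∀ x, g x ∈ O ↔ x ∈ O := by
    refine fun g hg x => ⟨fun hx => ?_, hUO g hg x⟩
    have := hUO g⁻¹ (U.inv_mem hg) _ hx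
    change g.symm (g x) ∈ O at this
    rwa [g.symm_apply_apply] at this
  have hOr : ∀ x ∈ O, r x u := fun x ⟨g, hg, h1⟩ => r.trans (hsr h1) (hUr hg u)
  refine ⟨r ⊓ Setoid.ker (· ∈ O), O,
    hr.inf (Setoid.IsOpenRel.of_isLocallyConstant (isLocallyConstant_mem hO)), inf_le_left,
    fun g hg x => ⟨hUr hg x, propext (hUO' g hg x)⟩, ⟨?_, ?_⟩, fun x hx y hy =>
    ⟨r.trans (hOr x hx) (r.symm (hOr y hy)), propext (iff_of_true hx hy)⟩,
    fun x y h hx => (Iff.of_eq h.2).1 hx⟩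
  · rintro x ⟨g, hg, h1⟩ y ⟨g', hg', h2⟩
    refine ⟨g' * g⁻¹, U.mul_mem hg' (U.inv_mem hg), (coarsest U).trans h2 ?_⟩
    change coarsest U (g' u) (g' (g.symm x))
    rw [coarsest_apply_apply hU hg', ← coarsest_apply_apply hU hg, g.apply_symm_apply]
    exact (coarsest U).symm h1
  · exact ⟨v u, ⟨v, hv, (coarsest U).refl _⟩, u, ⟨1, U.one_mem, (coarsest U).refl _⟩, hu⟩

end Orbits

/-! ### Denominators of the values -/

namespace GMeasure

open FinGSet

variable {𝔛 : Type u} [TopologicalSpace 𝔛] {k : Type v} [CommRing k]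

/-- The additive group generated by the values of a measure on transitive `G`-sets of bounded
symmetry index over the coset spaces of fixers. -/
def valueSubgroup (m : GMeasure (𝔛 ≃ₜ 𝔛) k) (N : ℕ) : AddSubgroup k :=
  AddSubgroup.closure {z | ∃ (X Y : FinGSet (𝔛 ≃ₜ 𝔛)) (_ : X.IsTransitive) (hY : Y.IsTransitive)
    (f : X →[𝔛 ≃ₜ 𝔛] Y) (x : X) (r : Setoid 𝔛), r.IsOpenRel ∧
    MulAction.stabilizer (𝔛 ≃ₜ 𝔛) (f x) = r.fixer ∧
    symIndex (MulAction.stabilizer (𝔛 ≃ₜ 𝔛) x) ≤ N ∧ z = m.toFun ⟨X, Y, f, hY⟩}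

theorem map_mem_valueSubgroup (m : GMeasure (𝔛 ≃ₜ 𝔛) k) {N : ℕ} {X Y : FinGSet (𝔛 ≃ₜ 𝔛)}
    (hX : X.IsTransitive) (hY : Y.IsTransitive) (f : X →[𝔛 ≃ₜ 𝔛] Y) {x : X} {r : Setoid 𝔛}
    (hr : r.IsOpenRel) (hy : MulAction.stabilizer (𝔛 ≃ₜ 𝔛) (f x) = r.fixer)
    (hN : symIndex (MulAction.stabilizer (𝔛 ≃ₜ 𝔛) x) ≤ N) :
    m.toFun ⟨X, Y, f, hY⟩ ∈ m.valueSubgroup N :=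
  AddSubgroup.subset_closure ⟨X, Y, hX, hY, f, x, r, hr, hy, hN, rfl⟩

variable [IsCantorSpace 𝔛]

/-- Base change to the partition that cuts `O` along one class `B` of the coarsest partition for
`x`. The stabilizers become `U' ⊓ r₁.fixer`, with `U'` conjugate to the old one by an element of
`r.fixer`, which preserves `O`. -/
theorem map_mem_sup_of_isClassOrbit {m : GMeasure (𝔛 ≃ₜ 𝔛) k} (hm : m.base = -2) {N : ℕ}
    {K : AddSubgroup k} (hK : m.valueSubgroup N ≤ K)
    {X Y : FinGSet (𝔛 ≃ₜ 𝔛)} (hX : X.IsTransitive) (hY : Y.IsTransitive) (f : X →[𝔛 ≃ₜ 𝔛] Y) (x : X)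
    {r : Setoid 𝔛} (hr : r.IsOpenRel) (hy : MulAction.stabilizer (𝔛 ≃ₜ 𝔛) (f x) = r.fixer)
    (hN : symIndex (MulAction.stabilizer (𝔛 ≃ₜ 𝔛) x) ≤ N + 1) {O : Set 𝔛}
    (hO : IsClassOrbit (MulAction.stabilizer (𝔛 ≃ₜ 𝔛) x) O)
    (hrO : ∀ x ∈ O, ∀ y ∈ O, r x y) (hOr : ∀ x y, r x y → x ∈ O → y ∈ O) :
    m.toFun ⟨X, Y, f, hY⟩ ∈ K ⊔ (m.valueSubgroup (N + 1)).map (AddMonoidHom.mulLeft 2) := by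
  obtain ⟨u, hu, u', hu', huu⟩ := hO.2
  have hs := coarsest_isOpenRel (X.smooth x)
  set B : Set 𝔛 := {z | coarsest (MulAction.stabilizer (𝔛 ≃ₜ 𝔛) x) u z}
  have hB : IsClopen B := hs.isClopen u
  set r₁ := r ⊓ Setoid.ker (· ∈ B) with hr₁_def
  have hr₁ : r₁.IsOpenRel :=
    hr.inf (Setoid.IsOpenRel.of_isLocallyConstant (isLocallyConstant_mem hB))
  have hr₁B : ∀ x y, r₁ x y ↔ r x y ∧ (x ∈ B ↔ y ∈ B) := fun x y =>
    and_congr Iff.rfl eq_iff_iff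
  have hfib : ∀ x', f x' = f x → symIndex (MulAction.stabilizer (𝔛 ≃ₜ 𝔛) x') ≤ N + 1 ∧
      IsClassOrbit (MulAction.stabilizer (𝔛 ≃ₜ 𝔛) x') O := by
    intro x' hx'
    obtain ⟨g, rfl⟩ := hX.exists_smul_eq x x'
    have hg : g ∈ r.fixer := by
      rw [← hy, MulAction.mem_stabilizer_iff, ← map_smul, hx']
    rw [MulAction.stabilizer_smul_eq_stabilizer_map_conj, symIndex_map_conj (X.smooth x)]
    exact ⟨hN, hO.map_conj (X.smooth x) fun z => ⟨hOr _ _ (hg z), hOr _ _ (r.symm (hg z))⟩⟩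
  have hZ := coset_isTransitive _ hr₁.isOpen_fixer
  have hz := stabilizer_cosetOne _ hr₁.isOpen_fixer
  obtain ⟨p, hp⟩ := hZ.exists_hom (cosetOne _ hr₁.isOpen_fixer) (f x)
    (by rw [hz, hy]; exact Setoid.fixer_mono inf_le_left)
  have hc := pullback_isCartesian f p
  rw [← m.map_baseChange _ _ _ _ hY hZ _ _ _ _ hc]
  have hstab : ∀ a, pullbackSnd f p a = cosetOne _ hr₁.isOpen_fixer → ∃ x', f x' = f x ∧
      MulAction.stabilizer (𝔛 ≃ₜ 𝔛) a = MulAction.stabilizer (𝔛 ≃ₜ 𝔛) x' ⊓ r₁.fixer := by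
    intro a ha
    refine ⟨pullbackFst f p a, ?_, ?_⟩
    · rw [hc.1, ha, hp]
    · rw [hc.stabilizer, ha, hz]
  revert hstab
  refine induction_hom (P := fun X₁ f₁ => (∀ a, f₁ a = cosetOne _ hr₁.isOpen_fixer →
    ∃ x', f x' = f x ∧ MulAction.stabilizer (𝔛 ≃ₜ 𝔛) a =
      MulAction.stabilizer (𝔛 ≃ₜ 𝔛) x' ⊓ r₁.fixer) → m.toFun ⟨X₁, _, f₁, hZ⟩ ∈
      K ⊔ (m.valueSubgroup (N + 1)).map (AddMonoidHom.mulLeft 2)) ?_ ?_ ?_ _ _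
  · intro X₁ f₁ _ _
    rw [map_isEmpty]
    exact zero_mem _
  · intro X₁ X₂ X₃ f₁ i₁ i₂ hd h1 h2 hst
    rw [m.map_add _ _ _ _ hZ f₁ i₁ i₂ hd]
    refine add_mem (h1 fun a ha => ?_) (h2 fun a ha => ?_)
    · rw [← stabilizer_eq_of_injective i₁ hd.1]
      exact hst (i₁ a) ha
    · rw [← stabilizer_eq_of_injective i₂ hd.2.1]
      exact hst (i₂ a) ha
  · intro X₁ f₁ hX₁ hst
    have := hX₁.nonempty
    obtain ⟨a, ha⟩ := hZ.surjective f₁ (cosetOne _ hr₁.isOpen_fixer)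
    obtain ⟨x', hx', hax⟩ := hst a ha
    obtain ⟨hN', hO'⟩ := hfib x' hx'
    -- Either the index has dropped and induction applies, or it is at least that of `U'`, the
    -- pieces in `O \ B` can be merged, and a factor `base = -2` splits off.
    by_cases hlt : symIndex (MulAction.stabilizer (𝔛 ≃ₜ 𝔛) a) ≤ N
    · exact le_sup_left (a := K) (hK (m.map_mem_valueSubgroup hX₁ hZ f₁ hr₁ (ha ▸ hz) hlt))
    · obtain ⟨t, ht⟩ := exists_merge (X.smooth x') (r := r) hr₁ hO'.1 hO'.2 hrO hOr hr₁B
        ⟨u, hu, (coarsest _).refl u⟩ ⟨u', hu', huu⟩ (by rw [← hax]; omega)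
      rw [← hax] at ht
      obtain ⟨X₂, hX₂, f₂, x₂, j, hx₂, hsym, hval⟩ := m.exists_map_eq_mul_base_pow hX₁ hZ f₁ a
        (by rw [ha, hz]) ht.1 ht.2.1 ht.2.2.1 ht.2.2.2.1 ht.2.2.2.2
      refine le_sup_right (a := K) ⟨-((-2) ^ j : ℤ) • m.toFun ⟨X₂, _, f₂, hZ⟩, ?_, ?_⟩
      · refine zsmul_mem (m.map_mem_valueSubgroup hX₂ hZ f₂ hr₁ (x := x₂) ?_ ?_) _
        · rw [hx₂, ha, hz]
        · rw [hax, symIndex_inf_fixer (X.smooth x') hr₁] at hsym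
          exact (hsym.trans (Subgroup.relIndex_le_of_le_right inf_le_left
            (symIndex_ne_zero (X.smooth x')))).trans hN'
      · rw [hval, hm, AddMonoidHom.coe_mulLeft, zsmul_eq_mul]
        push_cast
        ring

/-- If the stabilizer is itself a fixer, the value is a power of `-2`. Otherwise the map factors
through a partition isolating an orbit of classes, and the second factor has an integral value. -/
theorem valueSubgroup_le_sup {m : GMeasure (𝔛 ≃ₜ 𝔛) k} (hm : m.base = -2) {N : ℕ}
    {S : Subring k} (hS : m.valueSubgroup N ≤ S.toAddSubgroup) :
    m.valueSubgroup (N + 1) ≤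
      S.toAddSubgroup ⊔ (m.valueSubgroup (N + 1)).map (AddMonoidHom.mulLeft 2) := by
  have hbase : ∀ j : ℕ, m.base ^ j = ((-2) ^ j : ℤ) := fun j => by
    rw [hm]
    push_cast
    rfl
  refine (AddSubgroup.closure_le _).2 ?_
  rintro _ ⟨X, Y, hX, hY, f, x, r, hr, hy, hN, rfl⟩
  have hUr := (stabilizer_le_of_hom f x).trans hy.le
  by_cases hle : MulAction.stabilizer (𝔛 ≃ₜ 𝔛) x ≤
      (coarsest (MulAction.stabilizer (𝔛 ≃ₜ 𝔛) x)).fixer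
  · have hs := coarsest_isOpenRel (X.smooth x)
    have hx := le_antisymm hle (fixer_coarsest_le (X.smooth x))
    rw [(m.isRelValue hs (le_of_fixer_le hr hs (hx ▸ hUr))).eq hX hY f x hx hy, hbase]
    exact le_sup_left (a := S.toAddSubgroup) (intCast_mem S _)
  · obtain ⟨r', O, hr', hle', hUr', hO, h1, h2⟩ := exists_isClassOrbit (X.smooth x) hr hUr hle
    have hZ := coset_isTransitive _ hr'.isOpen_fixer
    have hz := stabilizer_cosetOne _ hr'.isOpen_fixer
    obtain ⟨p, hp⟩ := hX.exists_hom x (cosetOne _ hr'.isOpen_fixer) (by rw [hz]; exact hUr')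
    obtain ⟨q, hq⟩ := hZ.exists_hom (cosetOne _ hr'.isOpen_fixer) (f x)
      (by rw [hz, hy]; exact Setoid.fixer_mono hle')
    have hf : f = q.comp p := hX.hom_ext x (by rw [← hq, ← hp]; rfl)
    have hmem := map_mem_sup_of_isClassOrbit hm hS hX hZ p x hr' (by rw [hp, hz]) hN hO h1 h2
    have hval := (m.isRelValue hr' hle').eq hZ hY q _ hz (by rw [hq, hy])
    simp only [hf]
    rw [m.map_comp _ _ _ hZ hY, hval, hbase, ← zsmul_eq_mul]
    exact zsmul_mem hmem _

/-- Induction on the index bound; `(N + 1)!` is a multiple of every symmetry index that occurs, so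
it clears all denominators. -/
theorem valueSubgroup_le_fractionSubring {m : GMeasure (𝔛 ≃ₜ 𝔛) k} (hm : m.base = -2) (N : ℕ) :
    m.valueSubgroup N ≤ (fractionSubring oddSubmonoid k).toAddSubgroup := by
  induction N with
  | zero =>
    refine (AddSubgroup.closure_le _).2 ?_
    rintro _ ⟨X, Y, hX, hY, f, x, r, hr, hy, hN, rfl⟩
    exact (symIndex_ne_zero (X.smooth x) (Nat.le_zero.1 hN)).elim
  | succ N ih =>
    refine le_fractionSubring_of_le_sup (Nat.factorial_ne_zero (N + 1))
      (valueSubgroup_le_sup hm ih) fun z hz => ?_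
    refine (AddSubgroup.closure_le ((fractionSubring oddSubmonoid k).toAddSubgroup.comap
      (AddMonoidHom.mulLeft ((N + 1).factorial : k)))).2 ?_ hz
    rintro _ ⟨X, Y, hX, hY, f, x, r, hr, hy, hN, rfl⟩
    have h1 := m.symIndex_mul_map hX hY f x
    rw [hy, symIndex_fixer hr, Nat.cast_one, one_mul, hm] at h1
    obtain ⟨c, hc⟩ := Nat.dvd_factorial
      (Nat.pos_of_ne_zero (symIndex_ne_zero (X.smooth x))) hN
    change ((N + 1).factorial : k) * _ ∈ fractionSubring oddSubmonoid k
    rw [hc, mul_comm (symIndex _), Nat.cast_mul, mul_assoc, h1]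
    refine mul_mem (natCast_mem _ _) (pow_mem ?_ _)
    exact_mod_cast intCast_mem (fractionSubring oddSubmonoid k) (-2)

theorem map_mem_of_isTransitive {m : GMeasure (𝔛 ≃ₜ 𝔛) k} {S : Subring k}
    (h : ∀ (X Y : FinGSet (𝔛 ≃ₜ 𝔛)) (_ : X.IsTransitive) (hY : Y.IsTransitive)
      (f : X →[𝔛 ≃ₜ 𝔛] Y) (x : X) (r : Setoid 𝔛), r.IsOpenRel →
      MulAction.stabilizer (𝔛 ≃ₜ 𝔛) (f x) = r.fixer → m.toFun ⟨X, Y, f, hY⟩ ∈ S)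
    (f : TMap (𝔛 ≃ₜ 𝔛)) : m.toFun f ∈ S := by
  obtain ⟨X, Y, f, hY⟩ := f
  obtain ⟨y⟩ := hY.nonempty
  obtain ⟨W, w, q, hW, rfl, hw, -⟩ := exists_fixer_cover y
  have hc := pullback_isCartesian f q
  rw [← m.map_baseChange _ _ _ _ hY hW _ _ _ _ hc]
  refine induction_hom (P := fun X₁ f₁ => m.toFun ⟨X₁, W, f₁, hW⟩ ∈ S) ?_ ?_ ?_ _ _
  · intro X₁ f₁ _
    rw [map_isEmpty]
    exact zero_mem _
  · intro X₁ X₂ X₃ f₁ i₁ i₂ hd h1 h2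
    rw [m.map_add _ _ _ _ hW f₁ i₁ i₂ hd]
    exact add_mem h1 h2
  · intro X₁ f₁ hX₁
    have := hX₁.nonempty
    obtain ⟨a, ha⟩ := hW.surjective f₁ w
    exact h X₁ W hX₁ hW f₁ a _ (coarsest_isOpenRel (Y.smooth _)) (by rw [ha, hw])

theorem map_mem_fractionSubring_odd {m : GMeasure (𝔛 ≃ₜ 𝔛) k} (hm : m.base = -2)
    (f : TMap (𝔛 ≃ₜ 𝔛)) : m.toFun f ∈ fractionSubring oddSubmonoid k :=
  map_mem_of_isTransitive (fun _ _ hX hY f _ _ hr hy => valueSubgroup_le_fractionSubring hm _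
    (m.map_mem_valueSubgroup hX hY f hr hy le_rfl)) f

theorem map_mem_fractionSubring_nonZeroDivisors {m : GMeasure (𝔛 ≃ₜ 𝔛) k} (hm : m.base = -1)
    (f : TMap (𝔛 ≃ₜ 𝔛)) : m.toFun f ∈ fractionSubring (nonZeroDivisors ℕ) k := by
  refine map_mem_of_isTransitive (fun X Y hX hY f x r hr hy => ?_) f
  have h1 := m.symIndex_mul_map hX hY f x
  rw [hy, symIndex_fixer hr, Nat.cast_one, one_mul, hm] at h1
  refine mem_fractionSubring_of_mul
    (mem_nonZeroDivisors_of_ne_zero (symIndex_ne_zero (X.smooth x))) ?_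
  rw [h1]
  exact pow_mem (neg_mem (one_mem _)) _

end GMeasure

/-! ### Values of the constructed measures and inverses of integers -/

namespace GMeasure

open FinGSet

variable {𝔛 : Type u} [TopologicalSpace 𝔛] [IsCantorSpace 𝔛] {k : Type v} [CommRing k]

theorem isPowerMeasure_volumeMeasure (a : ℚ) (ha : a ≠ 0)
    (ha2 : ∀ n : ℕ, n ≠ 0 → (2 + a) ^ n = 2 + a) :
    IsPowerMeasure 𝔛 a (volumeMeasure a ha ha2) := by
  constructor
  · intro f hf
    exact (div_ne_zero (volume_ne_zero ha hf) (volume_ne_zero ha f.transitive)).isUnit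
  · intro n hn
    obtain ⟨φ⟩ := (cantorX_isTransitive (𝔛 := 𝔛) (Nat.one_le_iff_ne_zero.1 hn)).nonempty
    have h1 : volume a (point (𝔛 ≃ₜ 𝔛)) = a := by
      refine (volume_transitive point_isTransitive (PUnit.unit : point (𝔛 ≃ₜ 𝔛))).trans ?_
      refine (congrArg (weight a) (?_ : _ = (⊤ : Setoid 𝔛).fixer)).trans ?_
      · rw [Setoid.fixer_top]
        exact eq_top_iff.2 fun _ _ => rfl
      · rw [weight_fixer Setoid.IsOpenRel.top, Setoid.numClasses_top, pow_one]
    have h2 : volume a (cantorX 𝔛 n) = a ^ n := by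
      refine (volume_transitive (cantorX_isTransitive (Nat.one_le_iff_ne_zero.1 hn)) φ).trans ?_
      refine (congrArg (weight a) (stabilizer_cantorX φ)).trans ?_
      rw [weight_fixer (isOpenRel_ker_contSurj φ), Setoid.numClasses_ker_of_surjective φ.2]
    change volume a (cantorX 𝔛 n) / volume a (point (𝔛 ≃ₜ 𝔛)) = _
    rw [h1, h2, div_eq_iff ha, ← pow_succ, Nat.sub_add_cancel hn]

theorem base_of_isPowerMeasure {α : ℚ} {m : GMeasure (𝔛 ≃ₜ 𝔛) ℚ} (h : IsPowerMeasure 𝔛 α m) :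
    m.base = α :=
  (h.2 2 one_le_two).trans (pow_one α)

/-- A Bézout relation between `d` and `c ^ (d - 1)`, the latter being `d` times a value of the
measure. -/
theorem exists_natCast_mul_eq_one (m : GMeasure (𝔛 ≃ₜ 𝔛) k) {c : ℤ} (hm : m.base = c) {d : ℕ}
    (hd : d ≠ 0) (hcd : IsCoprime (d : ℤ) (c ^ (d - 1))) :
    ∃ (u v : ℤ) (X : FinGSet (𝔛 ≃ₜ 𝔛)), (d : k) * (u + v * m.ofSet X) = 1 := by
  obtain ⟨X, hX⟩ := m.exists_natCast_mul_eq_base_pow hd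
  obtain ⟨u, v, huv⟩ := hcd
  refine ⟨u, v, X, ?_⟩
  have := congrArg (Int.cast : ℤ → k) huv
  push_cast at this
  rw [hm] at hX
  linear_combination this + (v : k) * hX

end GMeasure

theorem isCoprime_neg_two_pow {d : ℕ} (hd : Odd d) (n : ℕ) : IsCoprime (d : ℤ) ((-2) ^ n) := by
  refine IsCoprime.pow_right ((IsCoprime.neg_right_iff _ _).2 ?_)
  exact_mod_cast Nat.isCoprime_iff_coprime.2 (Nat.coprime_two_right.2 hd)

theorem isCoprime_neg_one_pow (d n : ℕ) : IsCoprime (d : ℤ) ((-1) ^ n) :=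
  IsCoprime.pow_right ((IsCoprime.neg_right_iff _ _).2 isCoprime_one_right)

theorem mem_ZLocTwo_iff {q : ℚ} : q ∈ ZLocTwo ↔ Odd q.den := Iff.rfl

theorem mem_ZLocTwo_of_mem_fractionSubring {q : ℚ} (h : q ∈ fractionSubring oddSubmonoid ℚ) :
    q ∈ ZLocTwo := by
  obtain ⟨d, hd, n, h⟩ := h
  have hd0 : (d : ℚ) ≠ 0 := Nat.cast_ne_zero.2 (Odd.pos hd).ne'
  have hq : q = Rat.divInt n d := by
    rw [Rat.divInt_eq_div, ← h]
    push_cast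
    field_simp
  refine mem_ZLocTwo_iff.2 (Odd.of_dvd_nat hd ?_)
  rw [hq]
  exact_mod_cast Rat.den_dvd n d

/-! ### The structure of `Θ(G)` -/

namespace Theta

open GMeasure

variable {G : Type u} [Group G] [TopologicalSpace G] {k : Type v} [CommRing k]

theorem map_mem_of_forall_cls (φ : Theta G →+* k) {S : Subring k} (h : ∀ f, φ (cls f) ∈ S)
    (z : Theta G) : φ z ∈ S := by
  obtain ⟨p, rfl⟩ := Ideal.Quotient.mk_surjective z
  induction p using MvPolynomial.induction_on with
  | C n =>
    have : φ (Ideal.Quotient.mk (thetaIdeal G) (MvPolynomial.C n)) = n :=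
      eq_intCast ((φ.comp (Ideal.Quotient.mk (thetaIdeal G))).comp MvPolynomial.C) n
    rw [this]
    exact intCast_mem S n
  | add p q hp hq =>
    rw [_root_.map_add, _root_.map_add]
    exact add_mem hp hq
  | mul_X p f hp =>
    rw [map_mul, map_mul]
    exact mul_mem hp (h f)

variable {𝔛 : Type u} [TopologicalSpace 𝔛] [IsCantorSpace 𝔛]

theorem lift_base (μ : GMeasure (𝔛 ≃ₜ 𝔛) k) : lift μ (univMeasure (𝔛 ≃ₜ 𝔛)).base = μ.base :=
  lift_cls μ _

/-- If the values of all measures with value `c` on `X(2)` are fractions with invertible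
denominators, then a rational point of a ring generated by the values of a measure detects the
elements of that ring modulo `base - c`. -/
theorem _root_.GMeasure.mem_span_of_apply_eq_zero {R : Type w} [CommRing R]
    (m : GMeasure (𝔛 ≃ₜ 𝔛) R)
    (hgen : ∀ (k : Type w) [CommRing k] (ψ : R →+* k) (T : Subring k), (∀ f, ψ (m.toFun f) ∈ T) →
      ∀ z, ψ z ∈ T)
    {φ : R →+* ℚ} {c : ℤ} (hφ : φ m.base = c) {S : Submonoid ℕ}
    (hS : ∀ d ∈ S, d ≠ 0 ∧ IsCoprime (d : ℤ) (c ^ (d - 1)))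
    (hmem : ∀ (k : Type w) [CommRing k] (m : GMeasure (𝔛 ≃ₜ 𝔛) k), m.base = c →
      ∀ f, m.toFun f ∈ fractionSubring S k) {z : R} (hz : φ z = 0) :
    z ∈ Ideal.span {m.base - (c : R)} := by
  set I := Ideal.span {m.base - (c : R)} with hI
  have hbase : (m.map (Ideal.Quotient.mk I)).base = c := by
    rw [base_map, ← map_intCast (Ideal.Quotient.mk I)]
    exact Ideal.Quotient.eq.2 (Ideal.subset_span rfl)
  have hker : I ≤ RingHom.ker φ := by
    rw [hI, Ideal.span_singleton_le_iff_mem, RingHom.mem_ker, map_sub, hφ, map_intCast, sub_self]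
  -- Modulo `I` the element `z` satisfies `d z = n`. Applying `φ` gives `n = 0`, and `d` is a unit
  -- modulo `I`, so `z` vanishes there.
  obtain ⟨d, hd, n, hdn⟩ := hgen _ (Ideal.Quotient.mk I) _ (hmem _ _ hbase) z
  have h1 : (d : R) * z - n ∈ I := by
    rw [← Ideal.Quotient.eq, map_mul, map_natCast, map_intCast, hdn]
  have h2 := hker h1
  rw [RingHom.mem_ker, map_sub, map_mul, hz, mul_zero, map_intCast, zero_sub, neg_eq_zero,
    Int.cast_eq_zero] at h2
  rw [h2, Int.cast_zero] at hdn
  obtain ⟨hd0, hcd⟩ := hS d hd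
  obtain ⟨u, v, X, hu⟩ := (m.map (Ideal.Quotient.mk I)).exists_natCast_mul_eq_one hbase hd0 hcd
  rw [← Ideal.Quotient.eq_zero_iff_mem, ← one_mul (Ideal.Quotient.mk I z), ← hu, mul_right_comm,
    hdn, zero_mul]

theorem mem_span_of_lift_eq_zero {μ : GMeasure (𝔛 ≃ₜ 𝔛) ℚ} {c : ℤ} (hμ : μ.base = c)
    {S : Submonoid ℕ}
    (hS : ∀ d ∈ S, d ≠ 0 ∧ IsCoprime (d : ℤ) (c ^ (d - 1)))
    (hmem : ∀ (k : Type (u + 1)) [CommRing k] (m : GMeasure (𝔛 ≃ₜ 𝔛) k), m.base = c →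
      ∀ f, m.toFun f ∈ fractionSubring S k) {z : Theta (𝔛 ≃ₜ 𝔛)} (hz : lift μ z = 0) :
    z ∈ Ideal.span {(univMeasure (𝔛 ≃ₜ 𝔛)).base - (c : Theta (𝔛 ≃ₜ 𝔛))} :=
  (univMeasure (𝔛 ≃ₜ 𝔛)).mem_span_of_apply_eq_zero
    (fun _ _ ψ _ h => map_mem_of_forall_cls ψ h) ((lift_base μ).trans hμ) hS hmem hz

theorem exists_lift_eq_div {μ : GMeasure (𝔛 ≃ₜ 𝔛) ℚ} {c : ℤ} (hμ : μ.base = c) (q : ℚ)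
    (hq : IsCoprime (q.den : ℤ) (c ^ (q.den - 1))) : ∃ z, lift μ z = q := by
  obtain ⟨u, v, X, h⟩ := μ.exists_natCast_mul_eq_one hμ q.den_ne_zero hq
  refine ⟨q.num * (u + v * (univMeasure (𝔛 ≃ₜ 𝔛)).ofSet X), ?_⟩
  have h1 : lift μ ((univMeasure (𝔛 ≃ₜ 𝔛)).ofSet X) = μ.ofSet X := lift_cls μ _
  rw [map_mul, _root_.map_add, map_mul, map_intCast, map_intCast, map_intCast, h1]
  have h2 := Rat.mul_den_eq_num q
  rw [← h2, mul_assoc, h, mul_one]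

/-- The kernels of the two homomorphisms lie in the ideals generated by `a + 2` and `a + 1`. These
have difference `1` and product zero, so the kernels meet trivially and the two factors can be
prescribed independently. -/
theorem exists_ringEquiv {μ ν : GMeasure (𝔛 ≃ₜ 𝔛) ℚ} (hμ : μ.base = -2) (hν : ν.base = -1) :
    ∃ e : Theta (𝔛 ≃ₜ 𝔛) ≃+* ZLocTwo × ℚ, ∀ z : Theta (𝔛 ≃ₜ 𝔛),
      ((e z).1 : ℚ) = lift μ z ∧ (e z).2 = lift ν z := by
  have hμ' : μ.base = (-2 : ℤ) := by rw [hμ]; norm_num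
  have hν' : ν.base = (-1 : ℤ) := by rw [hν]; norm_num
  have hmem : ∀ z, lift μ z ∈ ZLocTwo := map_mem_of_forall_cls _ fun f => by
    rw [lift_cls]
    exact mem_ZLocTwo_of_mem_fractionSubring (map_mem_fractionSubring_odd hμ f)
  set a := (univMeasure (𝔛 ≃ₜ 𝔛)).base with ha
  have hμa : lift μ a = -2 := (lift_base μ).trans hμ
  have hνa : lift ν a = -1 := (lift_base ν).trans hν
  have hquad : (a + 1) * (a + 2) = 0 := (univMeasure (𝔛 ≃ₜ 𝔛)).base_eq.1
  have hbij : Bijective (((lift μ).codRestrict ZLocTwo hmem).prod (lift ν)) := by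
    constructor
    · rw [injective_iff_map_eq_zero]
      intro z hz
      have h1 : lift μ z = 0 := congrArg (fun p : ZLocTwo × ℚ => (p.1 : ℚ)) hz
      have h2 : lift ν z = 0 := congrArg Prod.snd hz
      obtain ⟨y, rfl⟩ := Ideal.mem_span_singleton.1 (mem_span_of_lift_eq_zero hμ'
        (S := oddSubmonoid) (fun d hd => ⟨(Odd.pos hd).ne', isCoprime_neg_two_pow hd _⟩)
        (fun k _ m hm => map_mem_fractionSubring_odd (by rw [hm]; norm_num)) h1)
      obtain ⟨w, hw⟩ := Ideal.mem_span_singleton.1 (mem_span_of_lift_eq_zero hν'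
        (S := nonZeroDivisors ℕ) (fun d hd => ⟨nonZeroDivisors.ne_zero hd,
          isCoprime_neg_one_pow _ _⟩)
        (fun k _ m hm => map_mem_fractionSubring_nonZeroDivisors (by rw [hm]; norm_num)) h2)
      rw [← ha] at hw ⊢
      push_cast at hw ⊢
      -- An element `z = (a + 2) y = (a + 1) w` equals `(a + 2) z - (a + 1) z`, where both terms
      -- contain `(a + 1)(a + 2)`.
      linear_combination (a + 2) * hw - y * hquad + w * hquad
    · rintro ⟨⟨p, hp⟩, q⟩
      obtain ⟨y, hy⟩ := exists_lift_eq_div hμ' p (isCoprime_neg_two_pow hp _)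
      obtain ⟨w, hw⟩ := exists_lift_eq_div hν' q (isCoprime_neg_one_pow _ _)
      -- `-(a + 1)` maps to `1` under `μ` and `0` under `ν`, and `a + 2` the other way round.
      refine ⟨-(a + 1) * y + (a + 2) * w, Prod.ext (Subtype.ext ?_) ?_⟩
      · change lift μ _ = p
        rw [_root_.map_add, map_mul, map_mul, map_neg, _root_.map_add, _root_.map_add, hμa, hy,
          map_one, map_ofNat]
        ring
      · change lift ν _ = q
        rw [_root_.map_add, map_mul, map_mul, map_neg, _root_.map_add, _root_.map_add, hνa, hw,
          map_one, map_ofNat]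
        ring
  exact ⟨RingEquiv.ofBijective _ hbij, fun z => ⟨rfl, rfl⟩⟩

end Theta

theorem mainTheorem1 (𝔛 : Type u) [TopologicalSpace 𝔛] [IsCantorSpace 𝔛] :
    ∃ μ ν : GMeasure (𝔛 ≃ₜ 𝔛) ℚ,
      -- `μ` and `ν` are the unique regular measures with the prescribed values on the `X(n)`
      (IsPowerMeasure 𝔛 (-2) μ ∧ ∀ μ', IsPowerMeasure 𝔛 (-2) μ' → μ' = μ) ∧
      (IsPowerMeasure 𝔛 (-1) ν ∧ ∀ ν', IsPowerMeasure 𝔛 (-1) ν' → ν' = ν) ∧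
      -- the pair `(μ, ν)` induces a ring isomorphism `Θ(G) ≅ ℤ₍₂₎ × ℚ`
      (∃ e : Theta (𝔛 ≃ₜ 𝔛) ≃+* ZLocTwo × ℚ, ∀ z : Theta (𝔛 ≃ₜ 𝔛),
        ((e z).1 : ℚ) = Theta.lift μ z ∧ (e z).2 = Theta.lift ν z) ∧
      -- over every field of characteristic zero there are exactly two measures, `μ` and `ν`
      (∀ (k : Type v) [Field k] [CharZero k],
        μ.map (algebraMap ℚ k) ≠ ν.map (algebraMap ℚ k) ∧
        ∀ m : GMeasure (𝔛 ≃ₜ 𝔛) k,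
          m = μ.map (algebraMap ℚ k) ∨ m = ν.map (algebraMap ℚ k)) := by
  have h2 : ∀ n : ℕ, n ≠ 0 → (2 + (-2) : ℚ) ^ n = 2 + (-2) := fun n hn => by
    rw [add_neg_cancel, zero_pow hn]
  have h1 : ∀ n : ℕ, n ≠ 0 → (2 + (-1) : ℚ) ^ n = 2 + (-1) := fun n _ => by norm_num
  have hμ := GMeasure.isPowerMeasure_volumeMeasure (𝔛 := 𝔛) (-2) (by norm_num) h2
  have hν := GMeasure.isPowerMeasure_volumeMeasure (𝔛 := 𝔛) (-1) (by norm_num) h1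
  have bμ := GMeasure.base_of_isPowerMeasure hμ
  have bν := GMeasure.base_of_isPowerMeasure hν
  refine ⟨_, _, ⟨hμ, fun m hm => ?_⟩, ⟨hν, fun m hm => ?_⟩, Theta.exists_ringEquiv bμ bν,
    fun k _ _ => ⟨fun h => ?_, fun m => ?_⟩⟩
  · exact GMeasure.ext_of_base_eq ((GMeasure.base_of_isPowerMeasure hm).trans bμ.symm)
  · exact GMeasure.ext_of_base_eq ((GMeasure.base_of_isPowerMeasure hm).trans bν.symm)
  · have := congrArg GMeasure.base h
    rw [GMeasure.base_map, GMeasure.base_map, bμ, bν] at this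
    norm_num at this
  · rcases mul_eq_zero.1 m.base_eq.1 with h | h
    · refine Or.inr (GMeasure.ext_of_base_eq ?_)
      rw [GMeasure.base_map, bν, map_neg, map_one, eq_neg_of_add_eq_zero_left h]
    · refine Or.inl (GMeasure.ext_of_base_eq ?_)
      rw [GMeasure.base_map, bμ, map_neg, map_ofNat, eq_neg_of_add_eq_zero_left h]
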